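/- A $4$-dimensional matrix of order $3$ is a real array $A=(a_\alpha)$ indexed by $\alpha=(\alpha_1,\alpha_2,\alpha_3,\alpha_4)\in\{0,1,2\}^4$. A line is a set of three indices obtained by fixing three coordinates and letting the remaining one vary; a hyperplane is obtained by fixing one coordinate, and that coordinate is its direction. Let $\Omega_3^4$ be the polytope of polystochastic matrices, i.e. of all such $A$ with nonnegative entries whose entries on each line sum to $1$. Two matrices are equivalent if one is obtained from the other by permuting hyperplanes of the same direction and/or permuting the directions. A matrix is symmetric if $a_{(\alpha_{\sigma(1)},\dots,\alpha_{\sigma(4)})}=a_\alpha$ for all $\alpha$ and all $\sigma\in S_4$. Let $N(A)$ be the number of nonzero entries of $A$, and let $\mathrm{per}\,A=\sum_{\ell}\prod_{\alpha\in\ell}a_\alpha$, where $\ell$ runs over the diagonals, i.e. the sets of three indices no two of which lie in a common hyperplane. Define matrices $A_1,\dots,A_{21}$ by the table below. The nine words in the last column are the rows, from top to bottom, of a $9\times 9$ array of one-digit integers, with rows and columns numbered from $0$; the entry $a_\alpha$ of $A_i$ is the integer in row $3\alpha_1+\alpha_3$ and column $3\alpha_2+\alpha_4$, divided by $\Delta_i$.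 $$ \begin{array}{r|c|c|c|l} i & \Delta_i & N_i & p_i & \text{array} \\ \hline 1 & 1 & 27 & 27 & \mathtt{100001010}\ \mathtt{001010100}\ \mathtt{010100001}\ \mathtt{001010100}\ \mathtt{010100001}\ \mathtt{100001010}\ \mathtt{010100001}\ \mathtt{100001010}\ \mathtt{001010100} \\ 2 & 2 & 49 & 21/2 & \mathtt{200020002}\ \mathtt{011101110}\ \mathtt{011101110}\ \mathtt{011101110}\ \mathtt{200011011}\ \mathtt{011110101}\ \mathtt{011101110}\ \mathtt{011110101}\ \mathtt{200011011} \\ 3 & 2 & 51 & 9 & \mathtt{200011011}\ \mathtt{011101110}\ \mathtt{011110101}\ \mathtt{011200011}\ \mathtt{110011101}\ \mathtt{101011110}\ \mathtt{011011200}\ \mathtt{101110011}\ \mathtt{110101011} \\ 4 & 2 & 52 & 33/4 & \mathtt{200011011}\ \mathtt{011101110}\ \mathtt{011110101}\ \mathtt{011101110}\ \mathtt{101020101}\ \mathtt{110101011}\ \mathtt{011110101}\ \mathtt{110101011}\ \mathtt{101011110} \\ 5 & 3 & 58 & 256/27 & \mathtt{300012021}\ \mathtt{021210102}\ \mathtt{012111210}\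 \mathtt{021210102}\ \mathtt{111102120}\ \mathtt{201021111}\ \mathtt{012111210}\ \mathtt{201021111}\ \mathtt{120201012} \\ 6 & 3 & 59 & 85/9 & \mathtt{300021012}\ \mathtt{021102210}\ \mathtt{012210111}\ \mathtt{021201111}\ \mathtt{201111021}\ \mathtt{111021201}\ \mathtt{012111210}\ \mathtt{111120102}\ \mathtt{210102021} \\ 7 & 3 & 59 & 85/9 & \mathtt{300021012}\ \mathtt{021201111}\ \mathtt{012111210}\ \mathtt{021201111}\ \mathtt{201012120}\ \mathtt{111120102}\ \mathtt{012111210}\ \mathtt{111120102}\ \mathtt{210102021} \\ 8 & 4 & 60 & 77/8 & \mathtt{400022022}\ \mathtt{022202220}\ \mathtt{022220202}\ \mathtt{031301112}\ \mathtt{301022121}\ \mathtt{112121211}\ \mathtt{013121310}\ \mathtt{121220103}\ \mathtt{310103031} \\ 9 & 4 & 60 & 39/4 & \mathtt{022202220}\ \mathtt{202031211}\ \mathtt{220211013}\ \mathtt{202031211}\ \mathtt{031310103}\ \mathtt{211103130}\ \mathtt{220211013}\ \mathtt{211103130}\ \mathtt{013130301} \\ 10 & 3 & 61 & 236/27 &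 \mathtt{111102120}\ \mathtt{111210012}\ \mathtt{111021201}\ \mathtt{201120012}\ \mathtt{012111210}\ \mathtt{120102111}\ \mathtt{021111201}\ \mathtt{210012111}\ \mathtt{102210021} \\ 11 & 3 & 61 & 236/27 & \mathtt{111102120}\ \mathtt{111210012}\ \mathtt{111021201}\ \mathtt{111021201}\ \mathtt{102111120}\ \mathtt{120201012}\ \mathtt{111210012}\ \mathtt{120012201}\ \mathtt{102111120} \\ 12 & 4 & 62 & 75/8 & \mathtt{400022022}\ \mathtt{022202220}\ \mathtt{022220202}\ \mathtt{013310121}\ \mathtt{310022112}\ \mathtt{121112211}\ \mathtt{031112301}\ \mathtt{112220112}\ \mathtt{301112031} \\ 13 & 5 & 62 & 1194/125 & \mathtt{500032023}\ \mathtt{032302221}\ \mathtt{023221311}\ \mathtt{032302221}\ \mathtt{302023230}\ \mathtt{221230104}\ \mathtt{023221311}\ \mathtt{221230104}\ \mathtt{311104140} \\ 14 & 4 & 62 & 73/8 & \mathtt{211202031}\ \mathtt{121220103}\ \mathtt{112022310}\ \mathtt{220112112}\ \mathtt{022112310}\ \mathtt{202220022}\ \mathtt{013130301}\ \mathtt{301112031}\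 \mathtt{130202112} \\ 15 & 3 & 63 & 26/3 & \mathtt{111102120}\ \mathtt{111021201}\ \mathtt{111210012}\ \mathtt{111111111}\ \mathtt{102210021}\ \mathtt{120012201}\ \mathtt{111120102}\ \mathtt{120102111}\ \mathtt{102111120} \\ 16 & 4 & 63 & 9 & \mathtt{211202031}\ \mathtt{121220103}\ \mathtt{112022310}\ \mathtt{202130112}\ \mathtt{022112310}\ \mathtt{220202022}\ \mathtt{031112301}\ \mathtt{301112031}\ \mathtt{112220112} \\ 17 & 5 & 63 & 1074/125 & \mathtt{041401113}\ \mathtt{401032122}\ \mathtt{113122320}\ \mathtt{311122122}\ \mathtt{122203230}\ \mathtt{122230203}\ \mathtt{203032320}\ \mathtt{032320203}\ \mathtt{320203032} \\ 18 & 5 & 63 & 1141/125 & \mathtt{041401113}\ \mathtt{401032122}\ \mathtt{113122320}\ \mathtt{410023122}\ \mathtt{023302230}\ \mathtt{122230203}\ \mathtt{104131320}\ \mathtt{131221203}\ \mathtt{320203032} \\ 19 & 6 & 63 & 85/9 & \mathtt{051501114}\ \mathtt{501033132}\ \mathtt{114132420}\ \mathtt{501033132}\ \mathtt{033303330}\ \mathtt{132330204}\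 \mathtt{114132420}\ \mathtt{132330204}\ \mathtt{420204042} \\ 20 & 4 & 64 & 145/16 & \mathtt{121211112}\ \mathtt{211103130}\ \mathtt{112130202}\ \mathtt{121013310}\ \mathtt{202130112}\ \mathtt{121301022}\ \mathtt{202220022}\ \mathtt{031211202}\ \mathtt{211013220} \\ 21 & 5 & 65 & 223/25 & \mathtt{122311122}\ \mathtt{212140203}\ \mathtt{221104230}\ \mathtt{230023302}\ \mathtt{023401131}\ \mathtt{302131122}\ \mathtt{203221131}\ \mathtt{320014221}\ \mathtt{032320203} \\ \end{array} $$ Then: (1) The vertices of $\Omega_3^4$ form exactly $21$ equivalence classes. Each $A_i$ is a vertex of $\Omega_3^4$, and every vertex of $\Omega_3^4$ is equivalent to exactly one of $A_1,\dots,A_{21}$. (2) $N(A_i)=N_i$ and $\mathrm{per}\,A_i=p_i$ for $i=1,\dots,21$. (3) Up to equivalence there are exactly $6$ symmetric vertices: $A_i$ is symmetric if and only if $i\in\{1,4,7,9,13,19\}$, every symmetric vertex of $\Omega_3^4$ is equivalent to one of these six matrices, and hence exactly $6$ of the $21$ equivalence classes contain a symmetric vertex. -/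

import Mathlib

/-- A `d`-dimensional real matrix of order `n`: a family of reals indexed by `{0, …, n - 1}^d`. -/
abbrev MultiMatrix (d n : ℕ) : Type := (Fin d → Fin n) → ℝ

namespace MultiMatrix

/-- The polytope `Ω_n^d` of polystochastic matrices: nonnegative matrices whose entries sum to `1`
along every line. The line through `α` in direction `i` consists of the indices obtained from `α`
by letting the `i`-th coordinate vary. -/
def birkhoffPolytope (d n : ℕ) : Set (MultiMatrix d n) :=
  {A | (∀ α, 0 ≤ A α) ∧ ∀ (i : Fin d) (α : Fin d → Fin n), ∑ k, A (Function.update α i k) = 1}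

/-- The vertices of `Ω_n^d`. -/
def vertices (d n : ℕ) : Set (MultiMatrix d n) :=
  Set.extremePoints ℝ (birkhoffPolytope d n)

/-- `B` is obtained from `A` by permuting the directions (through `σ`) and permuting, within each
direction `i`, the parallel hyperplanes of that direction (through `τ i`). -/
def Equivalent {d n : ℕ} (A B : MultiMatrix d n) : Prop :=
  ∃ (σ : Equiv.Perm (Fin d)) (τ : Fin d → Equiv.Perm (Fin n)),
    ∀ α, B α = A (fun i => τ i (α (σ i)))

theorem Equivalent.refl {d n : ℕ} (A : MultiMatrix d n) : Equivalent A A :=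
  ⟨1, fun _ => 1, fun _ => rfl⟩

theorem Equivalent.symm {d n : ℕ} {A B : MultiMatrix d n} (h : Equivalent A B) :
    Equivalent B A := by
  obtain ⟨σ, τ, h⟩ := h
  refine ⟨σ⁻¹, fun i => (τ (σ⁻¹ i))⁻¹, fun α => ?_⟩
  rw [h]
  congr 1
  funext i
  simp

theorem Equivalent.trans {d n : ℕ} {A B C : MultiMatrix d n} (h : Equivalent A B)
    (h' : Equivalent B C) : Equivalent A C := by
  obtain ⟨σ, τ, h⟩ := h
  obtain ⟨σ', τ', h'⟩ := h'
  refine ⟨σ' * σ, fun i => τ i * τ' (σ i), fun α => ?_⟩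
  rw [h', h]
  rfl

/-- Equivalence of matrices, restricted to the vertices of `Ω_n^d`. -/
def vertexSetoid (d n : ℕ) : Setoid (vertices d n) where
  r A B := Equivalent A.1 B.1
  iseqv := ⟨fun A => Equivalent.refl A.1, fun h => h.symm, fun h h' => h.trans h'⟩

/-- The equivalence classes of vertices of `Ω_n^d`. -/
abbrev VertexClass (d n : ℕ) : Type := Quotient (vertexSetoid d n)

/-- A matrix is symmetric if permuting the coordinates of the index never changes the entry. -/
def IsSymmetric {d n : ℕ} (A : MultiMatrix d n) : Prop :=
  ∀ (σ : Equiv.Perm (Fin d)) (α : Fin d → Fin n), A (fun i => α (σ i)) = A α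

/-- The diagonals: sets of `n` indices no two of which lie in a common hyperplane, i.e. any two of
which differ in every coordinate. -/
def diagonals (d n : ℕ) : Finset (Finset (Fin d → Fin n)) :=
  (Finset.powersetCard n Finset.univ).filter
    fun l => ∀ α ∈ l, ∀ β ∈ l, α ≠ β → ∀ i, α i ≠ β i

/-- The permanent: the sum over all diagonals of the product of the entries on the diagonal. -/
noncomputable def permanent {d n : ℕ} (A : MultiMatrix d n) : ℝ :=
  ∑ l ∈ diagonals d n, ∏ α ∈ l, A α

/-- The number of nonzero entries of a matrix. -/
noncomputable def supportSize {d n : ℕ} (A : MultiMatrix d n) : ℕ :=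
  (Function.support A).ncard

/-- The `4`-dimensional matrix of order `3` written as a `3 × 3` array of `3 × 3` blocks with a
common denominator `D`: the entry at `α` is in block row `α 0`, block column `α 1`, and within that
block in row `α 2`, column `α 3`. -/
noncomputable def ofBlocks (D : ℕ) (M : Matrix (Fin (3 * 3)) (Fin (3 * 3)) ℕ) : MultiMatrix 4 3 :=
  fun α => (M (finProdFinEquiv (α 0, α 2)) (finProdFinEquiv (α 1, α 3)) : ℝ) / (D : ℝ)

/-- The common denominators of the listed matrices. -/
def listedDenominator : Fin 21 → ℕ :=
  ![1, 2, 2, 2, 3, 3, 3, 4, 4, 3, 3, 4, 5, 4, 3, 4, 5, 5, 6, 4, 5]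

/-- The numerators of the listed matrices, in block form. -/
def listedNumerator : Fin 21 → Matrix (Fin (3 * 3)) (Fin (3 * 3)) ℕ := ![
  !![1, 0, 0, 0, 0, 1, 0, 1, 0;
     0, 0, 1, 0, 1, 0, 1, 0, 0;
     0, 1, 0, 1, 0, 0, 0, 0, 1;
     0, 0, 1, 0, 1, 0, 1, 0, 0;
     0, 1, 0, 1, 0, 0, 0, 0, 1;
     1, 0, 0, 0, 0, 1, 0, 1, 0;
     0, 1, 0, 1, 0, 0, 0, 0, 1;
     1, 0, 0, 0, 0, 1, 0, 1, 0;
     0, 0, 1, 0, 1, 0, 1, 0, 0],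
  !![2, 0, 0, 0, 2, 0, 0, 0, 2;
     0, 1, 1, 1, 0, 1, 1, 1, 0;
     0, 1, 1, 1, 0, 1, 1, 1, 0;
     0, 1, 1, 1, 0, 1, 1, 1, 0;
     2, 0, 0, 0, 1, 1, 0, 1, 1;
     0, 1, 1, 1, 1, 0, 1, 0, 1;
     0, 1, 1, 1, 0, 1, 1, 1, 0;
     0, 1, 1, 1, 1, 0, 1, 0, 1;
     2, 0, 0, 0, 1, 1, 0, 1, 1],
  !![2, 0, 0, 0, 1, 1, 0, 1, 1;
     0, 1, 1, 1, 0, 1, 1, 1, 0;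
     0, 1, 1, 1, 1, 0, 1, 0, 1;
     0, 1, 1, 2, 0, 0, 0, 1, 1;
     1, 1, 0, 0, 1, 1, 1, 0, 1;
     1, 0, 1, 0, 1, 1, 1, 1, 0;
     0, 1, 1, 0, 1, 1, 2, 0, 0;
     1, 0, 1, 1, 1, 0, 0, 1, 1;
     1, 1, 0, 1, 0, 1, 0, 1, 1],
  !![2, 0, 0, 0, 1, 1, 0, 1, 1;
     0, 1, 1, 1, 0, 1, 1, 1, 0;
     0, 1, 1, 1, 1, 0, 1, 0, 1;
     0, 1, 1, 1, 0, 1, 1, 1, 0;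
     1, 0, 1, 0, 2, 0, 1, 0, 1;
     1, 1, 0, 1, 0, 1, 0, 1, 1;
     0, 1, 1, 1, 1, 0, 1, 0, 1;
     1, 1, 0, 1, 0, 1, 0, 1, 1;
     1, 0, 1, 0, 1, 1, 1, 1, 0],
  !![3, 0, 0, 0, 1, 2, 0, 2, 1;
     0, 2, 1, 2, 1, 0, 1, 0, 2;
     0, 1, 2, 1, 1, 1, 2, 1, 0;
     0, 2, 1, 2, 1, 0, 1, 0, 2;
     1, 1, 1, 1, 0, 2, 1, 2, 0;
     2, 0, 1, 0, 2, 1, 1, 1, 1;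
     0, 1, 2, 1, 1, 1, 2, 1, 0;
     2, 0, 1, 0, 2, 1, 1, 1, 1;
     1, 2, 0, 2, 0, 1, 0, 1, 2],
  !![3, 0, 0, 0, 2, 1, 0, 1, 2;
     0, 2, 1, 1, 0, 2, 2, 1, 0;
     0, 1, 2, 2, 1, 0, 1, 1, 1;
     0, 2, 1, 2, 0, 1, 1, 1, 1;
     2, 0, 1, 1, 1, 1, 0, 2, 1;
     1, 1, 1, 0, 2, 1, 2, 0, 1;
     0, 1, 2, 1, 1, 1, 2, 1, 0;
     1, 1, 1, 1, 2, 0, 1, 0, 2;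
     2, 1, 0, 1, 0, 2, 0, 2, 1],
  !![3, 0, 0, 0, 2, 1, 0, 1, 2;
     0, 2, 1, 2, 0, 1, 1, 1, 1;
     0, 1, 2, 1, 1, 1, 2, 1, 0;
     0, 2, 1, 2, 0, 1, 1, 1, 1;
     2, 0, 1, 0, 1, 2, 1, 2, 0;
     1, 1, 1, 1, 2, 0, 1, 0, 2;
     0, 1, 2, 1, 1, 1, 2, 1, 0;
     1, 1, 1, 1, 2, 0, 1, 0, 2;
     2, 1, 0, 1, 0, 2, 0, 2, 1],
  !![4, 0, 0, 0, 2, 2, 0, 2, 2;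
     0, 2, 2, 2, 0, 2, 2, 2, 0;
     0, 2, 2, 2, 2, 0, 2, 0, 2;
     0, 3, 1, 3, 0, 1, 1, 1, 2;
     3, 0, 1, 0, 2, 2, 1, 2, 1;
     1, 1, 2, 1, 2, 1, 2, 1, 1;
     0, 1, 3, 1, 2, 1, 3, 1, 0;
     1, 2, 1, 2, 2, 0, 1, 0, 3;
     3, 1, 0, 1, 0, 3, 0, 3, 1],
  !![0, 2, 2, 2, 0, 2, 2, 2, 0;
     2, 0, 2, 0, 3, 1, 2, 1, 1;
     2, 2, 0, 2, 1, 1, 0, 1, 3;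
     2, 0, 2, 0, 3, 1, 2, 1, 1;
     0, 3, 1, 3, 1, 0, 1, 0, 3;
     2, 1, 1, 1, 0, 3, 1, 3, 0;
     2, 2, 0, 2, 1, 1, 0, 1, 3;
     2, 1, 1, 1, 0, 3, 1, 3, 0;
     0, 1, 3, 1, 3, 0, 3, 0, 1],
  !![1, 1, 1, 1, 0, 2, 1, 2, 0;
     1, 1, 1, 2, 1, 0, 0, 1, 2;
     1, 1, 1, 0, 2, 1, 2, 0, 1;
     2, 0, 1, 1, 2, 0, 0, 1, 2;
     0, 1, 2, 1, 1, 1, 2, 1, 0;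
     1, 2, 0, 1, 0, 2, 1, 1, 1;
     0, 2, 1, 1, 1, 1, 2, 0, 1;
     2, 1, 0, 0, 1, 2, 1, 1, 1;
     1, 0, 2, 2, 1, 0, 0, 2, 1],
  !![1, 1, 1, 1, 0, 2, 1, 2, 0;
     1, 1, 1, 2, 1, 0, 0, 1, 2;
     1, 1, 1, 0, 2, 1, 2, 0, 1;
     1, 1, 1, 0, 2, 1, 2, 0, 1;
     1, 0, 2, 1, 1, 1, 1, 2, 0;
     1, 2, 0, 2, 0, 1, 0, 1, 2;
     1, 1, 1, 2, 1, 0, 0, 1, 2;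
     1, 2, 0, 0, 1, 2, 2, 0, 1;
     1, 0, 2, 1, 1, 1, 1, 2, 0],
  !![4, 0, 0, 0, 2, 2, 0, 2, 2;
     0, 2, 2, 2, 0, 2, 2, 2, 0;
     0, 2, 2, 2, 2, 0, 2, 0, 2;
     0, 1, 3, 3, 1, 0, 1, 2, 1;
     3, 1, 0, 0, 2, 2, 1, 1, 2;
     1, 2, 1, 1, 1, 2, 2, 1, 1;
     0, 3, 1, 1, 1, 2, 3, 0, 1;
     1, 1, 2, 2, 2, 0, 1, 1, 2;
     3, 0, 1, 1, 1, 2, 0, 3, 1],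
  !![5, 0, 0, 0, 3, 2, 0, 2, 3;
     0, 3, 2, 3, 0, 2, 2, 2, 1;
     0, 2, 3, 2, 2, 1, 3, 1, 1;
     0, 3, 2, 3, 0, 2, 2, 2, 1;
     3, 0, 2, 0, 2, 3, 2, 3, 0;
     2, 2, 1, 2, 3, 0, 1, 0, 4;
     0, 2, 3, 2, 2, 1, 3, 1, 1;
     2, 2, 1, 2, 3, 0, 1, 0, 4;
     3, 1, 1, 1, 0, 4, 1, 4, 0],
  !![2, 1, 1, 2, 0, 2, 0, 3, 1;
     1, 2, 1, 2, 2, 0, 1, 0, 3;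
     1, 1, 2, 0, 2, 2, 3, 1, 0;
     2, 2, 0, 1, 1, 2, 1, 1, 2;
     0, 2, 2, 1, 1, 2, 3, 1, 0;
     2, 0, 2, 2, 2, 0, 0, 2, 2;
     0, 1, 3, 1, 3, 0, 3, 0, 1;
     3, 0, 1, 1, 1, 2, 0, 3, 1;
     1, 3, 0, 2, 0, 2, 1, 1, 2],
  !![1, 1, 1, 1, 0, 2, 1, 2, 0;
     1, 1, 1, 0, 2, 1, 2, 0, 1;
     1, 1, 1, 2, 1, 0, 0, 1, 2;
     1, 1, 1, 1, 1, 1, 1, 1, 1;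
     1, 0, 2, 2, 1, 0, 0, 2, 1;
     1, 2, 0, 0, 1, 2, 2, 0, 1;
     1, 1, 1, 1, 2, 0, 1, 0, 2;
     1, 2, 0, 1, 0, 2, 1, 1, 1;
     1, 0, 2, 1, 1, 1, 1, 2, 0],
  !![2, 1, 1, 2, 0, 2, 0, 3, 1;
     1, 2, 1, 2, 2, 0, 1, 0, 3;
     1, 1, 2, 0, 2, 2, 3, 1, 0;
     2, 0, 2, 1, 3, 0, 1, 1, 2;
     0, 2, 2, 1, 1, 2, 3, 1, 0;
     2, 2, 0, 2, 0, 2, 0, 2, 2;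
     0, 3, 1, 1, 1, 2, 3, 0, 1;
     3, 0, 1, 1, 1, 2, 0, 3, 1;
     1, 1, 2, 2, 2, 0, 1, 1, 2],
  !![0, 4, 1, 4, 0, 1, 1, 1, 3;
     4, 0, 1, 0, 3, 2, 1, 2, 2;
     1, 1, 3, 1, 2, 2, 3, 2, 0;
     3, 1, 1, 1, 2, 2, 1, 2, 2;
     1, 2, 2, 2, 0, 3, 2, 3, 0;
     1, 2, 2, 2, 3, 0, 2, 0, 3;
     2, 0, 3, 0, 3, 2, 3, 2, 0;
     0, 3, 2, 3, 2, 0, 2, 0, 3;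
     3, 2, 0, 2, 0, 3, 0, 3, 2],
  !![0, 4, 1, 4, 0, 1, 1, 1, 3;
     4, 0, 1, 0, 3, 2, 1, 2, 2;
     1, 1, 3, 1, 2, 2, 3, 2, 0;
     4, 1, 0, 0, 2, 3, 1, 2, 2;
     0, 2, 3, 3, 0, 2, 2, 3, 0;
     1, 2, 2, 2, 3, 0, 2, 0, 3;
     1, 0, 4, 1, 3, 1, 3, 2, 0;
     1, 3, 1, 2, 2, 1, 2, 0, 3;
     3, 2, 0, 2, 0, 3, 0, 3, 2],
  !![0, 5, 1, 5, 0, 1, 1, 1, 4;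
     5, 0, 1, 0, 3, 3, 1, 3, 2;
     1, 1, 4, 1, 3, 2, 4, 2, 0;
     5, 0, 1, 0, 3, 3, 1, 3, 2;
     0, 3, 3, 3, 0, 3, 3, 3, 0;
     1, 3, 2, 3, 3, 0, 2, 0, 4;
     1, 1, 4, 1, 3, 2, 4, 2, 0;
     1, 3, 2, 3, 3, 0, 2, 0, 4;
     4, 2, 0, 2, 0, 4, 0, 4, 2],
  !![1, 2, 1, 2, 1, 1, 1, 1, 2;
     2, 1, 1, 1, 0, 3, 1, 3, 0;
     1, 1, 2, 1, 3, 0, 2, 0, 2;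
     1, 2, 1, 0, 1, 3, 3, 1, 0;
     2, 0, 2, 1, 3, 0, 1, 1, 2;
     1, 2, 1, 3, 0, 1, 0, 2, 2;
     2, 0, 2, 2, 2, 0, 0, 2, 2;
     0, 3, 1, 2, 1, 1, 2, 0, 2;
     2, 1, 1, 0, 1, 3, 2, 2, 0],
  !![1, 2, 2, 3, 1, 1, 1, 2, 2;
     2, 1, 2, 1, 4, 0, 2, 0, 3;
     2, 2, 1, 1, 0, 4, 2, 3, 0;
     2, 3, 0, 0, 2, 3, 3, 0, 2;
     0, 2, 3, 4, 0, 1, 1, 3, 1;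
     3, 0, 2, 1, 3, 1, 1, 2, 2;
     2, 0, 3, 2, 2, 1, 1, 3, 1;
     3, 2, 0, 0, 1, 4, 2, 2, 1;
     0, 3, 2, 3, 2, 0, 2, 0, 3]]

/-- The `21` listed matrices. -/
noncomputable def listed (i : Fin 21) : MultiMatrix 4 3 :=
  ofBlocks (listedDenominator i) (listedNumerator i)

/-- The support sizes of the listed matrices. -/
def listedSupportSize : Fin 21 → ℕ :=
  ![27, 49, 51, 52, 58, 59, 59, 60, 60, 61, 61, 62, 62, 62, 63, 63, 63, 63, 63, 64, 65]

/-- The permanents of the listed matrices. -/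
noncomputable def listedPermanent : Fin 21 → ℝ :=
  ![27, 21/2, 9, 33/4, 256/27, 85/9, 85/9,
    77/8, 39/4, 236/27, 236/27, 75/8, 1194/125, 73/8,
    26/3, 9, 1074/125, 1141/125, 85/9, 145/16, 223/25]

/-- The positions in the list of the symmetric matrices, counted from `0`. -/
def listedSymmetric : Finset (Fin 21) :=
  {0, 3, 6, 8, 12, 18}

end MultiMatrix

/-! Call a matrix known if it is equivalent to a listed one. The known matrices are finitely many
points of the polytope, so all rests on showing that the polytope is their convex hull: extreme
points are then known. By Hahn–Banach this follows from `exists_le`: on the polytope, no linear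
functional exceeds its maximum over the known matrices.

For a listed matrix `A` other than the first, this is a local statement. Differences of
polystochastic matrices are balanced, and those starting at `A` lie in the cone of balanced arrays
that are nonnegative at the zeros of `A`. Suppose that every nonzero `x` in this cone has a witness:
a known `B` whose nonempty support within the zeros of `A` lies in the support of `x`. Subtracting
the largest admissible multiple of `B - A` from `x` makes the support smaller, so the differences `B
- A` generate the cone. Hence a functional whose maximum over the known matrices is attained at `A`
is maximal over the whole polytope there (`le_of_hasWitness`).

Witnesses are found by the double description method: the orthant on the zeros of `A` is cut by the
linear equations that the values of balanced arrays satisfy there. Only supports matter, so it is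
enough that every nonzero element of the cone contains the support of some computed ray
(`Spans.cutStep`). For three of the matrices the cone is treated face by face: either an element is
positive on the whole support of a chosen witness, or it vanishes at one of these cells and lies in
a smaller face, which an automorphism of `A` relates to a face already treated (`faceOk_branch`).

The first matrix has 54 zeros, and its cone is never enumerated. Its equivalents are the 24
indicators of the levels of the eight linear forms over `ℤ/3` (up to sign) with no zero coefficient,
and these indicators expand every balanced array (`eq_sum_levelMatrix`). Suppose that `f p` exceeds
the maximum `m` of `f` over the known matrices. By the local statement `f` is below `m` at all known
matrices outside the first class. The expansion gives a functional `g` with `g p ≥ f p`, with `g ≤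
m` on the first class (`le_deficit`), and with `g ≥ m` at some known matrix of the second class
(`exists_small_sum`). On the segment from `f` to `g` there is a first functional that reaches `m` at
a matrix `D` outside the first class. The local statement at `D` bounds its value at `p` by `m`,
although both ends of the segment exceed `m` at `p`.

Each listed matrix is a vertex because a balanced array vanishing at all its zeros is zero
(`eq_zero_of_rigid`). A numerical invariant separates the classes. A class containing a symmetric
matrix must have automorphisms inducing every permutation of the directions (`mem_listedSymmetric`),
which fails for the fifteen remaining matrices. -/

noncomputable section

namespace Polystochastic

/-! ### Computable ingredients

The functions in this section are evaluated by the kernel. They are written with recursors and with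
the primitive operations on `ℕ`, which the kernel reduces fastest. -/

/-- A pair stands for the integer `p.1 - p.2`. -/
abbrev Pair := ℕ × ℕ

/-- A ray of a cone: its support as a bit mask, and the values of the remaining equations on it. -/
abbrev Ray := ℕ × List Pair

/-- A ray with the absolute value of the current equation on it. -/
abbrev WeightedRay := ℕ × ℕ × List Pair

/-! ### Integer arithmetic on differences of natural numbers -/

/-- Truncated subtraction leaves at least one component zero, which keeps the numbers small. -/
def reduced (x y : ℕ) : Pair := (Nat.sub x y, Nat.sub y x)

def pairComb (a b : ℕ) (p q : Pair) : Pair :=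
  reduced (Nat.add (Nat.mul a p.1) (Nat.mul b q.1)) (Nat.add (Nat.mul a p.2) (Nat.mul b q.2))

def pairSub (p q : Pair) : Pair := reduced (Nat.add p.1 q.2) (Nat.add p.2 q.1)

/-- `h * s - g * t`. -/
def pairCross (h g s t : Pair) : Pair :=
  reduced
    (Nat.add (Nat.add (Nat.mul h.1 s.1) (Nat.mul h.2 s.2))
      (Nat.add (Nat.mul g.1 t.2) (Nat.mul g.2 t.1)))
    (Nat.add (Nat.add (Nat.mul h.1 s.2) (Nat.mul h.2 s.1))
      (Nat.add (Nat.mul g.1 t.1) (Nat.mul g.2 t.2)))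

def mapTwo (f : Pair → Pair → Pair) (v : List Pair) : List Pair → List Pair :=
  @List.rec Pair (fun _ => List Pair → List Pair) (fun _ => [])
    (fun p _ ih w => @List.rec Pair (fun _ => List Pair) [] (fun q t _ => f p q :: ih t) w) v

/-- `f n`, with `n` evaluated first. -/
def force {α : Type} (n : ℕ) (f : ℕ → α) : α :=
  @Nat.rec (fun _ => α) (f 0) (fun k _ => f (Nat.succ k)) n

/-- `f L`, with `L` evaluated first. -/
def forceList (L : List Ray) (f : List Ray → List Ray) : List Ray :=
  @List.rec Ray (fun _ => List Ray) (f []) (fun r t _ => f (r :: t)) L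

/-- Some mask of the list is contained in `u`. -/
def covered (u : ℕ) (R : List Ray) : Bool :=
  @List.rec Ray (fun _ => Bool) false
    (fun r _ ih => @Bool.rec (fun _ => Bool) ih true (Nat.beq (Nat.land r.1 u) r.1)) R

/-- Add the combination of `p` and `n` on which the current equation holds, unless its support
contains a support that is already present. -/
def insertComb (p n : WeightedRay) (acc : List Ray) : List Ray :=
  force (Nat.lor p.1 n.1) fun u =>
    @Bool.rec (fun _ => List Ray) ((u, mapTwo (pairComb n.2.1 p.2.1) p.2.2 n.2.2) :: acc) acc
      (covered u acc)

def insertAll (p : WeightedRay) (N : List WeightedRay) : List Ray → List Ray :=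
  @List.rec WeightedRay (fun _ => List Ray → List Ray) (fun acc => acc)
    (fun n _ ih acc => forceList (insertComb p n acc) ih) N

def insertPairs (N P : List WeightedRay) : List Ray → List Ray :=
  @List.rec WeightedRay (fun _ => List Ray → List Ray) (fun acc => acc)
    (fun p _ ih acc => forceList (insertAll p N acc) ih) P

/-! ### One step of the double description method -/

def zeroRays (R : List Ray) : List Ray :=
  @List.rec Ray (fun _ => List Ray) []
    (fun r _ ih => @List.rec Pair (fun _ => List Ray) ih
      (fun h v _ => @Bool.rec (fun _ => List Ray) ih ((r.1, v) :: ih) (Nat.beq h.1 h.2)) r.2) R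

def posRays (R : List Ray) : List WeightedRay :=
  @List.rec Ray (fun _ => List WeightedRay) []
    (fun r _ ih => @List.rec Pair (fun _ => List WeightedRay) ih
      (fun h v _ => @Bool.rec (fun _ => List WeightedRay) ((r.1, Nat.sub h.1 h.2, v) :: ih) ih
        (Nat.ble h.1 h.2)) r.2) R

def negRays (R : List Ray) : List WeightedRay :=
  @List.rec Ray (fun _ => List WeightedRay) []
    (fun r _ ih => @List.rec Pair (fun _ => List WeightedRay) ih
      (fun h v _ => @Bool.rec (fun _ => List WeightedRay) ((r.1, Nat.sub h.2 h.1, v) :: ih) ih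
        (Nat.ble h.2 h.1)) r.2) R

/-- Intersect the cone generated by the rays with the hyperplane of the current equation. -/
def cutStep (R : List Ray) : List Ray :=
  insertPairs (negRays R) (posRays R) (zeroRays R)

/-- Each step consumes the head of the list of values carried by every ray. -/
def cuts (k : ℕ) : List Ray → List Ray :=
  @Nat.rec (fun _ => List Ray → List Ray) (fun R => R) (fun _ ih R => ih (cutStep R)) k

/-- The coefficients of the equations are hexadecimal digits, shifted by `8`. -/
def coeffPair (E n : ℕ) : Pair := reduced (Nat.mod (Nat.shiftRight E (Nat.mul 4 n)) 16) 8

def coeffColumn (E k : ℕ) : ℕ → List Pair :=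
  @Nat.rec (fun _ => ℕ → List Pair) (fun _ => [])
    (fun _ ih n => coeffPair E n :: ih (Nat.add n 81)) k

def startRays (E k Z : ℕ) (cells : List ℕ) : List Ray :=
  @List.rec ℕ (fun _ => List Ray) []
    (fun c _ ih => @Bool.rec (fun _ => List Ray)
      ((Nat.shiftLeft 1 c, coeffColumn E k c) :: ih) ih (Nat.testBit Z c)) cells

/-- The coordinates of a functional on balanced arrays, see `sum_mul_eq_dot`. -/
def coords (n : ℕ) : (ℕ → Pair) → List Pair :=
  @Nat.rec (fun _ => (ℕ → Pair) → List Pair) (fun f => [f 0])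
    (fun n ih f =>
      force (3 ^ n) fun w =>
      List.append (ih fun c => pairSub (f c) (f (Nat.add c (Nat.mul 2 w))))
        (ih fun c => pairSub (f (Nat.add c w)) (f (Nat.add c (Nat.mul 2 w))))) n

/-! ### Fraction-free Gaussian elimination -/

def allZero (v : List Pair) : Bool :=
  @List.rec Pair (fun _ => Bool) true
    (fun p _ ih => @Bool.rec (fun _ => Bool) false ih (Nat.beq p.1 p.2)) v

/-- The empty list signals that every leading coefficient is zero. -/
def findPivot (vs : List (List Pair)) : List Pair :=
  @List.rec (List Pair) (fun _ => List Pair) []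
    (fun v _ ih => @List.rec Pair (fun _ => List Pair) ih
      (fun h _ _ => @Bool.rec (fun _ => List Pair) v ih (Nat.beq h.1 h.2)) v) vs

/-- Cross multiplication avoids fractions. The pivot itself turns into a zero vector, which does no
harm. -/
def eliminate (h : Pair) (t : List Pair) (vs : List (List Pair)) : List (List Pair) :=
  @List.rec (List Pair) (fun _ => List (List Pair)) []
    (fun v _ ih => @List.rec Pair (fun _ => List (List Pair)) ih
      (fun g s _ => @Bool.rec (fun _ => List (List Pair)) (mapTwo (pairCross h g) s t :: ih)
        (s :: ih) (Nat.beq g.1 g.2)) v) vs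

/-- The vectors span the space of dimension `k`. -/
def spanning (k : ℕ) : List (List Pair) → Bool :=
  @Nat.rec (fun _ => List (List Pair) → Bool) (fun _ => true)
    (fun _ ih vs => @List.rec Pair (fun _ => Bool) false (fun h t _ => ih (eliminate h t vs))
      (findPivot vs)) k

def indicator (c d : ℕ) : Pair :=
  @Bool.rec (fun _ => Pair) (0, 0) (1, 0) (Nat.beq c d)

def indicatorCoords (cells : List ℕ) : List (List Pair) :=
  @List.rec ℕ (fun _ => List (List Pair)) [] (fun c _ ih => coords 4 (indicator c) :: ih) cells

/-- The numerators of the listed matrices, three bits each. -/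
def numerators : ℕ := 0x308a45909c20a49809b0922594196488d041b40341a6124602212594914910920920c825048945841241120b21865905141145041944865824a44928a2a081052041b4c85133098106d321b61b6132d82285133094cb608b09229a130c209b08a4590996602c20d244348368245a00c09a4592914c11192443026184136104d30134c309841a48869849148a44961348b25229822324886044960861244a2512432c24016894122432124820816c12c240248244944941124a04928108a04224921140928805124228124a20841105141024924925125821a0912190c90d909005a24248944a09201205b04b09009209125125086024b80868a44b29342021a29069a0832920d304b29340a4834c34130052c22486890922486892c129125144a40165105b21041248049049048240081121220928805204224944044844224940228124909101128029024924924a04921029104940828a0490522102490884510422122022500520492492490c32c80cb0494c82504832c12530416582516104c82504894584104904902c30416c109144165164128a28928a40868921961041248049049048240085040829021124828928840844921144108924228028928824908a0882800ca08105204224905125104228124a04921124845024829100a40941105001a20920a21140921121220921140941020a21124a00a40940920a44220a003049208248208248209241208209208408209209208209240248248241200448240088209240248248049049048240088209241041248049049048240089041049201241011209041240241248209200448048250041208409048010041040041000240008201040009000208008208040008200208200208001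

/-- The numerator of the entry number `c` of the listed matrix number `j`. -/
def numerator (j c : ℕ) : ℕ :=
  Nat.mod (Nat.shiftRight numerators (Nat.add (Nat.mul 243 j) (Nat.mul 3 c))) 8

/-- `k` equations, starting from the coefficient number `n`, hold for the balanced arrays, if only
the cells at which the listed matrix number `j` vanishes are taken into account. -/
def equationsOk (j E k : ℕ) : ℕ → Bool :=
  @Nat.rec (fun _ => ℕ → Bool) (fun _ => true)
    (fun _ ih n => @Bool.rec (fun _ => Bool) false (ih (Nat.add n 81))
      (allZero (coords 4 fun c =>
        @Bool.rec (fun _ => Pair) (0, 0) (coeffPair E (Nat.add c n))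
          (Nat.beq (numerator j c) 0)))) k

def zeroCellsFrom (j n : ℕ) : ℕ → List ℕ :=
  @Nat.rec (fun _ => ℕ → List ℕ) (fun _ => [])
    (fun _ ih c => @Bool.rec (fun _ => List ℕ) (ih (Nat.succ c)) (c :: ih (Nat.succ c))
      (Nat.beq (numerator j c) 0)) n

def zeroCells (j : ℕ) : List ℕ := zeroCellsFrom j 81 0

def allBelow (n : ℕ) (f : ℕ → Bool) : Bool :=
  @Nat.rec (fun _ => Bool) true (fun k ih => @Bool.rec (fun _ => Bool) false ih (f k)) n

/-- The permutations of four objects, and of three objects, as tables. -/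
def perms4 : ℕ := 0x642046206240264042602460640246026042064240620462620426046024062420640264420624064026042620460246
def perms3 : ℕ := 0x192261624

def twoBits (n k : ℕ) : ℕ := Nat.land (Nat.shiftRight n k) 3

/-- The digits of `c` in base `3`, read in base `4`. -/
def spread (c : ℕ) : ℕ :=
  Nat.add (Nat.mul 64 (Nat.div c 27)) (Nat.add (Nat.mul 16 (Nat.mod (Nat.div c 9) 3))
    (Nat.add (Nat.mul 4 (Nat.mod (Nat.div c 3) 3)) (Nat.mod c 3)))

/-- Group elements are numbered `1296 * s + t0 + 6 * t1 + 36 * t2 + 216 * t3`, where `s` stands for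
the permutation of the directions and each `t` for a permutation of three hyperplanes. The tabulated
values are bit offsets in the spread form, hence already doubled and counted from the last digit. -/
def place (g i : ℕ) : ℕ :=
  Nat.land (Nat.shiftRight perms4 (Nat.add (Nat.mul 16 (Nat.div g 1296)) (Nat.mul 4 i))) 15

def table3 (t : ℕ) : ℕ := Nat.land (Nat.shiftRight perms3 (Nat.mul 6 (Nat.mod t 6))) 63

def moveCell (p0 p1 p2 p3 t0 t1 t2 t3 s : ℕ) : ℕ :=
  Nat.add (Nat.mul 27 (twoBits t0 (Nat.mul 2 (twoBits s p0))))
    (Nat.add (Nat.mul 9 (twoBits t1 (Nat.mul 2 (twoBits s p1))))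
      (Nat.add (Nat.mul 3 (twoBits t2 (Nat.mul 2 (twoBits s p2))))
        (twoBits t3 (Nat.mul 2 (twoBits s p3)))))

/-- The action of the group element number `g` on cells in spread form. -/
def act (g s : ℕ) : ℕ :=
  moveCell (place g 0) (place g 1) (place g 2) (place g 3) (table3 g) (table3 (Nat.div g 6))
    (table3 (Nat.div g 36)) (table3 (Nat.div g 216)) s

/-- `f (act g)`, with the tables evaluated first. -/
def withAct {α : Type} (g : ℕ) (f : (ℕ → ℕ) → α) : α :=
  force (place g 0) fun p0 => force (place g 1) fun p1 => force (place g 2) fun p2 =>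
  force (place g 3) fun p3 => force (table3 g) fun t0 => force (table3 (Nat.div g 6)) fun t1 =>
  force (table3 (Nat.div g 36)) fun t2 => force (table3 (Nat.div g 216)) fun t3 =>
  f (moveCell p0 p1 p2 p3 t0 t1 t2 t3)

/-- The cells together with their spread forms and their masks. -/
abbrev CellData := ℕ × ℕ × ℕ

def cellData (l : List ℕ) : List CellData :=
  @List.rec ℕ (fun _ => List CellData) []
    (fun c _ ih => force (spread c) fun s => force (Nat.shiftLeft 1 c) fun b => (c, s, b) :: ih) l

/-- The support, within the given cells, of the image of the listed matrix number `j`. -/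
def supportMask (j : ℕ) (f : ℕ → ℕ) (cells : List CellData) : ℕ :=
  @List.rec CellData (fun _ => ℕ) 0
    (fun c _ ih => @Bool.rec (fun _ => ℕ) (Nat.lor c.2.2 ih) ih
      (Nat.beq (numerator j (f c.2.1)) 0)) cells

/-- A witness is the number of a listed matrix and the number of a group element. -/
def witnessMask (cells : List CellData) (w : ℕ) : ℕ :=
  withAct (Nat.mod (Nat.div w 32) 31104) fun f => supportMask (Nat.mod (Nat.mod w 32) 21) f cells

/-- The support of the witness is nonempty and contained in `m`. -/
def witnessOk (cells : List CellData) (m w : ℕ) : Bool :=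
  force (witnessMask cells w) fun M =>
    @Bool.rec (fun _ => Bool) (Nat.beq (Nat.land M m) M) false (Nat.beq M 0)

/-- A witness takes 20 bits: five for the listed matrix and fifteen for the group element.
`witnessMask` reduces both parts to their ranges, so every number denotes a known matrix and no
range check is needed. -/
def witnessesOk (cells : List CellData) (R : List Ray) : ℕ → Bool :=
  @List.rec Ray (fun _ => ℕ → Bool) (fun _ => true)
    (fun r _ ih S => @Bool.rec (fun _ => Bool) false (ih (Nat.shiftRight S 20))
      (witnessOk cells r.1 (Nat.mod S 1048576))) R

/-- `f` holds for the entry number `l` of the list. -/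
def holdsAt (f : ℕ → Bool) (L : List ℕ) : ℕ → Bool :=
  @List.rec ℕ (fun _ => ℕ → Bool) (fun _ => false)
    (fun a _ ih l => @Nat.rec (fun _ => Bool) (f a) (fun l _ => ih l) l) L

def allCells (cells : List CellData) (f : CellData → Bool) : Bool :=
  @List.rec CellData (fun _ => Bool) true
    (fun c _ ih => @Bool.rec (fun _ => Bool) false ih (f c)) cells

/-- The group element moves those cells that belong to the mask `Y` into the mask `Z`. -/
def movesInto (cells : List CellData) (g Y Z : ℕ) : Bool :=
  withAct g fun f => allCells cells fun c =>
    @Bool.rec (fun _ => Bool) true (Nat.testBit Z (f c.2.1)) (Nat.testBit Y c.1)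

/-- For each cell `c` of the mask `m`, some earlier face is moved by an automorphism into the face
obtained from `Z` by adding `c`. -/
def childrenOk (cells0 : List CellData) (auts faces : List ℕ) (Z m : ℕ) (cells : List CellData) :
    ℕ → Bool :=
  @List.rec CellData (fun _ => ℕ → Bool) (fun _ => true)
    (fun c _ ih S => @Bool.rec (fun _ => Bool) (ih S)
      (@Bool.rec (fun _ => Bool) false (ih (Nat.shiftRight S 16))
        (holdsAt (fun Y => holdsAt (fun g => movesInto cells0 g Y (Nat.lor Z c.2.2)) auts
          (Nat.div (Nat.mod S 65536) 256)) faces (Nat.mod S 256)))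
      (Nat.testBit m c.1)) cells

/-- A step of a script: a face, given by a mask, and the data for its verification: `0` and
witnesses, or a witness plus one and data for `childrenOk`. -/
abbrev Step := ℕ × ℕ × ℕ

/-- A leaf enumerates the rays of the face and gives each a witness. A branch covers the elements
that are positive on the support of one witness, and refers the others to smaller faces. -/
def stepOk (E k : ℕ) (cells : List ℕ) (data : List CellData) (auts faces : List ℕ) (s : Step) :
    Bool :=
  @Nat.rec (fun _ => Bool)
    (witnessesOk data (cuts k (startRays E k s.1 cells)) s.2.2)
    (fun w _ => force (witnessMask data w) fun m =>
      @Bool.rec (fun _ => Bool) (childrenOk data auts faces s.1 m data s.2.2) false (Nat.beq m 0))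
    s.2.1

/-- References to faces count backwards from the most recent one. The last face must have the empty
mask, that is, be the whole cone. -/
def scriptOk (E k : ℕ) (cells : List ℕ) (data : List CellData) (auts : List ℕ)
    (script : List Step) : List ℕ → Bool :=
  @List.rec Step (fun _ => List ℕ → Bool) (fun faces => holdsAt (fun Z => Nat.beq Z 0) faces 0)
    (fun s _ ih faces => @Bool.rec (fun _ => Bool) false (ih (s.1 :: faces))
      (stepOk E k cells data auts faces s)) script

def isAut (j g : ℕ) : Bool :=
  withAct g fun f => allBelow 81 fun c => Nat.beq (numerator j (f (spread c))) (numerator j c)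

def autsOk (j : ℕ) (auts : List ℕ) : Bool :=
  @List.rec ℕ (fun _ => Bool) true
    (fun g _ ih => @Bool.rec (fun _ => Bool) false
      (@Bool.rec (fun _ => Bool) false ih (isAut j g)) (Nat.ble g 31103)) auts

/-- All checks for the cone of the polytope at the listed matrix number `j`. -/
def coneOk (j E k : ℕ) (auts : List ℕ) (script : List Step) : Bool :=
  @Bool.rec (fun _ => Bool) false
    (@Bool.rec (fun _ => Bool) false
      (scriptOk E k (zeroCells j) (cellData (zeroCells j)) auts script [])
      (autsOk j auts))
    (equationsOk j E k 0)

/-- The zeros of the listed matrix number `j` determine a balanced array. -/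
def rigid (j : ℕ) : Bool := spanning 16 (indicatorCoords (zeroCells j))

/-! ### Cutting cones by hyperplanes -/

/-- The integer that a pair stands for. -/
def val (p : Pair) : ℝ := (p.1 : ℝ) - (p.2 : ℝ)

theorem val_reduced (x y : ℕ) : val (reduced x y) = (x : ℝ) - y := by
  unfold val reduced
  change ((x - y : ℕ) : ℝ) - ((y - x : ℕ) : ℝ) = _
  rcases le_total x y with h | h
  · rw [Nat.sub_eq_zero_of_le h, Nat.cast_sub h]; simp
  · rw [Nat.sub_eq_zero_of_le h, Nat.cast_sub h]; simp

theorem val_pairComb (a b : ℕ) (p q : Pair) :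
    val (pairComb a b p q) = a * val p + b * val q := by
  rw [pairComb, val_reduced]
  simp only [Nat.add_eq, Nat.mul_eq, val]
  push_cast
  ring

theorem force_eq {α : Type} (n : ℕ) (f : ℕ → α) : force n f = f n := by
  cases n <;> rfl

theorem forceList_eq (L : List Ray) (f : List Ray → List Ray) : forceList L f = f L := by
  cases L <;> rfl

theorem boolRec_eq {α : Type} (a b : α) (t : Bool) :
    @Bool.rec (fun _ => α) a b t = if t then b else a := by
  cases t <;> rfl

theorem mapTwo_eq_zipWith (f : Pair → Pair → Pair) (v w : List Pair) :
    mapTwo f v w = List.zipWith f v w := by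
  induction v generalizing w with
  | nil => cases w <;> rfl
  | cons p v ih =>
    cases w with
    | nil => rfl
    | cons q w =>
      change f p q :: mapTwo f v w = _
      rw [ih]
      rfl

/-- Every bit of `m` is a bit of `n`. -/
def BitSubset (m n : ℕ) : Prop := ∀ c, m.testBit c = true → n.testBit c = true

theorem BitSubset.refl (m : ℕ) : BitSubset m m := fun _ h => h

theorem bitSubset_of_land {m n : ℕ} (h : Nat.land m n = m) : BitSubset m n := by
  intro c hc
  have h' : m &&& n = m := h
  have := Nat.testBit_and m n c
  rw [h', hc] at this
  simpa using this.symm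

theorem exists_of_covered {u : ℕ} {R : List Ray} (h : covered u R = true) :
    ∃ r ∈ R, BitSubset r.1 u := by
  induction R with
  | nil => exact absurd h (by simp [covered])
  | cons r t ih =>
    have h' : @Bool.rec (fun _ => Bool) (covered u t) true (Nat.beq (Nat.land r.1 u) r.1) =
        true := h
    rw [boolRec_eq] at h'
    split_ifs at h' with hb
    · exact ⟨r, List.mem_cons_self, bitSubset_of_land (Nat.eq_of_beq_eq_true hb)⟩
    · obtain ⟨s, hs, hs'⟩ := ih h'
      exact ⟨s, List.mem_cons_of_mem _ hs, hs'⟩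

/-- The ray obtained from `p` and `n`. -/
def combRay (p n : WeightedRay) : Ray :=
  (Nat.lor p.1 n.1, mapTwo (pairComb n.2.1 p.2.1) p.2.2 n.2.2)

theorem insertComb_eq (p n : WeightedRay) (acc : List Ray) :
    insertComb p n acc = if covered (Nat.lor p.1 n.1) acc then acc else combRay p n :: acc := by
  rw [insertComb, force_eq, boolRec_eq]
  rfl

/-- `R'` extends `R` by combinations of members of `P` and `N`. -/
def Extends (P N : List WeightedRay) (R R' : List Ray) : Prop :=
  (∀ r ∈ R, r ∈ R') ∧ ∀ r ∈ R', r ∈ R ∨ ∃ p ∈ P, ∃ n ∈ N, r = combRay p n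

theorem Extends.trans {P N : List WeightedRay} {R₁ R₂ R₃ : List Ray} (h : Extends P N R₁ R₂)
    (h' : Extends P N R₂ R₃) : Extends P N R₁ R₃ := by
  refine ⟨fun r hr => h'.1 r (h.1 r hr), fun r hr => ?_⟩
  rcases h'.2 r hr with h₁ | h₁
  · exact h.2 r h₁
  · exact Or.inr h₁

/-- Some mask in `R` is contained in the union of the masks of `p` and `n`. -/
def Covers (R : List Ray) (p n : WeightedRay) : Prop :=
  ∃ r ∈ R, BitSubset r.1 (Nat.lor p.1 n.1)

/-- A combination is omitted only if a mask inside its own is already present. Either way the pair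
is covered, which is all that `Spans.cutStep` needs. -/
theorem insertComb_spec {P N : List WeightedRay} {p n : WeightedRay} (hp : p ∈ P) (hn : n ∈ N)
    (acc : List Ray) :
    Extends P N acc (insertComb p n acc) ∧ Covers (insertComb p n acc) p n := by
  rw [insertComb_eq]
  split_ifs with h
  · exact ⟨⟨fun r hr => hr, fun r hr => Or.inl hr⟩, exists_of_covered h⟩
  · refine ⟨⟨fun r hr => List.mem_cons_of_mem _ hr, fun r hr => ?_⟩,
      combRay p n, List.mem_cons_self, BitSubset.refl _⟩
    rcases List.mem_cons.1 hr with h₁ | h₁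
    · exact Or.inr ⟨p, hp, n, hn, h₁⟩
    · exact Or.inl h₁

theorem Covers.mono {P N : List WeightedRay} {R R' : List Ray} {p n : WeightedRay}
    (h : Covers R p n) (h' : Extends P N R R') : Covers R' p n := by
  obtain ⟨r, hr, hs⟩ := h
  exact ⟨r, h'.1 r hr, hs⟩

theorem insertAll_spec {P N : List WeightedRay} {p : WeightedRay} (hp : p ∈ P)
    (N' : List WeightedRay) (hN' : ∀ n ∈ N', n ∈ N) (acc : List Ray) :
    Extends P N acc (insertAll p N' acc) ∧ ∀ n ∈ N', Covers (insertAll p N' acc) p n := by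
  induction N' generalizing acc with
  | nil => exact ⟨⟨fun r hr => hr, fun r hr => Or.inl hr⟩, fun n hn => absurd hn (by simp)⟩
  | cons n t ih =>
    have e : insertAll p (n :: t) acc = insertAll p t (insertComb p n acc) :=
      forceList_eq _ _
    rw [e]
    have h₁ := insertComb_spec hp (hN' n List.mem_cons_self) acc
    have h₂ := ih (fun k hk => hN' k (List.mem_cons_of_mem _ hk)) (insertComb p n acc)
    refine ⟨h₁.1.trans h₂.1, fun k hk => ?_⟩
    rcases List.mem_cons.1 hk with rfl | hk
    · exact h₁.2.mono h₂.1
    · exact h₂.2 k hk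

theorem insertPairs_spec {P N : List WeightedRay} (P' : List WeightedRay) (hP' : ∀ p ∈ P', p ∈ P)
    (acc : List Ray) :
    Extends P N acc (insertPairs N P' acc) ∧
      ∀ p ∈ P', ∀ n ∈ N, Covers (insertPairs N P' acc) p n := by
  induction P' generalizing acc with
  | nil => exact ⟨⟨fun r hr => hr, fun r hr => Or.inl hr⟩, fun n hn => absurd hn (by simp)⟩
  | cons p t ih =>
    have e : insertPairs N (p :: t) acc = insertPairs N t (insertAll p N acc) :=
      forceList_eq _ _
    rw [e]
    have h₁ := insertAll_spec (hP' p List.mem_cons_self) N (fun _ h => h) acc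
    have h₂ := ih (fun k hk => hP' k (List.mem_cons_of_mem _ hk)) (insertAll p N acc)
    refine ⟨h₁.1.trans h₂.1, fun k hk n hn => ?_⟩
    rcases List.mem_cons.1 hk with rfl | hk
    · exact (h₁.2 n hn).mono h₂.1
    · exact h₂.2 k hk n hn

theorem mem_zeroRays {R : List Ray} {r : Ray} :
    r ∈ zeroRays R ↔ ∃ h : Pair, (r.1, h :: r.2) ∈ R ∧ h.1 = h.2 := by
  induction R with
  | nil => simp [zeroRays]
  | cons s t ih =>
    obtain ⟨m, v⟩ := s
    cases v with
    | nil =>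
      have e : zeroRays ((m, []) :: t) = zeroRays t := rfl
      simp [e, ih]
    | cons g v =>
      have e : zeroRays ((m, g :: v) :: t) =
          if Nat.beq g.1 g.2 then (m, v) :: zeroRays t else zeroRays t := boolRec_eq _ _ _
      have hb : Nat.beq g.1 g.2 = true ↔ g.1 = g.2 := Nat.beq_eq.to_iff
      rw [e]
      split_ifs with h <;> rw [hb] at h
      · simp only [List.mem_cons, ih]
        constructor
        · rintro (rfl | ⟨k, hk, hk'⟩)
          · exact ⟨g, Or.inl rfl, h⟩
          · exact ⟨k, Or.inr hk, hk'⟩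
        · rintro ⟨k, hk | hk, hk'⟩
          · left; simp only [Prod.mk.injEq, List.cons.injEq] at hk; exact Prod.ext hk.1 hk.2.2
          · exact Or.inr ⟨k, hk, hk'⟩
      · rw [ih]
        constructor
        · rintro ⟨k, hk, hk'⟩; exact ⟨k, List.mem_cons_of_mem _ hk, hk'⟩
        · rintro ⟨k, hk, hk'⟩
          rcases List.mem_cons.1 hk with hk | hk
          · simp only [Prod.mk.injEq, List.cons.injEq] at hk
            rw [hk.2.1] at hk'; exact absurd hk' h
          · exact ⟨k, hk, hk'⟩

theorem mem_posRays {R : List Ray} {r : WeightedRay} :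
    r ∈ posRays R ↔ ∃ h : Pair, (r.1, h :: r.2.2) ∈ R ∧ h.2 < h.1 ∧ r.2.1 = h.1 - h.2 := by
  induction R with
  | nil => simp [posRays]
  | cons s t ih =>
    obtain ⟨m, v⟩ := s
    cases v with
    | nil =>
      have e : posRays ((m, []) :: t) = posRays t := rfl
      simp [e, ih]
    | cons g v =>
      have e : posRays ((m, g :: v) :: t) =
          if Nat.ble g.1 g.2 then posRays t else (m, g.1 - g.2, v) :: posRays t := boolRec_eq _ _ _
      have hb : Nat.ble g.1 g.2 = true ↔ g.1 ≤ g.2 := Nat.ble_eq.to_iff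
      rw [e]
      split_ifs with h <;> rw [hb] at h
      · rw [ih]
        constructor
        · rintro ⟨k, hk, hk'⟩; exact ⟨k, List.mem_cons_of_mem _ hk, hk'⟩
        · rintro ⟨k, hk, hk'⟩
          rcases List.mem_cons.1 hk with hk | hk
          · simp only [Prod.mk.injEq, List.cons.injEq] at hk
            rw [hk.2.1] at hk'; omega
          · exact ⟨k, hk, hk'⟩
      · simp only [List.mem_cons, ih]
        constructor
        · rintro (rfl | ⟨k, hk, hk'⟩)
          · exact ⟨g, Or.inl rfl, by omega, rfl⟩
          · exact ⟨k, Or.inr hk, hk'⟩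
        · rintro ⟨k, hk | hk, hk'⟩
          · left
            simp only [Prod.mk.injEq, List.cons.injEq] at hk
            rw [hk.2.1] at hk'
            exact Prod.ext hk.1 (Prod.ext hk'.2 hk.2.2)
          · exact Or.inr ⟨k, hk, hk'⟩

/-- Exchange the signs of the current equation. -/
def swapHead (r : Ray) : Ray := (r.1, (r.2.take 1).map Prod.swap ++ r.2.drop 1)

theorem negRays_eq (R : List Ray) : negRays R = posRays (R.map swapHead) := by
  induction R with
  | nil => rfl
  | cons s t ih =>
    obtain ⟨m, v⟩ := s
    cases v with
    | nil => exact ih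
    | cons g v =>
      change @Bool.rec (fun _ => List WeightedRay) ((m, Nat.sub g.2 g.1, v) :: negRays t)
        (negRays t) (Nat.ble g.2 g.1) = @Bool.rec (fun _ => List WeightedRay)
        ((m, Nat.sub g.2 g.1, v) :: posRays (t.map swapHead)) (posRays (t.map swapHead))
        (Nat.ble g.2 g.1)
      rw [ih]

theorem mem_negRays {R : List Ray} {r : WeightedRay} :
    r ∈ negRays R ↔ ∃ h : Pair, (r.1, h :: r.2.2) ∈ R ∧ h.1 < h.2 ∧ r.2.1 = h.2 - h.1 := by
  rw [negRays_eq, mem_posRays]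
  constructor
  · rintro ⟨h, hm, h1, h2⟩
    obtain ⟨⟨m, v⟩, hs, e⟩ := List.mem_map.1 hm
    cases v with
    | nil => simp [swapHead] at e
    | cons g v =>
      simp only [swapHead, List.take_succ_cons, List.take_zero, List.map_cons, List.map_nil,
        List.drop_succ_cons, List.drop_zero, List.cons_append, List.nil_append, Prod.mk.injEq,
        List.cons.injEq] at e
      obtain ⟨rfl, rfl, rfl⟩ := e
      exact ⟨g, hs, h1, h2⟩
  · rintro ⟨h, hm, h1, h2⟩
    exact ⟨h.swap, List.mem_map.2 ⟨_, hm, rfl⟩, h1, h2⟩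

/-- Subtract the largest possible multiple of `r` from `y`. -/
theorem exists_subtract {ι : Type*} (s : Finset ι) (y r : ι → ℝ) (hr : ∀ c ∈ s, 0 ≤ r c)
    (hy : ∀ c ∈ s, 0 ≤ y c) (hne : ∃ c ∈ s, 0 < r c) (hry : ∀ c ∈ s, 0 < r c → 0 < y c) :
    ∃ t : ℝ, 0 < t ∧ (∀ c ∈ s, 0 ≤ y c - t * r c) ∧
      (s.filter fun c => 0 < y c - t * r c).card < (s.filter fun c => 0 < y c).card := by
  classical
  -- The ratio test: the index of least ratio is the first at which `y - t * r` reaches zero, and it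
  -- leaves the support.
  obtain ⟨c₀, hc₀, hm⟩ := (s.filter fun c => 0 < r c).exists_min_image (fun c => y c / r c)
    (by obtain ⟨c, hc, h⟩ := hne; exact ⟨c, Finset.mem_filter.2 ⟨hc, h⟩⟩)
  obtain ⟨hs₀, hr₀⟩ := Finset.mem_filter.1 hc₀
  refine ⟨y c₀ / r c₀, div_pos (hry c₀ hs₀ hr₀) hr₀, fun c hc => ?_, ?_⟩
  · rcases (hr c hc).eq_or_lt with h | h
    · rw [← h]; simpa using hy c hc
    · have := hm c (Finset.mem_filter.2 ⟨hc, h⟩)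
      rw [le_div_iff₀ h] at this
      linarith
  · apply Finset.card_lt_card
    refine ⟨fun c hc => ?_, fun h => ?_⟩
    · obtain ⟨hc, h⟩ := Finset.mem_filter.1 hc
      refine Finset.mem_filter.2 ⟨hc, ?_⟩
      have : 0 ≤ y c₀ / r c₀ * r c :=
        mul_nonneg (div_pos (hry c₀ hs₀ hr₀) hr₀).le (hr c hc)
      linarith
    · have := (Finset.mem_filter.1 (h (Finset.mem_filter.2 ⟨hs₀, hry c₀ hs₀ hr₀⟩))).2
      rw [div_mul_cancel₀ _ hr₀.ne'] at this
      simp at this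

/-! ### Rays, supports and the invariant of the double description method -/

abbrev Vec := ℕ → ℝ

/-- `r` describes `y`: the mask is the support, the entries are the values of functionals. -/
def Describes (Φ : List (Vec →ₗ[ℝ] ℝ)) (r : Ray) (y : Vec) : Prop :=
  (∀ c, 0 ≤ y c) ∧ (∀ c, 0 < y c ↔ r.1.testBit c = true) ∧
    List.Forall₂ (fun φ p => φ y = val p) Φ r.2

/-- The rays in `R` belong to the cone of the nonnegative vectors of `W`, and the support of any
nonzero element of the cone contains the support of one of them. -/
def Spans (W : Submodule ℝ Vec) (Φ : List (Vec →ₗ[ℝ] ℝ)) (R : List Ray) : Prop :=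
  (∀ r ∈ R, ∃ y ∈ W, y ≠ 0 ∧ Describes Φ r y) ∧
    ∀ y ∈ W, (∀ c, 0 ≤ y c) → y ≠ 0 → ∃ r ∈ R, ∀ c, r.1.testBit c = true → 0 < y c

theorem exists_pos_of_ne_zero {y : Vec} (h : ∀ c, 0 ≤ y c) (hy : y ≠ 0) : ∃ c, 0 < y c := by
  by_contra! hc
  exact hy (funext fun c => le_antisymm (hc c) (h c))

/-- The ratio test inside a subspace. Vectors of `W` vanish from 81 on, so the size of the support
is finite and can serve as an induction measure. -/
theorem Spans.exists_sub {W : Submodule ℝ Vec} {Φ : List (Vec →ₗ[ℝ] ℝ)} {r : Ray}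
    (hW : ∀ y ∈ W, ∀ c, 81 ≤ c → y c = 0) {y z : Vec} (hy : y ∈ W) (h0 : ∀ c, 0 ≤ y c)
    (hz : z ∈ W) (hz0 : z ≠ 0) (hd : Describes Φ r z)
    (hs : ∀ c, r.1.testBit c = true → 0 < y c) :
    ∃ t : ℝ, 0 < t ∧ (∀ c, 0 ≤ (y - t • z) c) ∧
      ((Finset.range 81).filter fun c => 0 < (y - t • z) c).card <
        ((Finset.range 81).filter fun c => 0 < y c).card ∧ y - t • z ∈ W := by
  obtain ⟨c, hc⟩ := exists_pos_of_ne_zero hd.1 hz0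
  have hc81 : c < 81 := by
    by_contra h
    rw [hW z hz c (by omega)] at hc
    exact lt_irrefl _ hc
  obtain ⟨t, ht, ht', hcard⟩ := exists_subtract (Finset.range 81) y z (fun c _ => hd.1 c)
    (fun c _ => h0 c) ⟨c, Finset.mem_range.2 hc81, hc⟩ (fun c _ h => hs c ((hd.2.1 c).1 h))
  have hmem : y - t • z ∈ W := W.sub_mem hy (W.smul_mem t hz)
  refine ⟨t, ht, fun c => ?_, hcard, hmem⟩
  by_cases h : c < 81
  · simpa using ht' c (Finset.mem_range.2 h)
  · rw [hW _ hmem c (by omega)]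

/-- A functional that is negative somewhere on the cone is negative on one of the rays. -/
theorem Spans.exists_neg {W : Submodule ℝ Vec} {Φ : List (Vec →ₗ[ℝ] ℝ)} {R : List Ray}
    (hR : Spans W Φ R) (hW : ∀ y ∈ W, ∀ c, 81 ≤ c → y c = 0) (ψ : Vec →ₗ[ℝ] ℝ) (y : Vec)
    (hy : y ∈ W) (h0 : ∀ c, 0 ≤ y c) (hψ : ψ y < 0) :
    ∃ r ∈ R, ∃ z, Describes Φ r z ∧ ψ z < 0 ∧ ∀ c, r.1.testBit c = true → 0 < y c := by
  induction hn : ((Finset.range 81).filter fun c => 0 < y c).card using Nat.strong_induction_on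
    generalizing y with
  | _ n ih =>
    have hne : y ≠ 0 := by rintro rfl; simp at hψ
    obtain ⟨r, hr, hs⟩ := hR.2 y hy h0 hne
    obtain ⟨z, hz, hz0, hd⟩ := hR.1 r hr
    by_cases hψz : ψ z < 0
    · exact ⟨r, hr, z, hd, hψz, hs⟩
    -- Here `ψ z ≥ 0`, so subtracting a positive multiple of `z` keeps `ψ` negative while the
    -- support shrinks.
    obtain ⟨t, ht, ht', hcard, hmem⟩ := exists_sub hW hy h0 hz hz0 hd hs
    obtain ⟨r', hr', z', hd', hψ', hs'⟩ := ih _ (hn ▸ hcard) (y - t • z) hmem ht'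
      (by
        rw [map_sub, map_smul, smul_eq_mul]
        have := mul_nonneg ht.le (not_lt.1 hψz)
        linarith) rfl
    refine ⟨r', hr', z', hd', hψ', fun c hc => ?_⟩
    have h1 := hs' c hc
    simp only [Pi.sub_apply, Pi.smul_apply, smul_eq_mul] at h1
    have := mul_nonneg ht.le (hd.1 c)
    linarith

/-- If a functional vanishes on `y` and is positive on a ray below `y`, then it is negative on another
such ray. -/
theorem Spans.exists_opposite {W : Submodule ℝ Vec} {Φ : List (Vec →ₗ[ℝ] ℝ)} {R : List Ray}
    (hR : Spans W Φ R) (hW : ∀ y ∈ W, ∀ c, 81 ≤ c → y c = 0) (ψ : Vec →ₗ[ℝ] ℝ) {y z : Vec}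
    {r : Ray} (hy : y ∈ W) (h0 : ∀ c, 0 ≤ y c) (hψ : ψ y = 0) (hz : z ∈ W)
    (hz0 : z ≠ 0) (hd : Describes Φ r z) (hs : ∀ c, r.1.testBit c = true → 0 < y c)
    (hψz : 0 < ψ z) :
    ∃ r' ∈ R, ∃ z', Describes Φ r' z' ∧ ψ z' < 0 ∧ ∀ c, r'.1.testBit c = true → 0 < y c := by
  -- Since `ψ y = 0 < ψ z`, the functional is negative on `y - t • z`, which is still in the cone
  -- and has its support inside that of `y`.
  obtain ⟨t, ht, ht', -, hmem⟩ := exists_sub hW hy h0 hz hz0 hd hs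
  obtain ⟨r', hr', z', hd', hψ', hs'⟩ := hR.exists_neg hW ψ (y - t • z) hmem ht' (by
    rw [map_sub, map_smul, smul_eq_mul, hψ]
    have := mul_pos ht hψz
    linarith)
  refine ⟨r', hr', z', hd', hψ', fun c hc => ?_⟩
  have h1 := hs' c hc
  simp only [Pi.sub_apply, Pi.smul_apply, smul_eq_mul] at h1
  have := mul_nonneg ht.le (hd.1 c)
  linarith

/-- The weights are the absolute values of `φ` taken crosswise, so `φ` cancels. Both are positive
and the vectors nonnegative, so the support is exactly the union. -/
theorem describes_comb {φ : Vec →ₗ[ℝ] ℝ} {Φ : List (Vec →ₗ[ℝ] ℝ)} {m n : ℕ} {g h : Pair}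
    {v w : List Pair} {y z : Vec} (hy : Describes (φ :: Φ) (m, g :: v) y)
    (hz : Describes (φ :: Φ) (n, h :: w) z) (hg : g.2 < g.1) (hh : h.1 < h.2) :
    φ (((h.2 - h.1 : ℕ) : ℝ) • y + ((g.1 - g.2 : ℕ) : ℝ) • z) = 0 ∧
      Describes Φ (combRay (m, g.1 - g.2, v) (n, h.2 - h.1, w))
        (((h.2 - h.1 : ℕ) : ℝ) • y + ((g.1 - g.2 : ℕ) : ℝ) • z) := by
  obtain ⟨hy0, hys, hyv⟩ := hy
  obtain ⟨hz0, hzs, hzv⟩ := hz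
  rw [List.forall₂_cons] at hyv hzv
  have ha : 0 < ((h.2 - h.1 : ℕ) : ℝ) := by exact_mod_cast Nat.sub_pos_of_lt hh
  have hb : 0 < ((g.1 - g.2 : ℕ) : ℝ) := by exact_mod_cast Nat.sub_pos_of_lt hg
  refine ⟨?_, fun c => ?_, fun c => ?_, ?_⟩
  · rw [map_add, map_smul, map_smul, hyv.1, hzv.1, val, val, Nat.cast_sub hh.le,
      Nat.cast_sub hg.le, smul_eq_mul, smul_eq_mul]
    ring
  · exact add_nonneg (mul_nonneg ha.le (hy0 c)) (mul_nonneg hb.le (hz0 c))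
  · have e : (combRay (m, g.1 - g.2, v) (n, h.2 - h.1, w)).1 = m ||| n := rfl
    rw [e, Nat.testBit_or, Bool.or_eq_true, ← hys c, ← hzs c]
    simp only [Pi.add_apply, Pi.smul_apply, smul_eq_mul]
    constructor
    · intro hpos
      by_contra! hc
      have h1 : y c = 0 := le_antisymm hc.1 (hy0 c)
      have h2 : z c = 0 := le_antisymm hc.2 (hz0 c)
      simp [h1, h2] at hpos
    · rintro (hc | hc)
      · exact add_pos_of_pos_of_nonneg (mul_pos ha hc) (mul_nonneg hb.le (hz0 c))
      · exact add_pos_of_nonneg_of_pos (mul_nonneg ha.le (hy0 c)) (mul_pos hb hc)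
  · have e : (combRay (m, g.1 - g.2, v) (n, h.2 - h.1, w)).2 =
        List.zipWith (pairComb (h.2 - h.1) (g.1 - g.2)) v w := mapTwo_eq_zipWith _ _ _
    rw [e]
    have key : ∀ (Ψ : List (Vec →ₗ[ℝ] ℝ)) (v w : List Pair),
        List.Forall₂ (fun φ p => φ y = val p) Ψ v → List.Forall₂ (fun φ p => φ z = val p) Ψ w →
        List.Forall₂ (fun φ p => φ (((h.2 - h.1 : ℕ) : ℝ) • y + ((g.1 - g.2 : ℕ) : ℝ) • z) = val p)
          Ψ (List.zipWith (pairComb (h.2 - h.1) (g.1 - g.2)) v w) := by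
      intro Ψ v w h₁ h₂
      induction h₁ generalizing w with
      | nil => cases h₂; exact List.Forall₂.nil
      | cons e₁ _ ih =>
        cases h₂ with
        | cons e₂ t₂ =>
          refine List.Forall₂.cons ?_ (ih _ t₂)
          rw [map_add, map_smul, map_smul, e₁, e₂, val_pairComb, smul_eq_mul, smul_eq_mul]
    exact key Φ v w hyv.2 hzv.2

theorem Describes.tail {φ : Vec →ₗ[ℝ] ℝ} {Φ : List (Vec →ₗ[ℝ] ℝ)} {m : ℕ} {h : Pair}
    {v : List Pair} {y : Vec} (hy : Describes (φ :: Φ) (m, h :: v) y) :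
    Describes Φ (m, v) y :=
  ⟨hy.1, hy.2.1, (List.forall₂_cons.1 hy.2.2).2⟩

theorem Describes.exists_cons {φ : Vec →ₗ[ℝ] ℝ} {Φ : List (Vec →ₗ[ℝ] ℝ)} {r : Ray} {y : Vec}
    (hy : Describes (φ :: Φ) r y) : ∃ h v, r = (r.1, h :: v) ∧ φ y = val h := by
  obtain ⟨m, l⟩ := r
  cases l with
  | nil => exact absurd hy.2.2 (by simp)
  | cons h v => exact ⟨h, v, rfl, (List.forall₂_cons.1 hy.2.2).1⟩

theorem val_pos {h : Pair} : 0 < val h ↔ h.2 < h.1 := by simp [val]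

theorem val_neg {h : Pair} : val h < 0 ↔ h.1 < h.2 := by simp [val]

/-- Let `y` lie on the hyperplane, and take a ray supported inside the support of `y`. If `φ`
vanishes on the ray, the ray survives. Otherwise `Spans.exists_opposite` yields a ray of the
opposite sign that also lies below `y`, and the combination of the two is covered by a new mask. -/
theorem Spans.cutStep {W : Submodule ℝ Vec} {φ : Vec →ₗ[ℝ] ℝ} {Φ : List (Vec →ₗ[ℝ] ℝ)}
    {R : List Ray} (hR : Spans W (φ :: Φ) R) (hW : ∀ y ∈ W, ∀ c, 81 ≤ c → y c = 0) :
    Spans (W ⊓ LinearMap.ker φ) Φ (cutStep R) := by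
  have spec := insertPairs_spec (P := posRays R) (N := negRays R) (posRays R) (fun _ h => h)
    (zeroRays R)
  change Extends _ _ _ (Polystochastic.cutStep R) ∧
    (∀ p ∈ _, ∀ n ∈ _, Covers (Polystochastic.cutStep R) p n) at spec
  -- Shared by both signs: a positive and a negative ray below `y` produce a ray of the next stage
  -- below `y`.
  have cover : ∀ (p n : Ray) (h g : Pair) (v w : List Pair) (y : Vec), p ∈ R → n ∈ R →
      p = (p.1, h :: v) → n = (n.1, g :: w) → h.2 < h.1 → g.1 < g.2 →
      (∀ c, p.1.testBit c = true → 0 < y c) → (∀ c, n.1.testBit c = true → 0 < y c) →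
      ∃ r ∈ Polystochastic.cutStep R, ∀ c, r.1.testBit c = true → 0 < y c := by
    intro p n h g v w y hp hn ep en hh hg hpy hny
    obtain ⟨r, hr, hs⟩ := spec.2 (p.1, h.1 - h.2, v)
      (mem_posRays.2 ⟨h, ep ▸ hp, hh, rfl⟩) (n.1, g.2 - g.1, w)
      (mem_negRays.2 ⟨g, en ▸ hn, hg, rfl⟩)
    refine ⟨r, hr, fun c hc => ?_⟩
    have h1 := hs c hc
    have e : Nat.lor p.1 n.1 = p.1 ||| n.1 := rfl
    rw [e, Nat.testBit_or, Bool.or_eq_true] at h1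
    exact h1.elim (hpy c) (hny c)
  constructor
  · intro r hr
    rcases spec.1.2 r hr with h | ⟨p, hp, n, hn, rfl⟩
    · obtain ⟨h, hm, he⟩ := mem_zeroRays.1 h
      obtain ⟨y, hy, hy0, hd⟩ := hR.1 _ hm
      refine ⟨y, ⟨hy, ?_⟩, hy0, hd.tail⟩
      rw [SetLike.mem_coe, LinearMap.mem_ker, (List.forall₂_cons.1 hd.2.2).1, val, he, sub_self]
    · obtain ⟨g, hg, hg1, hg2⟩ := mem_posRays.1 hp
      obtain ⟨h, hh, hh1, hh2⟩ := mem_negRays.1 hn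
      obtain ⟨m, a, v⟩ := p
      obtain ⟨m', b, w⟩ := n
      simp only at hg2 hh2 hg hh
      subst hg2 hh2
      obtain ⟨y, hy, hy0, hd⟩ := hR.1 _ hg
      obtain ⟨z, hz, hz0, hd'⟩ := hR.1 _ hh
      have hc := describes_comb hd hd' hg1 hh1
      refine ⟨_, ⟨W.add_mem (W.smul_mem _ hy) (W.smul_mem _ hz), hc.1⟩, ?_, hc.2⟩
      obtain ⟨c, hc0⟩ := exists_pos_of_ne_zero hd.1 hy0
      intro h0
      have h1 := congrFun h0 c
      simp only [Pi.add_apply, Pi.smul_apply, smul_eq_mul, Pi.zero_apply] at h1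
      have ha : 0 < ((h.2 - h.1 : ℕ) : ℝ) := by exact_mod_cast Nat.sub_pos_of_lt hh1
      have hb : (0 : ℝ) ≤ ((g.1 - g.2 : ℕ) : ℝ) := Nat.cast_nonneg _
      have := mul_pos ha hc0
      have := mul_nonneg hb (hd'.1 c)
      linarith
  · rintro y ⟨hy, hφ⟩ h0 hne
    rw [SetLike.mem_coe, LinearMap.mem_ker] at hφ
    obtain ⟨r, hr, hs⟩ := hR.2 y hy h0 hne
    obtain ⟨z, hz, hz0, hd⟩ := hR.1 r hr
    obtain ⟨h, v, er, hv⟩ := hd.exists_cons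
    rcases lt_trichotomy (val h) 0 with hneg | hzero | hpos
    · obtain ⟨r', hr', z', hd', hψ', hs'⟩ := hR.exists_opposite hW (-φ) hy h0 (by simp [hφ]) hz
        hz0 hd hs (by simpa [hv] using hneg)
      obtain ⟨h', v', er', hv'⟩ := hd'.exists_cons
      exact cover r' r h' h v' v y hr' hr er' er (val_pos.1 (by simpa [hv'] using hψ'))
        (val_neg.1 hneg) hs' hs
    · refine ⟨(r.1, v), spec.1.1 _ (mem_zeroRays.2 ⟨h, er ▸ hr, ?_⟩), hs⟩
      rw [val, sub_eq_zero] at hzero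
      exact_mod_cast hzero
    · obtain ⟨r', hr', z', hd', hψ', hs'⟩ := hR.exists_opposite hW φ hy h0 hφ hz
        hz0 hd hs (by rwa [hv])
      obtain ⟨h', v', er', hv'⟩ := hd'.exists_cons
      exact cover r r' h h' v v' y hr hr' er er' (val_pos.1 hpos)
        (val_neg.1 (by rwa [hv'] at hψ')) hs hs'

theorem Spans.cuts {W : Submodule ℝ Vec} {Φ : List (Vec →ₗ[ℝ] ℝ)} {R : List Ray}
    (hR : Spans W Φ R) (hW : ∀ y ∈ W, ∀ c, 81 ≤ c → y c = 0) {y : Vec} (hy : y ∈ W)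
    (h0 : ∀ c, 0 ≤ y c) (hΦ : ∀ φ ∈ Φ, φ y = 0) (hne : y ≠ 0) :
    ∃ r ∈ cuts Φ.length R, ∀ c, r.1.testBit c = true → 0 < y c := by
  induction Φ generalizing W R with
  | nil => exact hR.2 y hy h0 hne
  | cons φ Φ ih =>
    exact ih (hR.cutStep hW) (fun z hz => hW z hz.1)
      ⟨hy, LinearMap.mem_ker.2 (hΦ φ List.mem_cons_self)⟩
      (fun ψ hψ => hΦ ψ (List.mem_cons_of_mem _ hψ))

/-- The functional whose coefficients start at the digit number `n`. -/
def equation (E n : ℕ) : Vec →ₗ[ℝ] ℝ :=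
  ∑ c ∈ Finset.range 81, val (coeffPair E (c + n)) • LinearMap.proj c

theorem equation_apply (E n : ℕ) (y : Vec) :
    equation E n y = ∑ c ∈ Finset.range 81, val (coeffPair E (c + n)) * y c := by
  simp [equation, LinearMap.sum_apply]

def equations (E : ℕ) : ℕ → ℕ → List (Vec →ₗ[ℝ] ℝ)
  | 0, _ => []
  | k + 1, n => equation E n :: equations E k (n + 81)

theorem length_equations (E k n : ℕ) : (equations E k n).length = k := by
  induction k generalizing n with
  | zero => rfl
  | succ k ih => rw [equations, List.length_cons, ih]

theorem forall₂_coeffColumn (E k n c : ℕ) (hc : c < 81) :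
    List.Forall₂ (fun φ p => φ (Pi.single c 1 : Vec) = val p) (equations E k n)
      (coeffColumn E k (c + n)) := by
  induction k generalizing n with
  | zero => exact List.Forall₂.nil
  | succ k ih =>
    refine List.Forall₂.cons ?_ (ih (n + 81))
    rw [equation_apply, Finset.sum_eq_single c]
    · simp
    · intro b _ hb; simp [Pi.single_eq_of_ne hb]
    · intro h; exact absurd (Finset.mem_range.2 hc) h

theorem mem_startRays {E k Z : ℕ} {cells : List ℕ} {r : Ray} :
    r ∈ startRays E k Z cells ↔
      ∃ c ∈ cells, Z.testBit c = false ∧ r = (1 <<< c, coeffColumn E k c) := by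
  induction cells with
  | nil => simp [startRays]
  | cons c t ih =>
    have e : startRays E k Z (c :: t) = if Z.testBit c then startRays E k Z t else
        (1 <<< c, coeffColumn E k c) :: startRays E k Z t := boolRec_eq _ _ _
    rw [e]
    split_ifs with h
    · rw [ih]; simp [h]
    · simp only [List.mem_cons, ih, exists_eq_or_imp]
      simp [h]

theorem testBit_one_shiftLeft (c d : ℕ) : (1 <<< c : ℕ).testBit d = true ↔ d = c := by
  rw [Nat.one_shiftLeft, Nat.testBit_two_pow]
  simp [eq_comm]

/-- Any nonzero nonnegative solution of the equations that vanishes outside the given cells and on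
the face `Z` contains one of the final masks in its support. -/
theorem exists_mem_cuts {E k Z : ℕ} {cells : List ℕ} (hcells : ∀ c ∈ cells, c < 81) {y : Vec}
    (h0 : ∀ c, 0 ≤ y c) (hy : ∀ c, y c ≠ 0 → c ∈ cells ∧ Z.testBit c = false)
    (hE : ∀ φ ∈ equations E k 0, φ y = 0) (hne : y ≠ 0) :
    ∃ r ∈ cuts k (startRays E k Z cells), ∀ c, r.1.testBit c = true → 0 < y c := by
  -- The coordinate subspace of the permitted cells. Its nonnegative part is an orthant, whose rays
  -- are the unit vectors of `startRays`.
  let W : Submodule ℝ Vec :=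
    { carrier := {y | ∀ c, y c ≠ 0 → c ∈ cells ∧ Z.testBit c = false}
      add_mem' := fun {a b} ha hb c hc => by
        by_cases h : a c = 0
        · exact hb c (by rintro h'; exact hc (by simp [h, h']))
        · exact ha c h
      zero_mem' := fun c hc => absurd rfl hc
      smul_mem' := fun t a ha c hc => ha c (by rintro h; exact hc (by simp [h])) }
  have hW : ∀ y ∈ W, ∀ c, 81 ≤ c → y c = 0 := by
    intro y hy c hc
    by_contra h
    exact absurd (hcells c (hy c h).1) (by omega)
  have hS : Spans W (equations E k 0) (startRays E k Z cells) := by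
    constructor
    · intro r hr
      obtain ⟨c, hc, hZ, rfl⟩ := mem_startRays.1 hr
      refine ⟨Pi.single c 1, fun d hd => ?_, ?_, fun d => ?_, fun d => ?_, ?_⟩
      · have : d = c := by by_contra h; exact hd (Pi.single_eq_of_ne h _)
        exact this ▸ ⟨hc, hZ⟩
      · intro h; simpa using congrFun h c
      · by_cases h : d = c
        · subst h; simp
        · rw [Pi.single_eq_of_ne h]
      · rw [testBit_one_shiftLeft]
        by_cases h : d = c
        · subst h; simp
        · rw [Pi.single_eq_of_ne h]; simp [h]
      · exact forall₂_coeffColumn E k 0 c (hcells c hc)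
    · intro y hy h0 hne
      obtain ⟨c, hc⟩ := exists_pos_of_ne_zero h0 hne
      refine ⟨_, mem_startRays.2 ⟨c, (hy c hc.ne').1, (hy c hc.ne').2, rfl⟩, fun d hd => ?_⟩
      rw [(testBit_one_shiftLeft c d).1 hd]
      exact hc
  have := hS.cuts hW hy h0 hE hne
  rwa [length_equations] at this

theorem natBeq_eq_true {a b : ℕ} : Nat.beq a b = true ↔ a = b :=
  ⟨Nat.eq_of_beq_eq_true, fun h => h ▸ Nat.beq_refl a⟩

/-! ### Cells and balanced arrays -/

/-- The index with the digits of `c` in base `3`. -/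
def cell (c : ℕ) : Fin 4 → Fin 3 :=
  ![Fin.ofNat 3 (c / 27), Fin.ofNat 3 (c / 9), Fin.ofNat 3 (c / 3), Fin.ofNat 3 c]

def code (α : Fin 4 → Fin 3) : ℕ := 27 * α 0 + 9 * α 1 + 3 * α 2 + α 3

theorem code_lt (α : Fin 4 → Fin 3) : code α < 81 := by
  unfold code
  have h0 := (α 0).isLt
  have h1 := (α 1).isLt
  have h2 := (α 2).isLt
  have h3 := (α 3).isLt
  omega

theorem cell_code (α : Fin 4 → Fin 3) : cell (code α) = α := by
  have h0 := (α 0).isLt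
  have h1 := (α 1).isLt
  have h2 := (α 2).isLt
  have h3 := (α 3).isLt
  funext i
  apply Fin.ext
  fin_cases i <;> simp [cell, code, Fin.ofNat] <;> omega

theorem code_cell {c : ℕ} (h : c < 81) : code (cell c) = c := by
  simp only [cell, code, Fin.ofNat, Matrix.cons_val]
  omega

theorem forall_cell {p : (Fin 4 → Fin 3) → Prop} (h : ∀ c < 81, p (cell c)) (α) : p α := by
  rw [← cell_code α]
  exact h _ (code_lt α)

theorem sum_cell {M : Type*} [AddCommMonoid M] (F : (Fin 4 → Fin 3) → M) :
    ∑ α, F α = ∑ c ∈ Finset.range 81, F (cell c) := by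
  refine Finset.sum_nbij' code cell (fun α _ => Finset.mem_range.2 (code_lt α))
    (fun _ _ => Finset.mem_univ _) (fun α _ => cell_code α)
    (fun c hc => code_cell (Finset.mem_range.1 hc)) (fun α _ => by rw [cell_code])

/-- All line sums are zero. -/
def balanced : Submodule ℝ (MultiMatrix 4 3) where
  carrier := {x | ∀ (i : Fin 4) (α : Fin 4 → Fin 3), ∑ k, x (Function.update α i k) = 0}
  zero_mem' := by simp
  add_mem' := by
    intro x y hx hy i α
    simp [Finset.sum_add_distrib, hx i α, hy i α]
  smul_mem' := by
    intro t x hx i α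
    simp [← Finset.mul_sum, hx i α]

/-- Balanced arrays of dimension `n`, indexed by the numbers below `3 ^ n`. -/
def FlatBalanced : ℕ → (ℕ → ℝ) → Prop
  | 0, _ => True
  | n + 1, X => (∀ c < 3 ^ n, X c + X (c + 3 ^ n) + X (c + 2 * 3 ^ n) = 0) ∧
      FlatBalanced n X ∧ FlatBalanced n fun c => X (c + 3 ^ n)

theorem line_zero {x : MultiMatrix 4 3} (hx : x ∈ balanced) (i : Fin 4) (c : ℕ)
    (h1 : cell (c + 3 ^ (3 - (i : ℕ))) = Function.update (cell c) i 1)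
    (h2 : cell (c + 2 * 3 ^ (3 - (i : ℕ))) = Function.update (cell c) i 2)
    (h0 : cell c = Function.update (cell c) i 0) :
    x (cell c) + x (cell (c + 3 ^ (3 - (i : ℕ)))) + x (cell (c + 2 * 3 ^ (3 - (i : ℕ)))) = 0 := by
  have := hx i (cell c)
  rw [Fin.sum_univ_three, ← h0, ← h1, ← h2] at this
  exact this

/-- Coordinate `0` is the most significant digit, hence the exponent `3 - i`. The condition picks
out the first cell of a line. -/
theorem cell_add_update : ∀ (i : Fin 4) (c : Fin 81), c / 3 ^ (3 - (i : ℕ)) % 3 = (0 : ℕ) →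
    cell (c + 3 ^ (3 - (i : ℕ))) = Function.update (cell c) i 1 ∧
    cell (c + 2 * 3 ^ (3 - (i : ℕ))) = Function.update (cell c) i 2 ∧
    cell c = Function.update (cell c) i 0 := by
  decide +kernel

/-- The induction runs over blocks of length `3 ^ n` aligned at multiples of `3 ^ n`. The recursion
enters only the first two thirds of a block, because the last third is determined by them. -/
theorem flatBalanced_aux {X : ℕ → ℝ} (h : ∀ i < 4, ∀ c < 81, c / 3 ^ i % 3 = 0 →
      X c + X (c + 3 ^ i) + X (c + 2 * 3 ^ i) = 0) {n a : ℕ} (hn : n ≤ 4)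
    (ha : 3 ^ n ∣ a) (ha' : a + 3 ^ n ≤ 81) : FlatBalanced n fun c => X (c + a) := by
  induction n generalizing a with
  | zero => trivial
  | succ n ih =>
    have hp : 0 < 3 ^ n := by positivity
    obtain ⟨b, rfl⟩ := ha
    rw [pow_succ] at ha' ⊢
    refine ⟨fun c hc => ?_, ?_, ?_⟩
    · have hq : (c + 3 ^ n * 3 * b) / 3 ^ n = 3 * b := by
        rw [mul_assoc, Nat.add_mul_div_left _ _ hp, Nat.div_eq_of_lt hc, zero_add]
      have := h n (by omega) (c + 3 ^ n * 3 * b) (by omega)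
        (by rw [hq]; omega)
      have e1 : c + 3 ^ n + 3 ^ n * 3 * b = c + 3 ^ n * 3 * b + 3 ^ n := by ring
      have e2 : c + 2 * 3 ^ n + 3 ^ n * 3 * b = c + 3 ^ n * 3 * b + 2 * 3 ^ n := by ring
      simpa only [e1, e2] using this
    · exact ih (by omega) ⟨3 * b, by ring⟩ (by omega)
    · have := ih (a := 3 ^ n + 3 ^ n * 3 * b) (by omega) ⟨1 + 3 * b, by ring⟩ (by omega)
      simpa only [add_assoc] using this

theorem flatBalanced_of_balanced {x : MultiMatrix 4 3} (hx : x ∈ balanced) :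
    FlatBalanced 4 fun c => x (cell c) := by
  have := flatBalanced_aux (X := fun c => x (cell c)) (n := 4) (a := 0) ?_ le_rfl (dvd_zero _)
    (by norm_num)
  · simpa using this
  · intro i hi c hc hd
    have h := cell_add_update ⟨3 - i, by omega⟩ ⟨c, hc⟩
    have hi' : 3 - (3 - i) = i := by omega
    have h0 := line_zero hx ⟨3 - i, by omega⟩ c
    simp only [hi'] at h h0
    obtain ⟨h1, h2, h3⟩ := h hd
    exact h0 h1 h2 h3

/-! ### Coordinates on balanced arrays -/

/-- The entries which determine a balanced array. -/
def base : ℕ → (ℕ → ℝ) → List ℝ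
  | 0, X => [X 0]
  | n + 1, X => base n X ++ base n fun c => X (c + 3 ^ n)

theorem length_base (n : ℕ) (X : ℕ → ℝ) : (base n X).length = 2 ^ n := by
  induction n generalizing X with
  | zero => rfl
  | succ n ih => simp [base, ih, pow_succ, mul_two]

def dot : List Pair → List ℝ → ℝ
  | p :: v, y :: b => val p * y + dot v b
  | _, _ => 0

theorem dot_append {v w : List Pair} {a b : List ℝ} (h : v.length = a.length) :
    dot (v ++ w) (a ++ b) = dot v a + dot w b := by
  induction v generalizing a with
  | nil =>
    cases a with
    | nil => simp [dot]
    | cons y a => simp at h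
  | cons p v ih =>
    cases a with
    | nil => simp at h
    | cons y a => simp only [List.cons_append, dot, ih (Nat.succ.inj h)]; ring

theorem coords_succ (n : ℕ) (f : ℕ → Pair) :
    coords (n + 1) f = coords n (fun c => pairSub (f c) (f (c + 2 * 3 ^ n))) ++
      coords n (fun c => pairSub (f (c + 3 ^ n)) (f (c + 2 * 3 ^ n))) := by
  change force (3 ^ n) (fun w =>
    coords n (fun c => pairSub (f c) (f (c + 2 * w))) ++
      coords n (fun c => pairSub (f (c + w)) (f (c + 2 * w)))) = _
  rw [force_eq]

theorem length_coords (n : ℕ) (f : ℕ → Pair) : (coords n f).length = 2 ^ n := by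
  induction n generalizing f with
  | zero => rfl
  | succ n ih => simp [coords_succ, ih, pow_succ, mul_two]

theorem val_pairSub (p q : Pair) : val (pairSub p q) = val p - val q := by
  rw [pairSub, val_reduced]
  simp only [Nat.add_eq, val]
  push_cast
  ring

/-- The last third of a balanced block is minus the sum of the other two, so its coefficients are
subtracted from theirs. Four rounds leave 16 coordinates. -/
theorem sum_mul_eq_dot (n : ℕ) (f : ℕ → Pair) (X : ℕ → ℝ) (h : FlatBalanced n X) :
    ∑ c ∈ Finset.range (3 ^ n), val (f c) * X c = dot (coords n f) (base n X) := by
  induction n generalizing f X with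
  | zero => simp [coords, base, dot]
  | succ n ih =>
    obtain ⟨h1, h2, h3⟩ := h
    rw [coords_succ, base, dot_append (by rw [length_coords, length_base]), ← ih _ _ h2,
      ← ih _ _ h3, show 3 ^ (n + 1) = 3 ^ n + 3 ^ n + 3 ^ n by ring, Finset.sum_range_add,
      Finset.sum_range_add, ← Finset.sum_add_distrib, ← Finset.sum_add_distrib,
      ← Finset.sum_add_distrib]
    refine Finset.sum_congr rfl fun c hc => ?_
    have := h1 c (Finset.mem_range.1 hc)
    have e : 3 ^ n + 3 ^ n + c = c + 2 * 3 ^ n := by ring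
    rw [e, add_comm (3 ^ n) c, val_pairSub, val_pairSub]
    linear_combination (val (f (c + 2 * 3 ^ n))) * this

theorem eq_zero_of_base (n : ℕ) (X : ℕ → ℝ) (h : FlatBalanced n X) (h0 : ∀ y ∈ base n X, y = 0) :
    ∀ c < 3 ^ n, X c = 0 := by
  induction n generalizing X with
  | zero =>
    intro c hc
    obtain rfl : c = 0 := by simpa using hc
    exact h0 _ (by simp [base])
  | succ n ih =>
    obtain ⟨h1, h2, h3⟩ := h
    have k1 := ih X h2 fun y hy => h0 y (by simp [base, hy])
    have k2 := ih _ h3 fun y hy => h0 y (by simp only [base, List.mem_append]; exact Or.inr hy)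
    intro c hc
    rw [pow_succ] at hc
    rcases lt_or_ge c (3 ^ n) with h | h
    · exact k1 c h
    · obtain ⟨d, rfl⟩ := Nat.exists_eq_add_of_le' h
      rcases lt_or_ge d (3 ^ n) with h' | h'
      · exact k2 d h'
      · obtain ⟨e, rfl⟩ := Nat.exists_eq_add_of_le' h'
        have he : e < 3 ^ n := by omega
        have := h1 e he
        rw [k1 e he, k2 e he] at this
        rw [show e + 3 ^ n + 3 ^ n = e + 2 * 3 ^ n by ring]
        linarith

theorem dot_of_allZero {v : List Pair} (h : allZero v = true) (b : List ℝ) : dot v b = 0 := by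
  induction v generalizing b with
  | nil => simp [dot]
  | cons p v ih =>
    change @Bool.rec (fun _ => Bool) false (allZero v) (Nat.beq p.1 p.2) = true at h
    rw [boolRec_eq] at h
    cases b with
    | nil => simp [dot]
    | cons y b =>
      split_ifs at h with h'
      have : p.1 = p.2 := Nat.eq_of_beq_eq_true h'
      simp [dot, ih h, val, this]

theorem val_pairCross (h g s t : Pair) :
    val (pairCross h g s t) = val h * val s - val g * val t := by
  rw [pairCross, val_reduced]
  simp only [Nat.add_eq, Nat.mul_eq, val]
  push_cast
  ring

theorem dot_mapTwo_pairCross (h g : Pair) {s t : List Pair} {b : List ℝ} (hs : s.length = b.length)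
    (ht : t.length = b.length) :
    dot (mapTwo (pairCross h g) s t) b = val h * dot s b - val g * dot t b := by
  rw [mapTwo_eq_zipWith]
  induction b generalizing s t with
  | nil => simp_all [dot]
  | cons y b ih =>
    obtain ⟨p, s, rfl⟩ := List.exists_cons_of_length_eq_add_one hs
    obtain ⟨q, t, rfl⟩ := List.exists_cons_of_length_eq_add_one ht
    simp only [List.zipWith_cons_cons, dot, val_pairCross,
      ih (Nat.succ.inj hs) (Nat.succ.inj ht)]
    ring

theorem findPivot_spec {vs : List (List Pair)} {h : Pair} {t : List Pair}
    (e : findPivot vs = h :: t) : h :: t ∈ vs ∧ val h ≠ 0 := by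
  induction vs with
  | nil => cases e
  | cons v vs ih =>
    cases v with
    | nil => exact ⟨List.mem_cons_of_mem _ (ih e).1, (ih e).2⟩
    | cons g s =>
      change @Bool.rec (fun _ => List Pair) (g :: s) (findPivot vs) (Nat.beq g.1 g.2) = _ at e
      rw [boolRec_eq] at e
      split_ifs at e with h'
      · exact ⟨List.mem_cons_of_mem _ (ih e).1, (ih e).2⟩
      · obtain ⟨rfl, rfl⟩ := List.cons.inj e
        refine ⟨List.mem_cons_self, fun h0 => h' ?_⟩
        rw [natBeq_eq_true]
        unfold val at h0
        exact_mod_cast sub_eq_zero.1 h0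

theorem mem_eliminate {h : Pair} {t : List Pair} {vs : List (List Pair)} {u : List Pair}
    (hu : u ∈ eliminate h t vs) :
    ∃ g s, g :: s ∈ vs ∧ (u = s ∧ val g = 0 ∨ u = mapTwo (pairCross h g) s t) := by
  induction vs with
  | nil => cases hu
  | cons v vs ih =>
    have lift (hu : u ∈ eliminate h t vs) : ∃ g s, g :: s ∈ v :: vs ∧
        (u = s ∧ val g = 0 ∨ u = mapTwo (pairCross h g) s t) := by
      obtain ⟨g, s, hm, hs⟩ := ih hu
      exact ⟨g, s, List.mem_cons_of_mem v hm, hs⟩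
    cases v with
    | nil => exact lift hu
    | cons g s =>
      change u ∈ @Bool.rec (fun _ => List (List Pair)) (mapTwo (pairCross h g) s t ::
        eliminate h t vs) (s :: eliminate h t vs) (Nat.beq g.1 g.2) at hu
      rw [boolRec_eq] at hu
      split_ifs at hu with h'
      · rcases List.mem_cons.1 hu with rfl | hu
        · have : g.1 = g.2 := Nat.eq_of_beq_eq_true h'
          exact ⟨g, u, List.mem_cons_self, Or.inl ⟨rfl, by simp [val, this]⟩⟩
        · exact lift hu
      · rcases List.mem_cons.1 hu with rfl | hu
        · exact ⟨g, s, List.mem_cons_self, Or.inr rfl⟩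
        · exact lift hu

/-- The eliminated vectors annihilate the tail of `b`, which therefore vanishes by induction. The
pivot equation, whose leading coefficient is nonzero, then forces the head to vanish. -/
theorem eq_zero_of_spanning {k : ℕ} {vs : List (List Pair)} (h : spanning k vs = true)
    (hvs : ∀ v ∈ vs, v.length = k) {b : List ℝ} (hb : b.length = k)
    (h0 : ∀ v ∈ vs, dot v b = 0) : ∀ y ∈ b, y = 0 := by
  induction k generalizing vs b with
  | zero => simp [List.eq_nil_of_length_eq_zero hb]
  | succ k ih =>
    obtain ⟨y, b, rfl⟩ := List.exists_cons_of_length_eq_add_one hb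
    change @List.rec Pair (fun _ => Bool) false (fun h t _ => spanning k (eliminate h t vs))
      (findPivot vs) = true at h
    cases e : findPivot vs with
    | nil => rw [e] at h; cases h
    | cons p t =>
      rw [e] at h
      obtain ⟨hm, hp⟩ := findPivot_spec e
      have hb' : b.length = k := Nat.succ.inj hb
      have ht : t.length = k := Nat.succ.inj (hvs _ hm)
      have hpt := h0 _ hm
      have key : ∀ z ∈ b, z = 0 := by
        refine ih h (fun u hu => ?_) hb' (fun u hu => ?_)
        · obtain ⟨g, s, hs, h' | h'⟩ := mem_eliminate hu
          · rw [h'.1]; exact Nat.succ.inj (hvs _ hs)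
          · rw [h', mapTwo_eq_zipWith, List.length_zipWith, ht,
              show s.length = k from Nat.succ.inj (hvs _ hs), min_self]
        · obtain ⟨g, s, hs, h' | h'⟩ := mem_eliminate hu
          · have := h0 _ hs
            simpa [dot, h'.1, h'.2] using this
          · have := h0 _ hs
            rw [h', dot_mapTwo_pairCross p g
              ((Nat.succ.inj (hvs _ hs)).trans hb'.symm) (ht.trans hb'.symm)]
            simp only [dot] at this hpt
            linear_combination val p * this - val g * hpt
      have hdot : dot t b = 0 := by
        clear hpt hm h0 ih hvs h e hb ht hb'
        induction b generalizing t with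
        | nil => cases t <;> simp [dot]
        | cons z b ih =>
          cases t with
          | nil => simp [dot]
          | cons q t =>
            simp [dot, key z List.mem_cons_self, ih _ fun z hz => key z (List.mem_cons_of_mem _ hz)]
      intro z hz
      rcases List.mem_cons.1 hz with rfl | hz
      · simp only [dot, hdot, add_zero, mul_eq_zero] at hpt
        exact hpt.resolve_left hp
      · exact key z hz

/-! ### Zeros of the listed matrices -/

theorem mem_zeroCellsFrom {j n a c : ℕ} :
    c ∈ zeroCellsFrom j n a ↔ a ≤ c ∧ c < a + n ∧ numerator j c = 0 := by
  induction n generalizing a with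
  | zero =>
    change c ∈ [] ↔ _
    simp only [List.not_mem_nil, false_iff]; omega
  | succ n ih =>
    change c ∈ @Bool.rec (fun _ => List ℕ) (zeroCellsFrom j n (a + 1))
      (a :: zeroCellsFrom j n (a + 1)) (Nat.beq (numerator j a) 0) ↔ _
    rw [boolRec_eq]
    split_ifs with h
    · rw [List.mem_cons, ih]
      have := Nat.eq_of_beq_eq_true h
      constructor
      · rintro (rfl | h') <;> [exact ⟨le_rfl, by omega, this⟩; omega]
      · intro h'
        by_cases hc : c = a <;> [exact Or.inl hc; exact Or.inr (by omega)]
    · rw [ih]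
      have : numerator j a ≠ 0 := fun h' => h (by rw [h']; rfl)
      constructor
      · intro h'; omega
      · rintro ⟨h1, h2, h3⟩
        have : c ≠ a := by rintro rfl; exact this h3
        omega

theorem mem_zeroCells {j c : ℕ} : c ∈ zeroCells j ↔ c < 81 ∧ numerator j c = 0 := by
  rw [zeroCells, mem_zeroCellsFrom]; simp

theorem mem_indicatorCoords {cells : List ℕ} {v : List Pair} :
    v ∈ indicatorCoords cells ↔ ∃ c ∈ cells, v = coords 4 (indicator c) := by
  induction cells with
  | nil => simp [indicatorCoords]
  | cons c cells ih =>
    change v ∈ _ :: indicatorCoords cells ↔ _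
    simp [ih]

theorem val_indicator (c d : ℕ) : val (indicator c d) = if c = d then 1 else 0 := by
  unfold indicator
  rw [boolRec_eq]
  by_cases h : c = d
  · simp [h, val]
  · have : Nat.beq c d = false := by
      rw [Bool.eq_false_iff, ne_eq, natBeq_eq_true]; exact h
    simp [h, this, val]

/-- Used twice: it shows that the listed matrices are vertices, and that no information is lost when
a balanced array is replaced by its values at the zeros. -/
theorem eq_zero_of_rigid {j : ℕ} (hj : rigid j = true) {x : MultiMatrix 4 3} (hx : x ∈ balanced)
    (h0 : ∀ α, numerator j (code α) = 0 → x α = 0) : x = 0 := by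
  have hX := flatBalanced_of_balanced hx
  have hb := eq_zero_of_spanning (b := base 4 fun c => x (cell c)) hj (fun v hv => ?_)
    (length_base 4 _) (fun v hv => ?_)
  · have := eq_zero_of_base 4 _ hX hb
    funext α
    exact forall_cell (p := fun α => x α = 0) this α
  · obtain ⟨c, -, rfl⟩ := mem_indicatorCoords.1 hv
    exact length_coords 4 _
  · obtain ⟨c, hc, rfl⟩ := mem_indicatorCoords.1 hv
    obtain ⟨hc, hn⟩ := mem_zeroCells.1 hc
    rw [← sum_mul_eq_dot 4 _ _ hX]
    refine Finset.sum_eq_zero fun d hd => ?_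
    rw [val_indicator]
    split_ifs with h
    · subst h
      rw [h0 (cell c) (by rwa [code_cell hc]), mul_zero]
    · rw [zero_mul]

/-- The values of `x` at the zeros of the listed matrix number `j`. -/
def zeroPart (j : ℕ) (x : MultiMatrix 4 3) : Vec :=
  fun c => if c < 81 ∧ numerator j c = 0 then x (cell c) else 0

/-- With the coefficients outside the zeros suppressed, the functional vanishes on balanced arrays,
and it sees only the values at the zeros. -/
theorem equation_zeroPart {j E n : ℕ} {x : MultiMatrix 4 3} (hx : x ∈ balanced)
    (h : allZero (coords 4 fun c => @Bool.rec (fun _ => Pair) (0, 0) (coeffPair E (Nat.add c n))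
      (Nat.beq (numerator j c) 0)) = true) : equation E n (zeroPart j x) = 0 := by
  rw [equation_apply]
  have := sum_mul_eq_dot 4 (fun c => @Bool.rec (fun _ => Pair) (0, 0) (coeffPair E (Nat.add c n))
      (Nat.beq (numerator j c) 0)) _ (flatBalanced_of_balanced hx)
  rw [dot_of_allZero h] at this
  rw [← this]
  refine Finset.sum_congr rfl fun c hc => ?_
  have hc : c < 81 := Finset.mem_range.1 hc
  rw [boolRec_eq]
  by_cases hn : numerator j c = 0
  · simp [zeroPart, hc, hn]
  · have : ¬ Nat.beq (numerator j c) 0 = true := by rwa [natBeq_eq_true]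
    simp [zeroPart, hn, val]

theorem equations_zeroPart {j E k n : ℕ} (h : equationsOk j E k n = true) {x : MultiMatrix 4 3}
    (hx : x ∈ balanced) : ∀ φ ∈ equations E k n, φ (zeroPart j x) = 0 := by
  induction k generalizing n with
  | zero => simp [equations]
  | succ k ih =>
    change @Bool.rec (fun _ => Bool) false (equationsOk j E k (Nat.add n 81)) _ = true at h
    rw [boolRec_eq] at h
    split_ifs at h with h'
    intro φ hφ
    simp only [equations, List.mem_cons] at hφ
    rcases hφ with rfl | hφ
    · exact equation_zeroPart hx h'
    · exact ih h φ hφ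

/-! ### The group of equivalences -/

/-- The action of the equivalences on indices. -/
def move (σ : Equiv.Perm (Fin 4)) (τ : Fin 4 → Equiv.Perm (Fin 3)) :
    Equiv.Perm (Fin 4 → Fin 3) where
  toFun α := fun i => τ i (α (σ i))
  invFun α := fun i => (τ (σ⁻¹ i))⁻¹ (α (σ⁻¹ i))
  left_inv α := by funext i; simp
  right_inv α := by funext i; simp

theorem move_apply (σ : Equiv.Perm (Fin 4)) (τ : Fin 4 → Equiv.Perm (Fin 3)) (α : Fin 4 → Fin 3)
    (i : Fin 4) : move σ τ α i = τ i (α (σ i)) := rfl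

theorem move_symm (σ : Equiv.Perm (Fin 4)) (τ : Fin 4 → Equiv.Perm (Fin 3)) :
    (move σ τ).symm = move σ⁻¹ fun i => (τ (σ⁻¹ i))⁻¹ :=
  Equiv.ext fun _ => rfl

/-- The equivalences, as a set of permutations of the indices. -/
def moves : Set (Equiv.Perm (Fin 4 → Fin 3)) := {γ | ∃ σ τ, γ = move σ τ}

theorem symm_mem_moves {γ : Equiv.Perm (Fin 4 → Fin 3)} (h : γ ∈ moves) : γ.symm ∈ moves := by
  obtain ⟨σ, τ, rfl⟩ := h
  exact ⟨_, _, move_symm σ τ⟩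

theorem equivalent_iff {A B : MultiMatrix 4 3} :
    MultiMatrix.Equivalent A B ↔ ∃ γ ∈ moves, B = A ∘ γ := by
  constructor
  · rintro ⟨σ, τ, h⟩
    exact ⟨_, ⟨σ, τ, rfl⟩, funext h⟩
  · rintro ⟨_, ⟨σ, τ, rfl⟩, rfl⟩
    exact ⟨σ, τ, fun α => rfl⟩

theorem move_update (σ : Equiv.Perm (Fin 4)) (τ : Fin 4 → Equiv.Perm (Fin 3)) (α : Fin 4 → Fin 3)
    (i : Fin 4) (k : Fin 3) :
    move σ τ (Function.update α i k) = Function.update (move σ τ α) (σ⁻¹ i) (τ (σ⁻¹ i) k) := by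
  funext j
  rw [move_apply]
  by_cases h : j = σ⁻¹ i
  · subst h; simp
  · have : σ j ≠ i := fun h' => h (by rw [← h']; simp)
    rw [Function.update_of_ne h, Function.update_of_ne this, move_apply]

/-- Equivalences map lines to lines. The direction `j` does not depend on `x`, so the statement
serves line sums equal to `0` and to `1` alike. -/
theorem sum_move_update {γ : Equiv.Perm (Fin 4 → Fin 3)} (hγ : γ ∈ moves) (i : Fin 4)
    (α : Fin 4 → Fin 3) : ∃ j, ∀ x : MultiMatrix 4 3,
      ∑ k, x (γ (Function.update α i k)) = ∑ k, x (Function.update (γ α) j k) := by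
  obtain ⟨σ, τ, rfl⟩ := hγ
  refine ⟨σ⁻¹ i, fun x => ?_⟩
  simp only [move_update]
  exact Equiv.sum_comp (τ (σ⁻¹ i)) fun k => x (Function.update (move σ τ α) (σ⁻¹ i) k)

theorem comp_mem_balanced {γ : Equiv.Perm (Fin 4 → Fin 3)} (hγ : γ ∈ moves)
    {x : MultiMatrix 4 3} (hx : x ∈ balanced) : x ∘ γ ∈ balanced := by
  intro i α
  obtain ⟨j, h⟩ := sum_move_update hγ i α
  exact (h x).trans (hx j _)

theorem comp_mem_birkhoffPolytope {γ : Equiv.Perm (Fin 4 → Fin 3)} (hγ : γ ∈ moves)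
    {x : MultiMatrix 4 3} (hx : x ∈ MultiMatrix.birkhoffPolytope 4 3) :
    x ∘ γ ∈ MultiMatrix.birkhoffPolytope 4 3 := by
  refine ⟨fun α => hx.1 _, fun i α => ?_⟩
  obtain ⟨j, h⟩ := sum_move_update hγ i α
  exact (h x).trans (hx.2 j _)

theorem sub_mem_balanced {x y : MultiMatrix 4 3} (hx : x ∈ MultiMatrix.birkhoffPolytope 4 3)
    (hy : y ∈ MultiMatrix.birkhoffPolytope 4 3) : x - y ∈ balanced := by
  intro i α
  simp only [Pi.sub_apply, Finset.sum_sub_distrib, hx.2 i α, hy.2 i α, sub_self]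

/-! ### Numbers of group elements -/

theorem exists_perm4 : ∀ s : Fin 24, ∃ σ : Equiv.Perm (Fin 4), ∀ i : Fin 4,
    place (1296 * s) i = 2 * (3 - σ i) := by decide +kernel

theorem exists_perm3 : ∀ t : Fin 6, ∃ τ : Equiv.Perm (Fin 3), ∀ a : Fin 3,
    twoBits (table3 t) (2 * a) = τ a := by decide +kernel

theorem exists_number3 : ∀ τ : Equiv.Perm (Fin 3), ∃ t : Fin 6, ∀ a : Fin 3,
    twoBits (table3 t) (2 * a) = τ a := by decide +kernel

theorem twoBits_spread : ∀ (c : Fin 81) (i : Fin 4),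
    twoBits (spread c) (2 * (3 - i)) = cell c i := by decide +kernel

theorem table3_mod (t : ℕ) : table3 (t % 6) = table3 t := by
  change Nat.land (Nat.shiftRight perms3 (Nat.mul 6 (t % 6 % 6))) 63 = _
  rw [Nat.mod_mod]
  rfl

theorem place_div (g i : ℕ) : place (1296 * (g / 1296)) i = place g i := by
  change Nat.land (Nat.shiftRight perms4 (Nat.add (Nat.mul 16 (1296 * (g / 1296) / 1296)) _)) 15 = _
  rw [Nat.mul_div_cancel_left _ (by norm_num)]
  rfl

theorem act_eq {g : ℕ} {σ : Equiv.Perm (Fin 4)} {τ : Fin 4 → Equiv.Perm (Fin 3)}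
    (hσ : ∀ i : Fin 4, place g i = 2 * (3 - σ i))
    (hτ : ∀ (i : Fin 4) (a : Fin 3), twoBits (table3 (g / 6 ^ (i : ℕ))) (2 * a) = τ i a)
    (α : Fin 4 → Fin 3) : act g (spread (code α)) = code (move σ τ α) := by
  have h (i : Fin 4) : twoBits (spread (code α)) (place g i) = α (σ i) := by
    have := twoBits_spread ⟨code α, code_lt α⟩ (σ i)
    rw [hσ, this, cell_code]
  have h' (i : Fin 4) : twoBits (table3 (g / 6 ^ (i : ℕ)))
      (Nat.mul 2 (twoBits (spread (code α)) (place g i))) = τ i (α (σ i)) := by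
    rw [h, ← hτ]
    rfl
  have h0 := h' 0
  have h1 := h' 1
  have h2 := h' 2
  have h3 := h' 3
  norm_num at h0 h1 h2 h3
  change 27 * twoBits (table3 g) (2 * twoBits (spread (code α)) (place g 0)) +
    (9 * twoBits (table3 (g / 6)) (2 * twoBits (spread (code α)) (place g 1)) +
    (3 * twoBits (table3 (g / 36)) (2 * twoBits (spread (code α)) (place g 2)) +
    twoBits (table3 (g / 216)) (2 * twoBits (spread (code α)) (place g 3)))) = _
  rw [h0, h1, h2, h3, code]
  simp only [move_apply]
  ring

theorem exists_move (g : ℕ) (hg : g < 31104) :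
    ∃ γ ∈ moves, ∀ α, act g (spread (code α)) = code (γ α) := by
  obtain ⟨σ, hσ⟩ := exists_perm4 ⟨g / 1296, by omega⟩
  choose τ hτ using fun i : Fin 4 => exists_perm3 ⟨g / 6 ^ (i : ℕ) % 6, Nat.mod_lt _ (by norm_num)⟩
  refine ⟨move σ τ, ⟨σ, τ, rfl⟩, act_eq (fun i => ?_) fun i a => ?_⟩
  · rw [← hσ, place_div]
  · rw [← hτ, table3_mod]

/-- The numbering is exhaustive once the permutation of the directions is fixed. Only the
non-symmetry check needs this; witnesses and automorphisms use `exists_move`. -/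
theorem exists_number (σ : Equiv.Perm (Fin 4)) (τ : Fin 4 → Equiv.Perm (Fin 3)) {s : ℕ}
    (hσ : ∀ i : Fin 4, place (1296 * s) i = 2 * (3 - σ i)) :
    ∃ t < 1296, ∀ α, act (1296 * s + t) (spread (code α)) = code (move σ τ α) := by
  choose t ht using fun i : Fin 4 => exists_number3 (τ i)
  have b0 := (t 0).isLt
  have b1 := (t 1).isLt
  have b2 := (t 2).isLt
  have b3 := (t 3).isLt
  refine ⟨t 0 + 6 * t 1 + 36 * t 2 + 216 * t 3, by omega, act_eq (fun i => ?_) fun i a => ?_⟩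
  · rw [← hσ, ← place_div (1296 * s + _)]
    congr 1
    omega
  · rw [← ht, ← table3_mod]
    congr 2
    obtain rfl | rfl | rfl | rfl : i = 0 ∨ i = 1 ∨ i = 2 ∨ i = 3 := by
      revert i; decide
    all_goals norm_num; omega

theorem withAct_eq {α : Type} (g : ℕ) (f : (ℕ → ℕ) → α) : withAct g f = f (act g) := by
  simp only [withAct, force_eq]
  rfl

/-! ### The listed matrices -/

theorem listedNumerator_eq : ∀ (i : Fin 21) (c : Fin 81),
    MultiMatrix.listedNumerator i (finProdFinEquiv (cell c 0, cell c 2))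
      (finProdFinEquiv (cell c 1, cell c 3)) = numerator i c := by decide +kernel

theorem listed_apply (i : Fin 21) (α : Fin 4 → Fin 3) :
    MultiMatrix.listed i α = (numerator i (code α) : ℝ) / MultiMatrix.listedDenominator i := by
  have := listedNumerator_eq i ⟨code α, code_lt α⟩
  simp only [cell_code] at this
  rw [MultiMatrix.listed, MultiMatrix.ofBlocks, this]

theorem listedDenominator_pos : ∀ i, 0 < MultiMatrix.listedDenominator i := by decide

theorem listed_eq_zero {i : Fin 21} {α : Fin 4 → Fin 3} :
    MultiMatrix.listed i α = 0 ↔ numerator i (code α) = 0 := by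
  have := (listedDenominator_pos i).ne'
  rw [listed_apply, div_eq_zero_iff]
  simp [this]

theorem sum_numerator : ∀ (j : Fin 21) (i : Fin 4) (c : Fin 81),
    ∑ k, numerator j (code (Function.update (cell c) i k)) = MultiMatrix.listedDenominator j := by
  decide +kernel

theorem listed_mem_birkhoffPolytope (i : Fin 21) :
    MultiMatrix.listed i ∈ MultiMatrix.birkhoffPolytope 4 3 := by
  have hD : (0 : ℝ) < MultiMatrix.listedDenominator i := by exact_mod_cast listedDenominator_pos i
  refine ⟨fun α => ?_, fun j α => ?_⟩
  · rw [listed_apply]; positivity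
  · simp only [listed_apply]
    rw [← Finset.sum_div, div_eq_one_iff_eq hD.ne']
    have := sum_numerator i j ⟨code α, code_lt α⟩
    simp only [cell_code] at this
    exact_mod_cast this

/-- The matrices equivalent to a listed one. -/
def known : Set (MultiMatrix 4 3) := {B | ∃ i, MultiMatrix.Equivalent (MultiMatrix.listed i) B}

theorem comp_mem_known {B : MultiMatrix 4 3} (h : B ∈ known) {γ : Equiv.Perm (Fin 4 → Fin 3)}
    (hγ : γ ∈ moves) : B ∘ γ ∈ known := by
  obtain ⟨i, h⟩ := h
  exact ⟨i, h.trans (equivalent_iff.2 ⟨γ, hγ, rfl⟩)⟩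

theorem listed_mem_known (i : Fin 21) : MultiMatrix.listed i ∈ known :=
  ⟨i, MultiMatrix.Equivalent.refl _⟩

theorem mem_birkhoffPolytope_of_equivalent {A B : MultiMatrix 4 3}
    (h : MultiMatrix.Equivalent A B) (hA : A ∈ MultiMatrix.birkhoffPolytope 4 3) :
    B ∈ MultiMatrix.birkhoffPolytope 4 3 := by
  obtain ⟨γ, hγ, rfl⟩ := equivalent_iff.1 h
  exact comp_mem_birkhoffPolytope hγ hA

theorem known_subset : known ⊆ MultiMatrix.birkhoffPolytope 4 3 := by
  rintro B ⟨i, h⟩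
  exact mem_birkhoffPolytope_of_equivalent h (listed_mem_birkhoffPolytope i)

/-! ### Cones at the listed matrices -/

/-- The index is a zero of the listed matrix number `j`. -/
def IsZero (j : ℕ) (α : Fin 4 → Fin 3) : Prop := numerator j (code α) = 0

theorem mem_zeroCells_iff {j c : ℕ} : c ∈ zeroCells j ↔ c < 81 ∧ IsZero j (cell c) := by
  rw [mem_zeroCells]
  exact and_congr_right fun h => by rw [IsZero, code_cell h]

/-- A known matrix that differs from the listed matrix number `j` but vanishes at those of its
zeros at which `x` vanishes. -/
def HasWitness (j : ℕ) (x : MultiMatrix 4 3) : Prop :=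
  ∃ B ∈ known, (∃ α, IsZero j α ∧ B α ≠ 0) ∧ ∀ α, IsZero j α → B α ≠ 0 → x α ≠ 0

/-- The mask `Z` describes a face of the cone at the listed matrix number `j`; all its nonzero
elements have witnesses. -/
def FaceOk (j Z : ℕ) : Prop :=
  ∀ x ∈ balanced, (∀ α, IsZero j α → 0 ≤ x α) → x ≠ 0 →
    (∀ α, IsZero j α → Z.testBit (code α) = true → x α = 0) → HasWitness j x

theorem mem_cellData {cells : List ℕ} {d : CellData} :
    d ∈ cellData cells ↔ ∃ c ∈ cells, d = (c, spread c, 1 <<< c) := by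
  induction cells with
  | nil => simp [cellData]
  | cons c cells ih =>
    change d ∈ force (spread c) (fun s => force (Nat.shiftLeft 1 c) fun b =>
      (c, s, b) :: cellData cells) ↔ _
    rw [force_eq, force_eq, List.mem_cons, ih]
    simp

theorem testBit_supportMask {j : ℕ} {f : ℕ → ℕ} {cells : List ℕ} {c : ℕ} :
    (supportMask j f (cellData cells)).testBit c = true ↔
      c ∈ cells ∧ numerator j (f (spread c)) ≠ 0 := by
  induction cells with
  | nil => simp [supportMask, cellData]
  | cons d cells ih =>
    have : cellData (d :: cells) = (d, spread d, 1 <<< d) :: cellData cells := by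
      change force (spread d) (fun s => force (Nat.shiftLeft 1 d) fun b =>
        (d, s, b) :: cellData cells) = _
      rw [force_eq, force_eq]
      rfl
    rw [this]
    change (@Bool.rec (fun _ => ℕ) (Nat.lor (1 <<< d) (supportMask j f (cellData cells)))
      (supportMask j f (cellData cells)) (Nat.beq (numerator j (f (spread d))) 0)).testBit c = true
      ↔ _
    rw [boolRec_eq]
    split_ifs with h
    · rw [natBeq_eq_true] at h
      rw [ih, List.mem_cons]
      constructor
      · exact fun h' => ⟨Or.inr h'.1, h'.2⟩
      · rintro ⟨rfl | h1, h2⟩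
        · exact absurd h h2
        · exact ⟨h1, h2⟩
    · rw [natBeq_eq_true] at h
      change ((1 <<< d) ||| supportMask j f (cellData cells)).testBit c = true ↔ _
      rw [Nat.testBit_or, Bool.or_eq_true, testBit_one_shiftLeft, ih, List.mem_cons]
      constructor
      · rintro (rfl | h')
        · exact ⟨Or.inl rfl, h⟩
        · exact ⟨Or.inr h'.1, h'.2⟩
      · rintro ⟨rfl | h1, h2⟩
        · exact Or.inl rfl
        · exact Or.inr ⟨h1, h2⟩

/-- The matrix that a witness number stands for. -/
theorem exists_known (w : ℕ) : ∃ B ∈ known, ∀ (cells : List ℕ) (α : Fin 4 → Fin 3),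
    (witnessMask (cellData cells) w).testBit (code α) = true ↔ code α ∈ cells ∧ B α ≠ 0 := by
  obtain ⟨γ, hγ, h⟩ := exists_move (w / 32 % 31104) (Nat.mod_lt _ (by norm_num))
  refine ⟨_, comp_mem_known (listed_mem_known ⟨w % 32 % 21, Nat.mod_lt _ (by norm_num)⟩) hγ,
    fun cells α => ?_⟩
  rw [witnessMask, withAct_eq, testBit_supportMask]
  refine and_congr_right fun _ => not_congr ?_
  rw [Function.comp_apply, listed_eq_zero, ← h]
  rfl

theorem exists_testBit_of_ne_zero {m : ℕ} (h : m ≠ 0) : ∃ c, m.testBit c = true := by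
  by_contra! h'
  exact h (Nat.eq_of_testBit_eq fun c => by simp [h' c])

theorem hasWitness_of_witnessMask {j w : ℕ} {x : MultiMatrix 4 3}
    (h0 : witnessMask (cellData (zeroCells j)) w ≠ 0)
    (h : ∀ α, IsZero j α →
      (witnessMask (cellData (zeroCells j)) w).testBit (code α) = true → x α ≠ 0) :
    HasWitness j x := by
  obtain ⟨B, hB, hw⟩ := exists_known w
  obtain ⟨c, hc⟩ := exists_testBit_of_ne_zero h0
  have hc' : c < 81 ∧ IsZero j (cell c) := by
    obtain ⟨hc, -⟩ := testBit_supportMask.1 (by rwa [witnessMask, withAct_eq] at hc)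
    exact mem_zeroCells_iff.1 hc
  refine ⟨B, hB, ⟨cell c, hc'.2, ?_⟩, fun α hα hBα => h α hα ?_⟩
  · rw [← code_cell hc'.1] at hc
    exact ((hw _ _).1 hc).2
  · rw [hw, mem_zeroCells_iff]
    exact ⟨⟨code_lt α, by rwa [cell_code]⟩, hBα⟩

theorem exists_of_witnessesOk {cells : List CellData} {R : List Ray} {S : ℕ}
    (h : witnessesOk cells R S = true) {r : Ray} (hr : r ∈ R) :
    ∃ w, witnessMask cells w ≠ 0 ∧ BitSubset (witnessMask cells w) r.1 := by
  induction R generalizing S with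
  | nil => cases hr
  | cons q R ih =>
    change @Bool.rec (fun _ => Bool) false (witnessesOk cells R (Nat.shiftRight S 20))
      (witnessOk cells q.1 (Nat.mod S 1048576)) = true at h
    rw [boolRec_eq] at h
    split_ifs at h with h'
    rcases List.mem_cons.1 hr with rfl | hr
    · rw [witnessOk, force_eq, boolRec_eq] at h'
      refine ⟨Nat.mod S 1048576, ?_, ?_⟩
      · intro h0
        simp [h0] at h'
      · split_ifs at h'
        exact bitSubset_of_land (natBeq_eq_true.1 h')
    · exact ih h hr

theorem zeroPart_code {j : ℕ} {x : MultiMatrix 4 3} {α : Fin 4 → Fin 3} (h : IsZero j α) :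
    zeroPart j x (code α) = x α := by
  rw [zeroPart, if_pos ⟨code_lt α, h⟩, cell_code]

/-- The values of `x` at the zeros form a nonnegative solution of the equations, nonzero by
rigidity. Its support contains a final mask, and that mask contains the support of a witness. -/
theorem faceOk_leaf {j E k Z S : ℕ} (hj : rigid j = true) (hE : equationsOk j E k 0 = true)
    (h : witnessesOk (cellData (zeroCells j)) (cuts k (startRays E k Z (zeroCells j))) S = true) :
    FaceOk j Z := by
  intro x hx hpos hne hZ
  have h0 (c : ℕ) : 0 ≤ zeroPart j x c := by
    unfold zeroPart
    split_ifs with hc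
    · exact hpos _ (by rw [IsZero, code_cell hc.1]; exact hc.2)
    · exact le_rfl
  have hy : zeroPart j x ≠ 0 := by
    intro hy
    refine hne (eq_zero_of_rigid hj hx fun α hα => ?_)
    rw [← zeroPart_code (j := j) (x := x) hα, hy]
    rfl
  have hsupp (c : ℕ) (hc : zeroPart j x c ≠ 0) : c ∈ zeroCells j ∧ Z.testBit c = false := by
    have hc' : c < 81 ∧ numerator j c = 0 := by
      by_contra hn
      exact hc (if_neg hn)
    refine ⟨mem_zeroCells.2 hc', ?_⟩
    by_contra hn
    have hz : IsZero j (cell c) := by rw [IsZero, code_cell hc'.1]; exact hc'.2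
    refine hc ?_
    rw [zeroPart, if_pos hc']
    exact hZ _ hz (by rw [code_cell hc'.1]; simpa using hn)
  obtain ⟨r, hr, hr'⟩ := exists_mem_cuts (fun c hc => (mem_zeroCells.1 hc).1) h0 hsupp
    (equations_zeroPart hE hx) hy
  obtain ⟨w, hw, hw'⟩ := exists_of_witnessesOk h hr
  refine hasWitness_of_witnessMask hw fun α hα hb => ?_
  have := hr' _ (hw' _ hb)
  rw [zeroPart_code hα] at this
  exact this.ne'

theorem exists_of_holdsAt {f : ℕ → Bool} {L : List ℕ} {l : ℕ} (h : holdsAt f L l = true) :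
    ∃ a ∈ L, f a = true := by
  induction L generalizing l with
  | nil => cases h
  | cons a L ih =>
    cases l with
    | zero => exact ⟨a, List.mem_cons_self, h⟩
    | succ l =>
      obtain ⟨b, hb, hf⟩ := ih h
      exact ⟨b, List.mem_cons_of_mem _ hb, hf⟩

theorem forall_of_allCells {cells : List CellData} {f : CellData → Bool}
    (h : allCells cells f = true) : ∀ d ∈ cells, f d = true := by
  induction cells with
  | nil => simp
  | cons c cells ih =>
    change @Bool.rec (fun _ => Bool) false (allCells cells f) (f c) = true at h
    rw [boolRec_eq] at h
    split_ifs at h with h'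
    intro d hd
    rcases List.mem_cons.1 hd with rfl | hd
    · exact h'
    · exact ih h d hd

theorem of_movesInto {cells : List ℕ} {g Y Z : ℕ} (h : movesInto (cellData cells) g Y Z = true) :
    ∀ c ∈ cells, Y.testBit c = true → Z.testBit (act g (spread c)) = true := by
  rw [movesInto, withAct_eq] at h
  intro c hc hY
  have := forall_of_allCells h _ (mem_cellData.2 ⟨c, hc, rfl⟩)
  change @Bool.rec (fun _ => Bool) true (Nat.testBit Z (act g (spread c))) (Nat.testBit Y c) = true
    at this
  rw [boolRec_eq, if_pos hY] at this
  exact this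

theorem of_childrenOk {cells0 : List CellData} {auts faces : List ℕ} {Z m : ℕ}
    {cells : List CellData} {S : ℕ} (h : childrenOk cells0 auts faces Z m cells S = true) :
    ∀ d ∈ cells, m.testBit d.1 = true →
      ∃ Y ∈ faces, ∃ g ∈ auts, movesInto cells0 g Y (Z ||| d.2.2) = true := by
  induction cells generalizing S with
  | nil => simp
  | cons c cells ih =>
    change @Bool.rec (fun _ => Bool) (childrenOk cells0 auts faces Z m cells S)
      (@Bool.rec (fun _ => Bool) false (childrenOk cells0 auts faces Z m cells
          (Nat.shiftRight S 16))
        (holdsAt (fun Y => holdsAt (fun g => movesInto cells0 g Y (Nat.lor Z c.2.2)) auts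
          (Nat.div (Nat.mod S 65536) 256)) faces (Nat.mod S 256)))
      (Nat.testBit m c.1) = true at h
    rw [boolRec_eq, boolRec_eq] at h
    intro d hd hm
    rcases List.mem_cons.1 hd with rfl | hd
    · rw [if_pos hm] at h
      split_ifs at h with h'
      obtain ⟨Y, hY, hg⟩ := exists_of_holdsAt h'
      obtain ⟨g, hg, hgY⟩ := exists_of_holdsAt hg
      exact ⟨Y, hY, g, hg, hgY⟩
    · split_ifs at h
      · exact ih h d hd hm
      · exact ih h d hd hm

/-- The group element number `g` fixes the listed matrix number `j`. -/
def Fixes (j g : ℕ) : Prop :=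
  g < 31104 ∧ ∀ c < 81, numerator j (act g (spread c)) = numerator j c

/-- The automorphism carries `x` into the face of `Y`, and its inverse carries the witness back. A
larger mask means a smaller face, so moving `Y` into `Z` is enough. -/
theorem FaceOk.of_aut {j Y Z g : ℕ} (hY : FaceOk j Y) (hg : Fixes j g)
    (h : ∀ c ∈ zeroCells j, Y.testBit c = true → Z.testBit (act g (spread c)) = true) :
    FaceOk j Z := by
  intro x hx hpos hne hZ
  obtain ⟨γ, hγ, hγg⟩ := exists_move g hg.1
  have hz (α : Fin 4 → Fin 3) : IsZero j (γ α) ↔ IsZero j α := by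
    rw [IsZero, ← hγg, hg.2 _ (code_lt α)]
    rfl
  obtain ⟨B, hB, ⟨α, hα, hBα⟩, hw⟩ := hY (x ∘ γ) (comp_mem_balanced hγ hx)
    (fun α hα => hpos _ ((hz α).2 hα))
    (fun h0 => hne (by
      funext α
      have := congrFun h0 (γ.symm α)
      simpa using this))
    (fun α hα hYα => hZ _ ((hz α).2 hα) (by
      rw [← hγg]
      exact h _ (mem_zeroCells.2 ⟨code_lt α, hα⟩) hYα))
  refine ⟨B ∘ γ.symm, comp_mem_known hB (symm_mem_moves hγ), ⟨γ α, (hz α).2 hα, by simpa⟩,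
    fun β hβ hBβ => ?_⟩
  have := hw (γ.symm β) ((hz _).1 (by simpa)) hBβ
  simpa using this

/-- Either `x` is nonzero on the whole support of the proposed witness, which then works, or `x`
vanishes at one of these cells. In the second case the cell joins the mask, and an earlier face
applies. -/
theorem faceOk_branch {j Z w S : ℕ} {auts faces : List ℕ} (hauts : ∀ g ∈ auts, Fixes j g)
    (hfaces : ∀ Y ∈ faces, FaceOk j Y) (h0 : witnessMask (cellData (zeroCells j)) w ≠ 0)
    (h : childrenOk (cellData (zeroCells j)) auts faces Z
      (witnessMask (cellData (zeroCells j)) w) (cellData (zeroCells j)) S = true) :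
    FaceOk j Z := by
  intro x hx hpos hne hZ
  by_cases hw : ∀ α, IsZero j α →
      (witnessMask (cellData (zeroCells j)) w).testBit (code α) = true → x α ≠ 0
  · exact hasWitness_of_witnessMask h0 hw
  · push Not at hw
    obtain ⟨α, hα, hwα, hxα⟩ := hw
    have hmem : code α ∈ zeroCells j := mem_zeroCells.2 ⟨code_lt α, hα⟩
    obtain ⟨Y, hY, g, hg, hgY⟩ := of_childrenOk h _ (mem_cellData.2 ⟨code α, hmem, rfl⟩) hwα
    refine (hfaces Y hY).of_aut (hauts g hg) (of_movesInto hgY) x hx hpos hne fun β hβ hb => ?_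
    rw [Nat.testBit_or, Bool.or_eq_true, testBit_one_shiftLeft] at hb
    rcases hb with hb | hb
    · exact hZ β hβ hb
    · rw [← cell_code β, hb, cell_code, hxα]

theorem faceOk_of_stepOk {j E k : ℕ} (hj : rigid j = true) (hE : equationsOk j E k 0 = true)
    {auts faces : List ℕ} (hauts : ∀ g ∈ auts, Fixes j g) (hfaces : ∀ Y ∈ faces, FaceOk j Y)
    {s : Step} (h : stepOk E k (zeroCells j) (cellData (zeroCells j)) auts faces s = true) :
    FaceOk j s.1 := by
  obtain ⟨Z, _ | w, S⟩ := s
  · exact faceOk_leaf hj hE h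
  · change force (witnessMask (cellData (zeroCells j)) w) (fun m =>
      @Bool.rec (fun _ => Bool) (childrenOk (cellData (zeroCells j)) auts faces Z m
        (cellData (zeroCells j)) S) false (Nat.beq m 0)) = true at h
    rw [force_eq, boolRec_eq] at h
    split_ifs at h with h'
    exact faceOk_branch hauts hfaces (fun h0 => h' (by rw [h0]; rfl)) h

theorem faceOk_of_scriptOk {j E k : ℕ} (hj : rigid j = true) (hE : equationsOk j E k 0 = true)
    {auts faces : List ℕ} (hauts : ∀ g ∈ auts, Fixes j g) (hfaces : ∀ Y ∈ faces, FaceOk j Y)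
    {script : List Step}
    (h : scriptOk E k (zeroCells j) (cellData (zeroCells j)) auts script faces = true) :
    FaceOk j 0 := by
  induction script generalizing faces with
  | nil =>
    obtain ⟨Z, hZ, h0⟩ := exists_of_holdsAt (f := fun Z => Nat.beq Z 0) (l := 0) h
    obtain rfl := natBeq_eq_true.1 h0
    exact hfaces _ hZ
  | cons s script ih =>
    change @Bool.rec (fun _ => Bool) false (scriptOk E k (zeroCells j) (cellData (zeroCells j))
      auts script (s.1 :: faces)) (stepOk E k (zeroCells j) (cellData (zeroCells j)) auts faces s)
      = true at h
    rw [boolRec_eq] at h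
    split_ifs at h with h'
    refine ih (fun Y hY => ?_) h
    rcases List.mem_cons.1 hY with rfl | hY
    · exact faceOk_of_stepOk hj hE hauts hfaces h'
    · exact hfaces Y hY

theorem of_allBelow {n : ℕ} {f : ℕ → Bool} (h : allBelow n f = true) : ∀ c < n, f c = true := by
  induction n with
  | zero => simp
  | succ n ih =>
    change @Bool.rec (fun _ => Bool) false (allBelow n f) (f n) = true at h
    rw [boolRec_eq] at h
    split_ifs at h with h'
    intro c hc
    rcases Nat.lt_succ_iff_lt_or_eq.1 hc with hc | rfl
    · exact ih h c hc
    · exact h'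

theorem fixes_of_autsOk {j : ℕ} {auts : List ℕ} (h : autsOk j auts = true) :
    ∀ g ∈ auts, Fixes j g := by
  induction auts with
  | nil => simp
  | cons a auts ih =>
    change @Bool.rec (fun _ => Bool) false
      (@Bool.rec (fun _ => Bool) false (autsOk j auts) (isAut j a)) (Nat.ble a 31103) = true at h
    rw [boolRec_eq, boolRec_eq] at h
    split_ifs at h with h1 h2
    intro g hg
    rcases List.mem_cons.1 hg with rfl | hg
    · rw [isAut, withAct_eq] at h2
      exact ⟨Nat.lt_succ_of_le (Nat.le_of_ble_eq_true h1),
        fun c hc => natBeq_eq_true.1 (of_allBelow h2 c hc)⟩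
    · exact ih h g hg

theorem hasWitness_of_coneOk {j E k : ℕ} {auts : List ℕ} {script : List Step}
    (hj : rigid j = true) (h : coneOk j E k auts script = true) {x : MultiMatrix 4 3}
    (hx : x ∈ balanced) (hpos : ∀ α, IsZero j α → 0 ≤ x α) (hne : x ≠ 0) : HasWitness j x := by
  rw [coneOk, boolRec_eq, boolRec_eq] at h
  split_ifs at h with h1 h2
  exact faceOk_of_scriptOk hj h1 (fixes_of_autsOk h2) (by simp) h x hx hpos hne (by simp)

/-- If each nonzero element of the cone has a witness, then linear functionals which are maximal
over the known matrices at the listed matrix are maximal over the polytope there. -/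
theorem le_of_hasWitness {j : Fin 21}
    (h : ∀ x ∈ balanced, (∀ α, IsZero j α → 0 ≤ x α) → x ≠ 0 → HasWitness j x)
    {f : MultiMatrix 4 3 →ₗ[ℝ] ℝ} (hf : ∀ B ∈ known, f B ≤ f (MultiMatrix.listed j))
    {p : MultiMatrix 4 3} (hp : p ∈ MultiMatrix.birkhoffPolytope 4 3) :
    f p ≤ f (MultiMatrix.listed j) := by
  classical
  set s : Finset (Fin 4 → Fin 3) := Finset.univ.filter fun α => IsZero j α
  have hs {α : Fin 4 → Fin 3} : α ∈ s ↔ IsZero j α := by simp [s]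
  have key : ∀ (n : ℕ), ∀ x ∈ balanced, (∀ α, IsZero j α → 0 ≤ x α) →
      (s.filter fun α => 0 < x α).card = n → f x ≤ 0 := by
    intro n
    induction n using Nat.strong_induction_on with
    | _ n ih =>
      intro x hx hpos hn
      by_cases hx0 : x = 0
      · simp [hx0]
      obtain ⟨B, hB, ⟨α, hα, hBα⟩, hw⟩ := h x hx hpos hx0
      -- At the zeros `B - listed j` equals `B`, so it belongs to the cone; the ratio test is
      -- carried out on these cells only.
      have hr {β : Fin 4 → Fin 3} (hβ : IsZero j β) : (B - MultiMatrix.listed j) β = B β := by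
        simp [listed_eq_zero.2 hβ]
      have hBpos := (known_subset hB).1
      obtain ⟨t, ht, hsub, hlt⟩ := exists_subtract s x (B - MultiMatrix.listed j)
        (fun β hβ => by rw [hr (hs.1 hβ)]; exact hBpos β) (fun β hβ => hpos β (hs.1 hβ))
        ⟨α, hs.2 hα, by rw [hr hα]; exact lt_of_le_of_ne (hBpos α) hBα.symm⟩
        (fun β hβ hlt => by
          rw [hr (hs.1 hβ)] at hlt
          exact lt_of_le_of_ne (hpos β (hs.1 hβ)) (hw β (hs.1 hβ) hlt.ne').symm)
      have := ih _ (hn ▸ hlt) (x - t • (B - MultiMatrix.listed j))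
        (balanced.sub_mem hx (balanced.smul_mem t
          (sub_mem_balanced (known_subset hB) (listed_mem_birkhoffPolytope j))))
        (fun β hβ => hsub β (hs.2 hβ)) rfl
      rw [map_sub, map_smul, map_sub, smul_eq_mul] at this
      -- By induction `f x ≤ t * (f B - f (listed j))`, and the right side is at most zero by
      -- maximality over the known matrices.
      nlinarith [hf B hB]
  have := key _ _ (sub_mem_balanced hp (listed_mem_birkhoffPolytope j)) (fun α hα => ?_) rfl
  · rw [map_sub] at this
    linarith
  · have h0 := listed_eq_zero.2 hα
    simpa [h0] using hp.1 α

/-- Both the polytope and the set of known matrices are invariant under equivalences, so the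
functional can be transported to the representative. -/
theorem le_of_equivalent {i : Fin 21}
    (h : ∀ f : MultiMatrix 4 3 →ₗ[ℝ] ℝ, (∀ B ∈ known, f B ≤ f (MultiMatrix.listed i)) →
      ∀ p ∈ MultiMatrix.birkhoffPolytope 4 3, f p ≤ f (MultiMatrix.listed i))
    {C : MultiMatrix 4 3} (hC : MultiMatrix.Equivalent (MultiMatrix.listed i) C)
    {f : MultiMatrix 4 3 →ₗ[ℝ] ℝ} (hf : ∀ B ∈ known, f B ≤ f C)
    {p : MultiMatrix 4 3} (hp : p ∈ MultiMatrix.birkhoffPolytope 4 3) : f p ≤ f C := by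
  obtain ⟨γ, hγ, rfl⟩ := equivalent_iff.1 hC
  have := h (f ∘ₗ LinearMap.funLeft ℝ ℝ γ) (fun B hB => hf _ (comp_mem_known hB hγ))
    (p ∘ γ.symm) (comp_mem_birkhoffPolytope (symm_mem_moves hγ) hp)
  have e : LinearMap.funLeft ℝ ℝ γ (p ∘ γ.symm) = p := by
    funext α
    simp [LinearMap.funLeft_apply]
  rw [LinearMap.comp_apply, e] at this
  exact this

/-! ### Matrices equivalent to the first one -/

/-- Up to sign, there are eight linear forms in four variables over `ℤ/3` without zero
coefficients. This is the value of the form number `r` at the cell number `c`. -/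
def direction (r c : ℕ) : ℕ :=
  Nat.mod (Nat.add (Nat.add (Nat.div c 27)
      (Nat.mul (Nat.add 1 (Nat.mod (Nat.div r 4) 2)) (Nat.div c 9)))
    (Nat.add (Nat.mul (Nat.add 1 (Nat.mod (Nat.div r 2) 2)) (Nat.div c 3))
      (Nat.mul (Nat.add 1 (Nat.mod r 2)) c))) 3

theorem direction_lt (r c : ℕ) : direction r c < 3 := Nat.mod_lt _ (by norm_num)

/-- The number of forms with equal values at two cells. -/
def agreement (c d : ℕ) : ℕ :=
  @Nat.rec (fun _ => ℕ) 0
    (fun r ih => @Bool.rec (fun _ => ℕ) ih (Nat.succ ih)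
      (Nat.beq (direction r c) (direction r d))) 8

theorem agreement_eq (c d : ℕ) :
    agreement c d = ∑ r ∈ Finset.range 8, if direction r c = direction r d then 1 else 0 := by
  unfold agreement
  generalize 8 = n
  induction n with
  | zero => rfl
  | succ n ih =>
    rw [Finset.sum_range_succ, ← ih]
    change @Bool.rec (fun _ => ℕ) _ (Nat.succ _) (Nat.beq (direction n c) (direction n d)) = _
    rw [boolRec_eq]
    simp only [natBeq_eq_true]
    split_ifs <;> rfl

/-- The indicator matrix of a level of a form. -/
def levelMatrix (r b : ℕ) : MultiMatrix 4 3 := fun α => if direction r (code α) = b then 1 else 0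

/-- The permutations of `ℤ/3` are exactly the affine bijections. Therefore the matrices equivalent
to the indicator of `∑ i, α i = 0` are exactly the indicators of levels of forms without zero
coefficients. -/
theorem exists_perm_affine : ∀ u c : Fin 3, u ≠ 0 → ∃ τ : Equiv.Perm (Fin 3), ∀ a,
    τ a = u * a + c := by decide +kernel

theorem perm_affine : ∀ τ : Equiv.Perm (Fin 3), ∃ u c : Fin 3, u ≠ 0 ∧ ∀ a, τ a = u * a + c := by
  decide +kernel

theorem exists_form : ∀ (r : Fin 8) (b : Fin 3), ∃ (u : Fin 4 → Fin 3) (c : Fin 3),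
    (∀ i, u i ≠ 0) ∧ ∀ d : Fin 81, direction r d = b ↔ ∑ i, u i * cell d i + c = 0 := by
  intro r b
  refine ⟨![1, 1 + Fin.ofNat 3 (r / 4 % 2), 1 + Fin.ofNat 3 (r / 2 % 2), 1 + Fin.ofNat 3 (r % 2)],
    -b, ?_⟩
  revert r b
  decide +kernel

theorem exists_direction : ∀ (u : Fin 4 → Fin 3) (c : Fin 3), (∀ i, u i ≠ 0) →
    ∃ (r : Fin 8) (b : Fin 3), ∀ d : Fin 81, ∑ i, u i * cell d i + c = 0 ↔ direction r d = b := by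
  decide +kernel

theorem listed_zero_apply : ∀ d : Fin 81, numerator 0 d = if ∑ i, cell d i = 0 then 1 else 0 := by
  decide +kernel

theorem listed_zero (α : Fin 4 → Fin 3) :
    MultiMatrix.listed 0 α = if ∑ i, α i = 0 then 1 else 0 := by
  have := listed_zero_apply ⟨code α, code_lt α⟩
  simp only [cell_code] at this
  rw [listed_apply, show ((0 : Fin 21) : ℕ) = 0 from rfl, this]
  simp [MultiMatrix.listedDenominator]

theorem levelMatrix_mem_known (r : Fin 8) (b : Fin 3) : levelMatrix r b ∈ known := by
  obtain ⟨u, c, hu, h⟩ := exists_form r b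
  choose τ hτ using fun i => exists_perm_affine (u i) (if i = 0 then c else 0) (hu i)
  refine ⟨0, 1, τ, fun α => ?_⟩
  rw [listed_zero, levelMatrix]
  refine if_congr ?_ rfl rfl
  have := h ⟨code α, code_lt α⟩
  simp only [cell_code] at this
  rw [this]
  simp [hτ, Finset.sum_add_distrib]

theorem exists_levelMatrix {B : MultiMatrix 4 3}
    (h : MultiMatrix.Equivalent (MultiMatrix.listed 0) B) :
    ∃ (r : Fin 8) (b : Fin 3), B = levelMatrix r b := by
  obtain ⟨σ, τ, h⟩ := h
  choose u c hu hτ using fun i => perm_affine (τ i)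
  obtain ⟨r, b, hrb⟩ := exists_direction (fun i => u (σ⁻¹ i)) (∑ i, c i) fun i => hu _
  refine ⟨r, b, funext fun α => ?_⟩
  have := hrb ⟨code α, code_lt α⟩
  simp only [cell_code] at this
  rw [h, listed_zero, levelMatrix]
  refine if_congr ?_ rfl rfl
  rw [← this, ← Equiv.sum_comp σ fun i => u (σ⁻¹ i) * α i]
  simp [hτ, Finset.sum_add_distrib]

/-- The sum of the entries over a level of a form. -/
def levelSum (r b : ℕ) : MultiMatrix 4 3 →ₗ[ℝ] ℝ :=
  ∑ α, levelMatrix r b α • LinearMap.proj α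

theorem levelSum_apply (r b : ℕ) (x : MultiMatrix 4 3) :
    levelSum r b x = ∑ α, levelMatrix r b α * x α := by
  simp [levelSum]

/-- The Fourier projection onto balanced arrays is the average, with factor `1/81`, of the 16
characters nontrivial in every coordinate. Each form accounts for two of them, and its agreement
indicator is a third of one plus their values at `c - d`. So, up to a constant that balanced arrays
annihilate, the agreement is 27 times the projection kernel. -/
theorem agreement_check : allBelow 81 (fun c =>
    allZero (coords 4 fun d =>
      pairSub (agreement c d, 0) (pairComb 27 0 (indicator c d) (0, 0)))) = true := by
  decide +kernel

theorem levelMatrix_cell {r b c : ℕ} (h : c < 81) :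
    levelMatrix r b (cell c) = if direction r c = b then 1 else 0 := by
  rw [levelMatrix, code_cell h]

/-- Balanced arrays are determined by their sums over levels. -/
theorem sum_levelSum {x : MultiMatrix 4 3} (hx : x ∈ balanced) (α : Fin 4 → Fin 3) :
    ∑ r : Fin 8, levelSum r (direction r (code α)) x = 27 * x α := by
  have h := of_allBelow agreement_check (code α) (code_lt α)
  have h' := sum_mul_eq_dot 4 (fun d => pairSub (agreement (code α) d, 0)
    (pairComb 27 0 (indicator (code α) d) (0, 0))) _ (flatBalanced_of_balanced hx)
  rw [dot_of_allZero h] at h'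
  simp only [val_pairSub, val_pairComb, val_indicator, sub_mul, Finset.sum_sub_distrib] at h'
  have e1 : ∑ d ∈ Finset.range (3 ^ 4), ((27 : ℕ) * (if code α = d then 1 else 0) +
      (0 : ℕ) * val (0, 0)) * x (cell d) = 27 * x α := by
    rw [Finset.sum_eq_single (code α)]
    · simp [cell_code]
    · intro d _ hd
      simp [hd.symm]
    · intro hd
      exact absurd (Finset.mem_range.2 (code_lt α)) hd
  rw [e1, sub_eq_zero] at h'
  rw [← h']
  simp only [levelSum_apply, sum_cell]
  rw [Finset.sum_comm]
  refine Finset.sum_congr rfl fun c hc => ?_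
  rw [← Finset.sum_mul]
  refine congrArg (· * x (cell c)) ?_
  rw [val, agreement_eq, Finset.sum_range]
  push_cast
  rw [sub_zero]
  refine Finset.sum_congr rfl fun r _ => ?_
  rw [levelMatrix_cell (Finset.mem_range.1 hc)]
  exact if_congr eq_comm rfl rfl

/-- Distinct forms are linearly independent, so any two levels of theirs meet in a ninth of the 81
cells. -/
theorem card_levels : ∀ r r' : Fin 8, r ≠ r' → ∀ b b' : Fin 3,
    ∑ c ∈ Finset.range 81,
      (if direction r c = b then 1 else 0) * (if direction r' c = b' then 1 else 0) = 9 := by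
  decide +kernel

theorem levelSum_levelMatrix {r r' : Fin 8} (h : r ≠ r') (b b' : Fin 3) :
    levelSum r b (levelMatrix r' b') = 9 := by
  have := card_levels r r' h b b'
  rw [levelSum_apply, sum_cell]
  rw [← Nat.cast_inj (R := ℝ)] at this
  push_cast at this
  rw [← this]
  exact Finset.sum_congr rfl fun c hc => by
    rw [levelMatrix_cell (Finset.mem_range.1 hc), levelMatrix_cell (Finset.mem_range.1 hc)]

theorem levelMatrix_nonneg (r b : ℕ) (α) : 0 ≤ levelMatrix r b α := by
  unfold levelMatrix
  split_ifs <;> norm_num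

theorem levelSum_nonneg (r b : ℕ) {x : MultiMatrix 4 3} (hx : ∀ α, 0 ≤ x α) :
    0 ≤ levelSum r b x := by
  rw [levelSum_apply]
  exact Finset.sum_nonneg fun α _ => mul_nonneg (levelMatrix_nonneg r b α) (hx α)

/-- The seven other forms contribute `9` each, and the form `r` itself a nonnegative amount. -/
theorem le_sum_levelSum_levelMatrix (β : Fin 8 → Fin 3) (r : Fin 8) (b : Fin 3) :
    63 ≤ ∑ s : Fin 8, levelSum s (β s) (levelMatrix r b) := by
  rw [← Finset.add_sum_erase _ _ (Finset.mem_univ r),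
    Finset.sum_congr rfl fun s hs => levelSum_levelMatrix (Finset.ne_of_mem_erase hs) (β s) b]
  have := levelSum_nonneg r (β r) (levelMatrix_nonneg r b)
  simp
  linarith

theorem sum_levelMatrix (r : ℕ) (α : Fin 4 → Fin 3) :
    ∑ b : Fin 3, levelMatrix r b α = 1 := by
  rw [Finset.sum_eq_single (⟨direction r (code α), direction_lt _ _⟩ : Fin 3)]
  · simp [levelMatrix]
  · intro b _ hb
    refine if_neg fun h => hb (Fin.ext h.symm)
  · simp

/-! ### Matrices with small sums over given levels -/

/-- Some group elements, together with the sums over levels, six bits each, of the images of the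
second listed matrix. -/
def covering : List (ℕ × ℕ) :=
  [(2603, 0x60f3cc5553155583cf78c3183cf60f3de30c), (2664, 0x3155583cf60f3cc5553d83cc78c31e30f60f),
    (2702, 0x3155583cf60f3cc5553cf60c31e30c78f3d8), (3267, 0x60f3cc31e31e3183cf31554f3d83d83cc555),
    (3057, 0x60f3cc78c30c7983cf31554f60f3cf60c555), (3261, 0x3d83de30c78c30f3d854c5583cf60f3d554c),
    (782, 0x31554f3d83cf60c78c3d83cc55578c30f3d8), (1315, 0x54c54f60f3d83cc78c60f3de30c3155583cf),
    (534, 0x31554f60f3d83cc31e3cf60c55578c30f60f), (745, 0x60f3cc31e54c5583cf31e3183cf3cf615315),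
    (2050, 0x60f3cc78c5553183cf5553183cf3d83cc31e), (517, 0x3cf61e30c31554f60f78c30f60f3d83d554c),
    (555, 0x3d83cc31e31554f60f30c7983cf3d83d554c), (753, 0x3cf61531578c30f3d854c5583cf3cf60c78c),
    (448, 0x60f3cc78c31554f60f31e30f3d83d83d554c), (3357, 0x31e3183cf3d83de30c60f3d554c31554f3d8),
    (115, 0x3d83d531578c3183cf54c54f60f60f3de30c)]

/-- For all choices of levels, some entry of the list has a small sum: the entries consist of a
partial sum and of the sums over the levels of the remaining `k` forms. -/
def coverOk (k : ℕ) : List (ℕ × ℕ) → Bool :=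
  @Nat.rec (fun _ => List (ℕ × ℕ) → Bool)
    (fun L => L.any fun p => Nat.ble p.1 126)
    (fun _ ih L => allBelow 3 fun b => ih (L.map fun p =>
      (Nat.add p.1 (Nat.mod (Nat.shiftRight p.2 (Nat.mul 6 b)) 64), Nat.shiftRight p.2 18))) k

theorem exists_of_coverOk {k : ℕ} {L : List (ℕ × ℕ)} (h : coverOk k L = true) (β : ℕ → ℕ)
    (hβ : ∀ r, β r < 3) :
    ∃ p ∈ L, p.1 + ∑ r ∈ Finset.range k, (p.2 >>> (18 * r + 6 * β r)) % 64 ≤ 126 := by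
  induction k generalizing L β with
  | zero =>
    obtain ⟨p, hp, h⟩ := List.any_eq_true.1 h
    exact ⟨p, hp, by simpa using Nat.le_of_ble_eq_true h⟩
  | succ k ih =>
    obtain ⟨q, hq, h'⟩ := ih (of_allBelow (n := 3) (f := fun b => coverOk k (L.map fun p : ℕ × ℕ =>
      (Nat.add p.1 (Nat.mod (Nat.shiftRight p.2 (Nat.mul 6 b)) 64), Nat.shiftRight p.2 18)))
      h (β 0) (hβ 0)) (fun r => β (r + 1)) fun r => hβ _
    obtain ⟨p, hp, rfl⟩ := List.mem_map.1 hq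
    refine ⟨p, hp, le_of_eq_of_le ?_ h'⟩
    rw [Finset.sum_range_succ']
    change _ = p.1 + (p.2 >>> (6 * β 0)) % 64 +
      ∑ r ∈ Finset.range k, ((p.2 >>> 18) >>> (18 * r + 6 * β (r + 1))) % 64
    rw [add_comm (∑ r ∈ Finset.range k, _), ← add_assoc]
    simp only [← Nat.shiftRight_add, mul_zero, zero_add]
    congr 1
    refine Finset.sum_congr rfl fun r _ => ?_
    congr 2
    ring

/-- The bound `126` is twice `63`, because the tables hold numerators over the denominator `2`. All
`3 ^ 8` choices of levels are examined. -/
theorem coverOk_tables : coverOk 8 (covering.map fun p => (0, p.2)) = true := by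
  decide +kernel

theorem covering_spec : ∀ p ∈ covering, p.1 < 31104 ∧ ∀ (r : Fin 8) (b : Fin 3),
    ∑ c ∈ Finset.range 81, (if direction r c = b then 1 else 0) * numerator 1 (act p.1 (spread c)) =
      (p.2 >>> (18 * (r : ℕ) + 6 * (b : ℕ))) % 64 := by
  decide +kernel

/-- The bound `63` matches `le_sum_levelSum_levelMatrix`: for every choice of levels, some matrix of
the second class has a deficit at least as large as any matrix of the first. -/
theorem exists_small_sum (β : Fin 8 → Fin 3) :
    ∃ B, MultiMatrix.Equivalent (MultiMatrix.listed 1) B ∧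
      ∑ r : Fin 8, levelSum r (β r) B ≤ 63 := by
  obtain ⟨q, hq, h⟩ := exists_of_coverOk coverOk_tables
    -- The value `0` beyond the eight forms only makes the function total with values below `3`.
    (fun r => if hr : r < 8 then β ⟨r, hr⟩ else 0) fun r => by
      split
      · exact (β _).isLt
      · norm_num
  obtain ⟨p, hp, rfl⟩ := List.mem_map.1 hq
  obtain ⟨hg, hsum⟩ := covering_spec p hp
  obtain ⟨γ, hγ, hγg⟩ := exists_move p.1 hg
  refine ⟨MultiMatrix.listed 1 ∘ γ, equivalent_iff.2 ⟨γ, hγ, rfl⟩, ?_⟩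
  have key (r : Fin 8) (b : Fin 3) : levelSum r b (MultiMatrix.listed 1 ∘ γ) =
      ((p.2 >>> (18 * (r : ℕ) + 6 * (b : ℕ))) % 64 : ℕ) / 2 := by
    rw [← hsum r b, levelSum_apply, sum_cell]
    push_cast
    rw [Finset.sum_div]
    refine Finset.sum_congr rfl fun c hc => ?_
    have hc := Finset.mem_range.1 hc
    rw [levelMatrix_cell hc, Function.comp_apply, listed_apply, ← hγg, code_cell hc,
      show (MultiMatrix.listedDenominator 1) = 2 from rfl, mul_div_assoc]
    rfl
  simp only [key]
  rw [← Finset.sum_div, ← Nat.cast_sum]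
  rw [Finset.sum_range] at h
  simp only [Fin.is_lt, dite_true, zero_add] at h
  have : ((∑ r : Fin 8, (p.2 >>> (18 * (r : ℕ) + 6 * (β r : ℕ))) % 64 : ℕ) : ℝ) ≤ 126 := by
    exact_mod_cast h
  linarith

/-! ### Evaluation of the checks -/

-- There are 32 zeros and balanced arrays have 16 coordinates, whence 16 equations; in every case
-- the number of equations is the number of zeros minus 16. The steps with a nonzero second
-- component are branches, and the last one, with mask `0`, treats the whole cone.
set_option maxHeartbeats 4000000 in
theorem coneOk_1 : coneOk 1 0x888888988888888888888888887888888988888888888888888887888888888888888788888888898888888888888888888888888887888888888888888888888888887888888889888888889888888888888888788888888888888888889888888788888888888888888889888888898888888887888888888889888888888988888888887887878888988888888888888898887888888888898888788888888888888888888888988878898887887878889888888888888888888887988888888888888889888888888888888888888988878898888887878888888888887888888888887988888888888888889888889888888888888888988878898887887878888888888887888888998887988888888888888889888888888888888888888988878898887887878888888888887888889888888988888888888888889888888888888888888888788898878888888898888888888889888888888888788888888888888887889888888888878988888888888898888887888888888988887888888888888888888888878888889888888888888888888889788888888888888898888788888888888888878889888888888878888988888888888888888888888888898888888888888888888888888898888888888888888888888888787888888888888888888888888888998887887888888888888888888888888888888888888888888888888888888888888788888888888888888888888888788888888888888888888988988888888888888888888888888888788888888888888888888888888788888888888888888888888888888888888988888888988888888888888888888888888888888888888888888888888888888888888888898898787888888888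 16
    [0, 222, 259, 6480, 6702, 9072, 9109, 9294, 11664, 11886, 11923, 18144, 18181, 18366, 18403,
    20773, 20995]
    [
    (4521198255867904, 0, 0x134305c01160c40dcc40098202d850e101009430006014e8102d871ee052be4202d430d8850ddc51548100520025030e641),
    (4521202550835204, 0, 0x536608f4c1a2a11548141da5005201a3444a025053650628102503051a2244a50008045827196610e641),
    (4521202550835208, 0, 0x5d01224497d5af2cb8222e4916a4901343192e907de3a7ea205c0103fc20820316d09160c40dcc400982027e5027c32cf2d6924f02d85ba70e023a32f86a002a3000400aca10e101009430c784292625464206f23000607d7c5a5642b918714e812c0aa7f49302d871ee051f9a54b5ae12004044012be42075034334e19f0202d4300caa7b5537e5ab0d8850ddc5057877dc271c70f81bef053661a2a115481005201a3444a025053650628102503051a2244a5458270e641),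
    (4521202551097344, 0, 0x5d01224497d5af2cb8222e4916a4901343192e907de3a7ea205c0103fc20820316d09017e3060a10f7e4161a4160c40dcc400982027e5027c32cf2d6924f02d85ba70e023a351e222f86a002a32c0aabd3f07f49302d871ee051f9a54b5ae12004044012be42075034334e4c16519f020292302d4300caa3fd0b0536608f4c1a2a11548141da5005201a3444a025053650628102503051a2244a50008045827196610e641),
    (4521202559223808, 0, 0x5d01224492cb8216a4901343192e907de3a7ea2060a10f7e4160c400982027e5027c36924f009430c7842926206f2300caa698c27b55319f4203f290d885057870544b81bef3fd0b0536608f4c1a2a11548141da5005201a3444a025053650628102503051a2244a50008045827196610e641),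
    (4521202685052928, 0, 0x134305c01160c40dcc40098202d850e101009430006014e8102d871ee052be4202d430d8850ddc51548100520025030e641),
    (4661940039190528, 0, 0x5d012244916a490134307de3060a1161a40dcc400982027c32f86a00040037a40aca10e1010094329262b91870a56114e81cc5532c0aabd3f07f49302d871ee051f9a54b5ae12004044012be42075034334e4c16519f020292302d436af427b55319f4236d890ddc5057870544b81bef0536608f4c1a2a11548141da5005201a3444a025053650628102503051a2244a50008045827196610e641),
    (4802677527545856, 0, 0x5d01224497d5af2cb8201343192e907de305c0103fc208203017e3060a10f7e4161a4160c40dcc400982027e5027c302d85ba70e2f86a0aca10e101407c5009430c78429262000607d7c5b91870a56114e817f49302d871ee051f9a54b5ae2be420750319f020292302d4300caa7b5537e5ab1882219f4203f2936d890d8850ddc5057877dc2714a330544b1a2a11548141da5005201a3444a02502503051a245827196610e641),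
    (4521202550835200, 3556, 0x1000700020003000400050006),
    (4521743716714496, 0, 0x536122e4916a49013432e6a2a7ea205c01223a916d09160c40dcc4009822cf2d6924f02d85023a351e22bd733002a300040037a40e10100943073835464206f2300060a564200de314e81cc5532c0aabd3f002d871ee05030a312004044012be424334e4c16502d43068aa057adcfe2f1d7c46af42698c20d8850ddc51c70f81bef3fd0b0536608f4c154810052005e21053650628102503244a5000800e641),
    (148636382036756480, 0, 0x16de9a7a02013431f0692e6a205c0154fc2223a9017e3060a10f7e4161a4160c40dcc40098202d8551e22005a0037a40e101407c50094318324073830006000de30a56114e81cc553bd3f002d871ee0543c6a030a32be424c1650292302d436af42698c21882219f4203f2936d890d8850ddc53fd0b08f4c1548141da5005200b1e405e210250300080196610e641),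
    (2310645678151305216, 0, 0x16de922449a7a022cb820134307de305c0108203017e3060a10f7e4161a4160c40dcc400982027c3005a02f86ae1f730094329262b91870a56114e811ee054b5ae19f020292302d4300caa1a541e64cf458110d6c513825cdeaf5374d51f540d584873ee005204a02545827196610e641),
    (2310364203174594560, 21346, 0xc000c0b000100000003000b),
    (302231459424851254577152, 0, 0x1343192e91f06907de32e6a2a7ea205c0103fc254fc208203223a916d09017e3060a10f7e4161a4160c40dcc402d85ba70e023a351e22005a02f86abd733002a31a844000607d7c5a564200de3b91870a56114e812be42075034334e4c16519f020292302d4300caa7f16ee1674b988f10481458110d6c513825068aa2b109057adcfe2f3d7940156e1d7c468b4fa58cd2d04a5a3ef528530fe0102503051a2244a50008045827196610e641),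
    (4521193960900608, 1377, 0x1000300040005000d),
    (4521200403351556, 0, 0x5000a661422e50b1e10536405366b962708f4c1a2a11548141da5005201a344a72024a025053657f7450628102503051a229622244a50ccc40008056162029a34582719661078630e641),
    (4521200403351616, 0, 0x17e3060a10f7e4161a451e227b76517b2100de3004c00a5617b7674c165a2de2029230f8e50f3a50a66100080029a319661),
    (4521200403621888, 0, 0x5d012244916a4901343192e91f5c907de31824fa7ea203fc216d0955382060a1161a40dcc42f86a002a31f9a512004044012be42075035572d4334e495e54c165ce5af1a344053650628102503051a229622244a50ccc40008007863),
    (4521200411748352, 0, 0x5d012244916a4901343192e91f5c907de31824fa7ea255382060a1009430c78422525292620376206f23183c4037a5004c0046c17b55319f42057870544b81bef79ed303d47188c203a0b8326f1a344053650628102503051a229622244a50ccc40008007863),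
    (148636388479215616, 0, 0x1343060a1161a40dcc417b21402850738c037a40e101407c5009430006000de3004c00a56114e81ba2abcc5532be424c165698226af4219f4236d890ddc5188c20f3a5043890250300080),
    (18889470452678984214528, 0, 0x192e9a7ea203fc216d09002a30c7845464206f23000607d7c549b85a5642183c400de3046c11a344053650628102503051a229622244a50ccc40008007863),
    (4521200403359744, 277768, 0x100c080a00000c0c00010410000c0c040002000300040005),
    (148636388479731712, 0, 0x17b21402850738c037a40e101407c5009430006000de3004c00a56114e81698226aea26af42698c21882219f4203f2936d890d8850ddc5188c219ea20f8e50f3a536929043890a661422e50536408f4c1548141da5005200250300080029a3196610e641),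
    (295152426379756701696, 0, 0x17b214028543d070e101407c5009430c78422525546420376206f230006049b85183c400de3004c0046c1698226aea26af42698c27b5537e5ab1882219f4203f2936d890d8850ddc5188c203a0b19ea2160b30f8e50f3a536929043890a661422e5b96271548141da5005201a344a7202053657f7450628102503296220ccc400080029a307863),
    (4521200403875840, 284712, 0xf0f00000c020e0f0001030f010f0c070002040800070108),
    (148636388479207424, 0, 0x134305c01017e3060a10f7e4161a4160c40dcc40098202d8551e227b76517b21402850738c037a40e101407c5009430006000de3004c00a56114e81ba2abcc5537b7673fcd0bd3f002d871ee052be424c165a2de20292302d43698226aea26af42698c21882219f4203f2936d890d8850ddc5188c219ea20f8e50f3a53692904389670b33fd0b0a661422e50536408f4c1548141da5005200250300080029a3196610e641),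
    (75557868247114726770688, 0, 0x224492cb8201343192e907de3a7ea205c0103fc20820316d091ef89017e355382060a10f7e4161a4160c40dcc42f86a40285407c5009430c7842926206f23000607d7c5a5642183c400de3037a5004c0b91870a561046c114e8100caa698226aea26af42698c21882219f4203f2936d890d8850ddc514a330544b79ed37fc2b188c219ea20f8e50f3a53692904389422e541da5005201a3444a0250628102503051a2244a50ccc40008056162029a34582719661078630e641),
    (4521200403351552, 27017, 0x1012000010050c050c120001041200120c0a040500020005040b000a000b),
    (148636929645086720, 0, 0x13432e6a205c01223a9160c40dcc40098202d8551e2217b2140285037a40e10100943073830006000de30aca414e81cc5537b767bd3f002d871ee05030a32be424c1651c08a02d436af42698c20d8850ddc5188c219ea236929043893fd0b0a661422e508f4c154810052005e2102503000801a2a40e641),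
    (4616207759996618752, 0, 0x2cf2d02d850c5e451e22002a317b2143d070e101546420006049b8500de37b7670698802d87120042be425572d4c1650a661b96271548105365025032962200080),
    (590300332100274882560, 0, 0x536122e4916a49009822cf2da430d6924f51e2217b210004043d07037a40e1010094307383546420376206f2300de3cc5537b7672c0aa06988bd3f002d871ee05030a3120041b164044014c1656af42698c21c70f81bef3fd0b0a66105366b962708f4c154810052005e21053657f7450628100080),
    (4521741569230848, 193, 0x10002041e00030015),
    (148636379889272836, 0, 0xa661422e50536408f4c1548141da5005200b1e405e2102503000801a2a4029a307cc3196610e641),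
    (148636379889272840, 0, 0x134305c01160c40dcc40098202d850e101009430006014e8102d871ee052be4202d430d8850ddc51548100520025030e641),
    (148636379889281024, 0, 0x13431f0692e6a2060a1161a40dcc417b21402850738c037a40e101407c50094318324073830006000de30aca4004c0042610a56114e81ba2abcc5532be424c165698226af4219f4236d890ddc5188c20f3a5043890250300080),
    (148636379889797120, 0, 0x17b21402850738c037a40e101407c50094318324073830006000de30aca4004c0042610a56114e81698226aea26af42698c21882219f4203f2936d890d8850ddc5188c219ea20f8e50f3a536929043890a661422e50536408f4c1548141da5005200b1e405e2102503000801a2a4029a307cc3196610e641),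
    (148636379889272832, 1441, 0x10010c0706090c0110070c020007000a0407040100000001040300020003),
    (4521191813416960, 14242, 0xc050c160000000500090016),
    (4521191813488640, 0, 0x37a1000c00536100560037a617b2140285183210738c0004043d07037a40aca10e101407c5009430c78418324225252926207383546420376206f23000607d7c549b85a5642183c400de30aca4037a5004c0b9187042610a561046c114e81),
    (4521191821811712, 0, 0x37a1000c0053610056005d012244916a4901343192e91f5c907de31824fa7ea255382060a100ea17ceaf009430c78422525292620376206f23183c4037a5004c0046c1234e956ea218249a64627b55319f4202d83057870544b198cf074c381bef20c4979ed303d47042c1188c203a0b046618326f153c97ee2f1a344053650628102503051a229622244a50ccc40008007863),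
    (4521333614452736, 0, 0x37a1000c048e65037a617b21183210738c43d070e1010006049b850aca40426114e810ef24003af0134b2be425572d14e6951c6dcdf4f00c03009428936e53a740d1c40250329622),
    (4521337909420032, 0, 0x2a3037a617b21183210738c0004043d07037a40aca10e10154642000607d7c549b85a564200de3b91870a56114e81040b000e243d545003af2caaf0134b44ae50d811a1554120042be42075035572d4334e4c1657a0e5025a31590400c03a28cd00942c6d4eb59547f8d01daaa0536502503051a229622244a500080),
    (148636517395341312, 0, 0x1f0692e6a22b7b315ca41acaa17b210738c037a40e10118324073830006000de30aca4042610a56114e810ef2400e240134b07333037c8567ad2be424c16514e697a0e50094205ea2a4c8d19a2f0250300080),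
    (2310364338533179392, 0, 0xc0053612e6a20f561bd7332b7b317b211832100040037a407383a564200de30aca4b91870a56114e8100e243d5454334e4c165b988f10481057adcfe2f7a0e515904244a500080),
    (295152426508672311296, 0, 0x37a1000c00536100560197611f0692e6a248e6500006002a31acaa17b2143d070e1011832407383546420006049b8500de30aca4042610ef2407333567ad120042be425572d4c165068aacfe2f68b4f2d04a14e6951c6dcdf4f2dfad05ea26aa2f3fbb38936e2f0aa4488f53a741a6810d1c40484a19a2f05365025032962200080),
    (18889470452807900340224, 0, 0x37a1000c0053610056000006002a354642000607d7c549b85a564200de3040b0068aa2b109057adcfe2f68b4fa58cd2d04a025a351c6dcdf4f2dfad6aa2f2f0aa0484a7f8d00536502503051a229622244a500080),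
    (4521329319485440, 497672, 0x3010000030200010c07000200030305000400050107010800070008),
    (18889470452807833231360, 0, 0x37a1000c00536100560192e9a7ea200006002a3434aa0c7845464206f23000607d7c549b85a5642183c400de3046c1040b0068aa2b109057adcfe2f68b4fa58cd2d04a234e9025a351c6dcdf4f56ea22dfad6aa2f2f0aa0484a7f8d07ee2f0536502503051a229622244a500080),
    (4521329252376576, 3746, 0xc090001010a0009000a),
    (18889470452670394277888, 0, 0x37a1000c00536100560192e9a7ea203fc216d0900006002a317b4f434aa0c7845464206f23000607d7c549b85a5642183c400de3046c1040b0068aa2b109057adcfe2f68b4fa58cd2d04a234e92c7c2025a351c6dcdf4f20f0956ea22dfad6aa2f2f0aa0484a7f8d018c4a7ee2f1a344053650628102503051a229622244a50ccc40008007863),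
    (4521191813423104, 1153, 0x1000a010c000b000c),
    (75853016152285489659904, 2562, 0xd000b000100010d0000000d),
    (295152426371166240768, 8069, 0xa0100000e010c010601060e0901050e05010101010e0001000e),
    (4521191813414912, 83171, 0x1000e0200000c020102010f0002000f),
    (4503599627370496, 1345, 0x7000000), (0, 225, 0x2000000)] = true := by
  decide +kernel

set_option maxHeartbeats 4000000 in
theorem coneOk_2 : coneOk 2 0x888888898878888888988898888888878888888888888888788889898988887788888888888888878888888878888888888788888888888888888888888898888988887888788889988888888888888888888887878898888888788888888888898888888889888888888887878888889988878888888888898888889788878888888988888888888878888889888888888888888898888888788898888888888878888888778888888889888888888888888888888888888888888887888888888888888888889889888889889778888888888888888888888888888888888888888888888888888888888888888888888888888889898888888887888888888988878888888888888888888889888888888788898888888887878888888778888888889888888888888888888888888888888888887888888888888888888888888998888888778888888889888888889888888888888888888888888888888888888888888888888888888888888778888888889888888888888888888888888888888888887888888889888888889888888888888888778888888888888888888888888889888888888888888888888888889888888888888888888888887888888988888888888888888898888888888888888788888888888888888878888888889888888888788888888888988888888888888888888888988888788888888988888788888888888888888888888898878888888888888888888878888888888888898888888888888888888898888888888878 1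4
    [0, 21, 28, 43, 50, 223, 252, 1296, 1548, 1569, 7790, 7811, 7840, 8013, 8035, 8042, 9086, 9129,
    9331, 9338]
    [
    (141776003072, 0, 0x22c305f820012001fa305a62004c001bc3302aab64cec5e4eb22f43e9f301bd318a641d8ea3efb3799c74e1a5199418924e0094179f25a35ed155890466100ea1799c5a554d041011506915704005e00f7410034303a01),
    (35188709138432, 0, 0x22c305f82004c0a844d040020fee12b02979cae807c5071a3005c0146ca008a3046662a50a2023145eca2b3cf017a31558fb64ce01bd379f2504661a554d1506915704005e00f7410034303a01),
    (9223372041191825408, 0, 0x22c30012005a6282685000a02b3c91028179caea6d0d1666a043e207b03008a317e0101243045e8413530130428eaa0d484b64ce01bd3a35ed15589799c50410115704005e00f7410034303a01),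
    (1180591620721748353024, 0, 0x22c305f820012001fa305a62004c001bc3302aa0002382685a844d000a0040020ab612b3c90fee1102812b02979caec59eec3e0e876ae7b4b01beaa005c0043e2146ca07b03008a34562517d81b80e73ea5317e0104666012432a50a3d37331ceab6590086acb64ce01bd318a641d8ea799c74e1a5199418924e155890466100ea1799c5a554d0410115069005e00f7410034303a01),
    (9444732965743627476992, 0, 0x22c305f820012001fa305a62004c001bc3302aa82685a844d0ab612b3c90fee1102812b02979caea6d0d807c50b081c3e0e876ae7b4b0288221666a071a379ef01d50a146ca07b03008a3b860743bc5eceb4eee1445625b80e7198613ea5317e01046664fd45b035400567005b220231045e845eca413530be312b3cf01304005b10000b79f271558f0d484086acb64ce01bd318a640094179f25a35ed155890466100ea1799c5a554d041011506915704005e00f74103a01),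
    (4337049600, 1348, 0x800000000010002000308040004),
    (21483364352, 0, 0x22c30068305f820012001fa305a62004c001bc3b754e1e2ea302aa1a12100023000a00400288deec59ee1beaa00543005c0043e230b2a3d03317d8101f337b0ee3d37331ceac5e4e3e9f31d8ea3efb3199418924e00343),
    (1180591620721714798594, 0, 0x22c305f820012001fa3144e4a74ed7b1e505a62004c001bc3b754e302aa000230ab612b3c90fee1c3e0e3ea5301f3318a641d8eaabff4799c71994100ea1799c5a554d0f741),
    (1180591620721715060736, 0, 0x12001fa31780aa448d144e4a74ed047281e50405a6201bc30002382685000a00ab612b3c91028108c042a04ac3e0e876ae043e207b03008a33ea5317e010124310e841558900ea1799c504101),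
    (1180609635120224280576, 0, 0x5f8201fa3074c381305144e47b1e526e51a7a62004c001bc300023a844d040020ab610fee12b02952a4f01ac3c3e0e876ae005c0146ca008a33ea53046662a50a6888f0466100ea1a554d15069),
    (1180879851097866510336, 0, 0x22c365d820068305f820012001fa3074c31780aa448d81305144e4a74ed7b1e526e51047281e504a7a6205a62004c001bc3b98c7b754e1d06a7b1b07b1e7008d27b1b1302aa1a6010002382685a844d000a0040020ab612b3c90fee1102812b02979caec59ee08c0452a4f2a04a01ac3c3e0e876ae7b4b01beaa005c0043e2146ca07b03008a3b98903d431b93ef130052f8aadedb44562517d81b80e73ea5301f337b0eee8b14),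
    (20070057552200295653376, 0, 0x68300023000a0040022a04a01ac3005c0043e2008a3b98902f8aa012432a50a31ceab65905194200343),
    (1180591620721714798592, 1505, 0x80000000a060801000100020005000308040004),
    (4303495168, 1345, 0x60007),
    (292066304000, 0, 0x22c30068300023000a004002009610608116c29a54ad7b4e516fc905ce188deec59eeb68aea350d7ba0500e811beaa00543005c0043e223189017c6ccd6f30b2a3d033b22147b4e74f82517d81005533d3731a4a431cea17144055410dc01004e000343),
    (35201560485888, 0, 0x22c30068305f82a56622abc914c0928aca004c001f2302e23a2e020400216c29a54ad05ce1b68ae7ba05005c000553822e5205f116fcf2998f4484a077631610a05ce6798ce294690e861a83ad17144055410dc01004e000343),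
    (9223372054043172864, 0, 0x22c300683001201d7041014103fc1031c305a6201f232aa6a1b8a4000a0060817b4e516fc9b68aea350d043e200553a6ded05c680b50403284429d314aaa06c4319841798ce0e3012998980ba517144055410dc01004e000343),
    (9739880870935831650304, 0, 0x22c305f820012001fa328aca031c305a62004c001f23b80b0302aa),
    (295147905196541222912, 500018, 0x80000000f0e00010a02000208030003000b060e0a0113030a03),
    (9444732965756478824448, 0, 0x22c305f820012001fa328aca031c305a62004c001bc301f23b80b0302aa144222aa6a02e23b6af03190a),
    (17188397056, 132518, 0x80000000f0700010003000408050005000d060e),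
    (295148468266787282944, 0, 0x22c305f820012001fa328aca031c305a62004c001f23b80b0302aab64cec5e4e3e9f301bd37eb2e2c82201fb3798ce0756a05fd30dba179f25a35ed15589046610e301294690e86129989000801570448f453ed470dc01004e00034303a01),
    (295148472527394840576, 0, 0x22c328aca031c305a62004c001f23b80b0302aa82685a844d000a0040020608116c29a54ad7b4e5060081eb91176a40cf6416c2f79cae88deea6d0d807c5b68ae0546100033eee1401fd101fd27b4e74f82517d81b80e73e9f301bd31570448f453ed470dc01004e00034303a01),
    (295148503313720418304, 0, 0x22c305f8228aca004c001f23a844d0400216c29a54ad06008176a40cf6479cae807c5b68ae05461071a3005c0146ca008a3000333d327202315f71448ba55298d2cbc20910a017a31558f00553b64ce01bd37eb2e01fb3798ce05fd30dba179f2504661294690e861000801570448f453ed470dc01004e00034303a01),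
    (295148468129348329472, 165923, 0x50105020d12050003140b120000000100020614),
    (562949995503616, 85314, 0x70000000315051306130013),
    (1180592183667373252610, 0, 0x22c305f820012001fa328aca031c305a62004c001bc301f23b80b0302aa144222aa6a02e23b6af03190a),
    (1180592183667373252672, 0, 0x1fa3a448d813052abc9101410b36128aca031c305a62004c001bc301f2352f6f07484b80b0302aa144228ffef82685a844d000a004002a54ad7b4e5060081eb91176a4c42ae876aeb02b401fd27b4e717d81b80e71b94a3ce133ed1112a457b0eee8b1445b453e9a5751b466d8d0a7b1032842998f0776314aaa7b9d0187c2ba16e0756a05fd315589046610e86129989000803ed470dc010034303a01),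
    (1180592183667373253120, 0, 0x22c365d820068305f8201fa3074c3813052abc9a7a6228aca004c001bc307484b80b0302aa1442202e23a2e02a844d04002a54ad060082b029c59ee02d647ba057b4b01beaa005c0146cab22140c1d14562501fd27b4e717d81b80e700a633ed1112a457b0eee8b143d373bb72e822e5205f173b1407a8a66d8d2998f07763187c28924e05fd3046610e86115069171443ed45005e03ed470dc010034303a01),
    (1180592183667507470336, 0, 0x22c365d82006830012001fa31780aa448d101411e504031c305a6201bc352f6fb80b0302aa144222aa6a1b8a482685000a07b4e51eb9110281c59ee2b02fa350d7b4b01beaa043e207b03b22140c1d14562501fd27b4e717d81b80e734de93ed1112a457b0eee8b143d37318422a6ded05c686842d05ab3751b40328414aaaba16e8924e0756a155892998904101171443ed45005e03ed470dc010034303a01),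
    (1180592183942251159552, 0, 0x22c365d820068382685a844d000a004002a54ad7b4e5060081eb91176a4102812b02979caec59eeb68ae0f6612b02f02d64a350d7ba057b4b01beaa005c0043e2146ca07b03008a3b93ef2f8aadedb400033b22140c1d14562501fd27b4e717d81b80e7005533d373171443ed45005e03ed470dc010034303a01),
    (1180592184217129066496, 0, 0x22c365d820068305f820012001fa3074c31780a1d06a7b1b07b4b01beaa005c0043e2146ca07b03008a3005533d373039a118422bb72ea6ded822e5b64ce7accf06e8501fb3798ce8924e0756a05fd315589046610e86129989000800410115069171443ed45005e03ed470dc010034303a01),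
    (1180592183667373252608, 159334, 0xd1a000000011015001300020707000300040005),
    (562949961949184, 1345, 0xc0007), (288230376160239616, 1345, 0x1001000d051c),
    (8527872, 86690, 0x800000008010001000e0015),
    (9007216443006980, 0, 0x6830534117949062a101bc37c12f7b9d11b8a4a2e02205a50002316444000a004002a5dad7c925c59eea350d7ba0500e81b702e00543005c0043e217e2130b2a7ba073d033a9fb41b94a003533d37331ceaa6ded822e50ab41eeef4b6b2708c2501be7205f105c6801c32474f1130e465ccf0776314aaa7b9d001be5288021fbe9cabaf8924e000e005a21162a91714400c0100343),
    (9007216443007040, 0, 0x5341aac0d816c51d704a566205a62004c001bc301f23b88477a1311a121205a5000231644482a45a2ecd000a0040020608116c2988dee00e817a42e00543ccd6f30b2af2d343d0331b94a003530ab4101be74484a429d30776314aaa7b9d054702c118e01be528802c5e4e3e9f31d8ea43fa5799908e64f4394503c061610a06c438dfaf000e02a6a90fc210e30129469004e0003430ae01),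
    (9007216443269632, 0, 0x534101bc3205a5000231644400e81005430ab4101be701be528802000e0),
    (9007216577225216, 0, 0x22c329242006830534101bc3b88477a13179b8fb754e1e2ea06f257a1301a121205a5000231644488deec59ee00e810054323189ccd6f30b2af2d343d0333d37331cea0ab41eeef401be701be528802c5e4e3e9f31d8ea43fa5799907a26f1fbe903646071c58e64f4394503c063efb379991cabaf19941b65c78924e8dfaf000e01714402305257c50230700c0105541004e0003430ae01),
    (9232379253297783296, 0, 0x22c329242006831714402305257c50230700c0105541004e0003430ae01),
    (9444741972955733434880, 0, 0x22c305f8229caa004c001bc302e23),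
    (37778940870173604717056, 0, 0x22c3292420068305f8207203a566214c097a13179b8f1e2ea7a13002e23a2e02205a516c2905ce1113e47ba0500e8100543005c0158aa23189ccd6f00963c4d8e822e50ab4101be7205f13a5b416fcf4484a036468e64f29469a83ad171440230505541004e0),
    (9007216443007488, 18114, 0x100020b0a0405040600030c0a0004001600050006),
    (4620697632916905984, 0, 0x68305341aac0d816c51d704a566203fc114c0917949062a1159e9046c105a62004c001bc301f23b88477a13179b8fb754e06f251a1217c12fcb0cf7b9d11b8a4a2e02205a500023000a00400230b2a1b94a21b4983aae0776314aaa7b9d0288021d8ea799907a26f1fbe9071c503c061610a06c4300343),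
    (4620693234870394880, 8804, 0x40804010018000100070008),
    (9007216443006976, 335587, 0x400000004080409041904020019000200080009),
    (9007199263137792, 1345, 0x11000000050b),
    (4611686310493560832, 0, 0x68300023000a00400200543005c0043e230b2a31cea00343),
    (4611686585371467776, 0, 0x6830226305f820012001fa30720316a6a7c170654e2153ca07aa31e2ea7a1301c34a00543005c0043e231ceaa6ded822e50ab4105226eeef4c5e4e43fa50364637ac98e64f43945361e93efb379991cabaf19941b65c7798ce8924e8dfaf1e6057c171a71a21c0a47bbcf9050fb87cf000e02a6a90fc210b0a10e301294690e8612998980ba5a83ad05a21162a9a29421cf0400343),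
    (4611721219987742720, 0, 0x6830226305f8207203816c5a56622abc914c0917949046c1004c001f23a8d4d153caa2e0204002005c083aae822e5077631610a798ce1c0a40fc21294690e861a83ad05a211cf0400343),
    (4611686035615653888, 14242, 0x5010502050000050e05000000010002051e001e),
    (4611686018435784704, 1345, 0x5050000051f), (8396800, 193, 0x50011),
    (21474975744, 0, 0x1d03022c30068305f820012001fa3326ea05a62004c001bc3b754e1e2ea302aa1a12100023000a00400288deec59ee7a94e186e11beaa00543005c0043e2008b3b7cee002f330b2a3d03317d811c72a01f337b0ee022733d37331ceac5e4e3e9f31d8ea3efb3199418924e00343),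
    (4295106560, 1345, 0xf2200000622), (4294975488, 193, 0x120309030000),
    (8192, 1185, 0xa0300000003), (0, 33, 0x20001000000)] = true := by
  decide +kernel

set_option maxHeartbeats 4000000 in
theorem coneOk_3 : coneOk 3 0x988888878888898788878888888887888988888888888888888887898788888888888888888888998888888888888878988898888888888898788888888888888888889878888889888888888888888778888888888888898788878888888888878988888888888888888887898888888888888889888888888888888888889888788888888888888888888878988888888888888898788888888888888888889878888888878888898788888888888888888988878888888888888887898788888988888888888889888888888878888898888878888888887888988888788888988888887898888888888888888888888898888888888888888888878988888887888988898788888888888888888888888888888888888887898888889878888888888888888888887888988888888888888888888898788888888888888888888888888888888888878888888888888888898888888888888888898888888888888888878888888888888888888888888878888888888888888888888898888898888888888888888888888878888888888888888888888888888888888888888888888888888888888888888888888888888888888888889889778888888888888878888888888888888888888888989888888888888888888888888878888888888888888888888888888888888888889888888888888888888888888889888888888888888888888888778 13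
    [0, 518, 1296, 2592, 3888, 5184, 7776, 10368, 10886, 11664, 13478, 14256, 14774, 19958, 22550,
    23328, 26438, 27216, 27734, 30326]
    [
    (8198, 0, 0x22288220048001be3005601442200563000c001fa302064152a10f56105361164640c2640b0a100ea119761152811e625000270a2c40bd04000c401b04004a000e810b0810a22515f0414d410d98100025144c403781000e0005400ab410094117b81),
    (137438962186, 0, 0x5601442200563000c001fa3c168e17a610a3e13dc8e00040081433e6a5462e5081841a0c10e8e1046e11c584123840fec105cc118ae12bf620eda906f05292622924d231a907e0506f0702914353141c9ef00a62255052640500a4d037622d3a918fa902064152a10f56105361164640c2640b0a100ea119761000c401b04004a014d410d98103781000e0005400ab410094117b81),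
    (137439092746, 0, 0x560144220056301fa305d01001204c12ec168e081433e6a5081841a0c1123840fec105cc118ae12bf620eda92924d231a907e0565e4d0280968b6243b0544a05dce34e15efc8a34b9f8722c6502064152a10c2640b0a100ea1197611850416313000c4004a014d41005400ab410094117b81),
    (137573179402, 0, 0x5601442200563000c001fa300120080033e6a5462e5081841a0c10e8e1046e11c584123840fec105cc118ae165e4d0280935f6965e6268b6243b0544a0502064152a10f56105361164640c2640b0a100ea119761000c401b04004a014d410d98103781000e0005400ab410094117b81),
    (171798700042, 0, 0x5601442200563000c00f52e080030e60117a6100040462e5081841a0c10e8e1046e11238418ae12bf620eda906f052924d07e0565e4d0280935f6968b6244a05dce34e15efc8a34b9f87251c502064152a10f561053610c2641976118dc4e365301b04004a014d410d981037810054017b81),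
    (137438961674, 679971, 0x10002000302040004),
    (562984313167882, 0, 0x2882214422000c0a2dc2080033ce5001d2a17a61145e1000401cf24040a8504e5462e508184184732c87308b241a0c10e8e112d24046e11238418ae179a510007297774d4374113e579a87b66873ce5119961b6daf470517a1af071e53d5af18dc4a6a53e36531e625000270bd0401b04004a000e810b0810a22514d410d98100025037810054017b81),
    (565148976685066, 0, 0x14422a6022094ca00120a2dc2080033ce5001d2ac168e17a610a3e13dc8e0004008143040731cf24040a83e6a5462e508184184732c87308b241a0c10e8e112d24046e11c584123840fec105cc118ae13ce8779a51000726ef74d4374113e579a87b66873ce5119961b6daf470517a1af257e5071e50f761055613d5af06f0702914353141c9ef18dc4e36531850416313152811e62500027000c401b04004a000e810b0810a22514d410d9810002503781000e0005400ab410094117b81),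
    (577023702256853002, 0, 0x14422000c0a6022a2dc20800317a61145e147e8e0a3e13dc8e00040081431cf24504e5462e508184184731a0c10e8e1046e11c5840fec179a5197774d4374113e579a8719961b6daf7a1af257e50f76120f14015070cb1430def06f070291400a62255052640500a4d2d3a918dc4a6a53e36531e6250bd0401b04004a000e8114d410d98103781000e00ab41),
    (562949953429514, 8100, 0x1008020000000201000100020a08),
    (9444732965739298824202, 0, 0x288221442200563000c001fa3a6022094ca05d010012041f2ea2dc20f52e08003872ce3ce5001d2a4c12ec168e17a613dc8e08143462e52c8731a0c11238405cc10eda92924d231a9d4374b668719961071e505561353141c9ef0376218fa90280968b62e15efc8a34451ef539140ca0951a4d4dd0509bcd80c650010003fe116fe922c65152a10c26400ea1e3653185041631301b040b08114d410054000941),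
    (9444732967938347245578, 0, 0x1442200563a6022094ca00120a2dc2080030ad41872ce3ce5001d2a4c12e7a88e3dc8e08143462e5081842c87308b2482ee51a0c10e8e105cc1d4374113e5b66873ce51e877419961b6daf0556165e4d0280935f6967d14451ef09bcd0e1e180c655182fa49ed0010029dc916fe91850401b04004a00b0810a22515f0414d410d98100941),
    (9444732967938447908874, 0, 0x144220056300120080030ad41872ce01d2a462e5081842c87308b2482ee51a0c10e8e11238405cc118ae165e4d0280935f6968b6244a0567d14451ef5391444a0701b04004a00b0810a22515f0414d410d981005400094117b81),
    (9445309428690617114634, 0, 0x1442200563a6022a2dc20f52e080030e6014c12e17a617a88e3dc8e0004008143462e5081841a0c10e8e12bf620eda9d4374113e519961b6daf16d14085ef65e4d0280935f69dce34e15ef085ed0e1e10010029dc918dc4e365301b04004a014d410d981),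
    (9447038810947527385098, 0, 0x563a6022a2dc20f52e08003872ce17a61036617a88e3dc8e0004008143462e52c87382ee51a0c10e8e11238405cc10eda92924d231a9d4374b6687e877419961b6daf071e505561085ef2b114353141c9ef085ed80c65a49ed0010029dc903fe116fe918dc4e365301b040b08115f0414d410d9810054000941),
    (9444732967938313691146, 16359, 0x100e000000010007080e00090002000300040405020e000e),
    (9445309426491593859082, 0, 0x1442200563000c0a6022a2dc20532e0f52e080030e6014c12e17a61145e17a88e3dc8e0004008143462e5081841a0c10e8e12bf620eda914e4d04ba911105d4374113e519961b6daf16d14085ef20f140150700a622550565e4d0280935f69dce34e15ef085ed0e1e10010029dc9251c502064152a10f56118dc4a6a53e365301b04004a014d410d981),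
    (47223664828696452145162, 104290, 0x10100200000000070201000102060006),
    (9444732965739290435594, 1153, 0x1011000100080002000c0007),
    (8202, 35, 0x200000010120009020d000d),
    (18014398643707906, 0, 0x22288220048001be3005601442200563000c001fa302064152a10f56105361164640c2640b0a100ea119761152811e625000270a2c40bd04000c401b04004a000e810b0810a22515f0414d410d98100025144c403781000e0005400ab410094117b81),
    (576460752437649410, 0, 0x2201be3005601442200563000c07a4ee08003c3ece198410fc01004e01cf24504e5462e508184184731a0c10e8e17b2a5046e11c5840fec1a2a622bd6981605a2a4d8070565e4d0280935f6965e6243b05d2c34b8defe7034b85474b46502064152a10f56105361164640b0a13eb130e444bdb531e6250bd0401b04004a000e8114d410d981144c403781000e00ab41),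
    (134225922, 182307, 0x30000000001030200020015),
    (576460752303431746, 0, 0x2201be3005601442200563000c005a427a4ee0186a198410e4c10fc0188d2e0b1811a101004e01d8ca694221dfcd5982f8e42f67ded02be933fc903c260ae21355e9a2a622bd6981605a2a4d80705b8907f1234d2c34b8defe7034b854723fd445d8760bd42345145d851a4a11048168bef829852bfef0e865cab734b4651da6402064152a10f56105361164640b0a10410401f13290933eb1300d4117a890e444bdb537e3851e6250bd0401b04004a000e8114d410d981144c403781000e00ab41),
    (576460752303562754, 0, 0x2201be300560144220056305a42c3ece4c12e1984188d2e1a101b748e0d8617a88e08143004e01d8ca6942208184184731a0c17b2a50fec11dfcd02be9355e9a2a62807052bf620eda914e4d04ba9375a9113e579a8719961abb740f76116d14085ef65e4d0280943b05d2c34b8547dce34e15ef23fd445d851a4a12bfef0e1e179a8500100a796d2b3e90e86502064152a10b0a10410401f133eb13004a000e8114d41144c40ab41),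
    (37469948899722534914, 0, 0x22005601442200563a60220e6014c12e88d2e0b1810a3e10d8617a88e3dc8e000400814369422081840e8e11c5840fec133fc90ae21355e9a2a622bd69a2a4d807052bf622926214e4d1110514e62375a9113e5b6daf257e50f761f123416d1420f14015070cb1430def0291400a622550500a4d2d3a965e4d35f6965e6243b05d2c34b8defe7034b8547dce3445d8510481829852bfef0e1e129dc92b3e9020640f561164640b0a1004a00d981000e00ab41),
    (590872271111009083394, 0, 0x2201be300560a602205a420e4c147e8e88d2e0b1811a101b748e0a3e10d8610004008143004e01d8ca694227b2a5046e11c5840fec11dfcd5982f03c260ae21355e981605a2a4d8070506f052926214e62375a9abb747a1af257e50f761b8907f12340cb1430def06f07029142640500a4d2d3a923fd42345168bef829852bfefa796d159c92b3e90e8651da6405361164640b0a10410401f13290937e385144c403781000e00ab41),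
    (576460752303431682, 667075, 0x121a000113050d070e070005000203070003001a),
    (8194, 27748, 0x121b0300000012050d080e08000503080008001b),
    (549755813894, 0, 0x65422288220048001be300020a202202043000c001fa302064152a10f56105361164640c2640b0a100ea11976103861b64273d1650a2c40bd041488414424004a014d410d981037810ac21000240056579d6517c6100484000e0005400ab410094117b81),
    (549755945026, 0, 0x65422288220048001be30002001fa32c822183a119e8a7eb2e1ccaa0642e00f01004e0078836942217d2d0c34514d820c705005a9863147ad079a714aa5ef5198248f455492d20e090d7690e865096644d9c5b677302064152a10c2640b0a100ea119761041046cb5341785118c4a28930dba1038610a2c414884004a014d410056500484005400ab410094117b81),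
    (9345848836162, 0, 0x65422288220048001be32c82219e8a1ccaa004e0078836942204104049c42909369e5300d410e444ba5072d25365c9341785118c47e385151410dba104b8503861b64273d1650a2c40bd04004a014d410d981037810ac21000240056579d6517c6100484000e0005400ab410094117b81),
    (549755813954, 663587, 0x10206010c0900011209),
    (549764333570, 0, 0x2882201be30002001fa32c8220012041f2e153017eb2e00f0108143004e027ce51a0c113a44138e5123840fec105cc148f455492d20e090ca0951a4d4dd050e86522c65b6773152a10c2640b0a100ea1041046cb53a9753185040dba11488414d410056500484005400ab4100941),
    (141287244300290, 0, 0x288220048001fa32c8220012007883488a51238405cc118ae15492d20e090d76951a4d4dd054ec054d9c50c26400ea119761118c40a2c4005400094117b81),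
    (549755944962, 431139, 0x110c00010302090d0005),
    (549755813890, 679971, 0x100110d00000b0d00030006), (2, 1, 0x70806080008),
    (0, 129, 0xf00050002000000)] = true := by
  decide +kernel

/-- From here on a single leaf treats the whole cone, with neither branches nor automorphisms. -/
theorem coneOk_4 : coneOk 4 0x888888988888889888888888888888888878887888888888888889788898888888888888888887888888888788888887888888888889888888898889888888888888888988878888888888888888889778888888988898888888788888888888788888887888888888888888888898888888888889888887888889888888888888888788888888888888888887888888898888888888898888888788889888888878888888888888889888888878888888888878887888988898888888888898888888788888888888888888888888888888888888888888888888888888888888888888888888888889888888889888888778888888888888888888888888888888888888888888888888888888888888888888888888889889778 7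
    []
    [
    (0, 0, 0x4a00d9a117ba10ac0114e01000c000560144c201b03000c3020631eaa5000e50048000a010048300dc1037a1654c20384105281000e1000230096146ee579ca50002011de50e9611a5a1153c1100816b2c201a2308323129b1049e4151610fd61ccb9367793447e53e68505d440b1292972907784000607bb932420505c05ba14e4ab4e693c21626a09a6a7915400e822cceade5542da024618a410ea00e8b04ba5231a5000a001707bdb73416738d554833541de6a0ba0e03d4e188ea16d2d0bc851a3c105162295e20b3c10a4a1195617fb6e1df5489d6e28154077732d273078a379c47e367355a7319d4d45387b7b07b728b4588b453b1045840f6a117e617e3a54ca05183c279f0b0050095373a9773085c331d8ad43540958a6ef54167934b9a57f405c1e0e3e40e56202a71621a2c200140005806ad4d67d2d400aa51de2a2e822bf490542a2bcaa0d94904a08)] = true := by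
  decide +kernel

theorem coneOk_5 : coneOk 5 0x888888788888988888888888889878888888889888888888898888888888888788888888888888878888888988888788888888888888898888888887888888888878889888888887988888887888888898888898888878888888888888888888888888888888898888878888888788888988888887888889888888888788888888888988888888888887888889888878888898888888988888788888888888888888888888888888888888888888888888888888888888888888888888888888887888888887888888998888888888888888888888888888888888888888888888888888888888888887888888887889889888 6
    []
    [
    (0, 0, 0x5600002017ba1037a100ea1152a1000e400001144e41440100540a2002654020ab610056300006b846700b61c1b6e14f6104ee9004c0192e9b796e0010011ea412d0400002144020000700023288027ee70422707facf42ecf195a20404a08dca051a21d1ca1844a4977102b437e193415931bae4076e40e88101ac3008e5017e54222f7ee2f000802b48d01d0a017e710161293941610a008e70b3613359446f9106c43094ea3cd9001243a29421d8ea7999065d42a23af00343657af000602c0cd68b4fa574f03c0503fc50f741086a30466418a64ab6f36eaf302be30a3c1c3074b774702fa30d841b8e74bd147290cd2e64d0214321ca90596e02503101ee0d8a9561a251942)] = true := by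
  decide +kernel

theorem coneOk_6 : coneOk 6 0x8878889888a8888888788888889888688888888889878888898888988888886888878887889888898889888788868888888988888888888a88888888887898888878889788888889888898888887888878887888988898788888888888888898788888888889878888888888888888887888888887889888898888878988898888888788888888888788888988888878888898888888888887888888888889888888888888888888888888888888888888888888888888888888888888888888887888888887888888998888888888888888888888888888888888888888888888888888888888888887888888887889889888 6
    []
    [
    (0, 0, 0xc0144010000100480197610f5610536117ba1037a1005600d9a10a201b64077b8653ec650b0a13ec671e6057b8670a20500007b8467000050000c798057980748e6500ea13cc053cc0746e05152a10ac010206c2066502065020670c26500a0114e01000202d04a03fc2183c2025a32c7c29322fa762f6aa2fcfe2f5662fe422f00de30484a18c4a002a3000802b48d1708d02c8dbba2f2d6e9378e9192e904ee956ea2234e90f0e9803cb437cbbcfcb6b2a24222f7ee2fa7ea2434aa152226606d0cb0951c6d02909296220374f00e22a2c6d20f09548cd2d9a216d0917b4f19bad68a4251e22bc4d0040b02dfad54642057ada5642a2e2242cd0662227f8d004baba58cd68ccd35309195a2051a22b1092bf4f4144a4034f693c2a5fc27cf4f0dfa92c5a92946d223a900c6d181a91506d03da9367a9bafabb9b4f7e3ab417ab54fc20562f00a692914253c8d6808d14d420ac6919a2f2be4214e69567ada4c8d009421f06906bcb51942ba4b0561a22c0cd060d06a5a217ccd65d427d8b0a71a2038cda294240cb02de2f17a42334692926903642a77ad6abad00fc35474f9134f68b4fa574f2f0aacdf4fe234f1a2a205ea22e6a21acaa0214302503068aa00060)]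 = true := by
  decide +kernel

theorem coneOk_7 : coneOk 7 0x888888888878988888888888888888888888888887898888888888898788888888888888888889878888898888878888888888888888888888888888888898888878888888788889988888888888889778888888888888888888888888888888888888888888888888888888888888888888888888889889778888888888888888888888888888888888888888888888888888888888888889888888889888888778888888888888888888888888889888888888888888888888888889888888888888888888888888778 5
    []
    [
    (0, 0, 0xb0a100ea1152a10002000080462aa040880005265d420a251003431708d016e440e33a294202c8d1e605012437da330a205144021e65115ae400002b65902a50a0002301d0a3cd901610a799902946f27d541395400fc306c430dba10aae51eee5bba2fba6330054014401008e53c15400001000067ee2f02503017e54222f31f5402143519422b48d000050056b004a0039a11506f000e00a2011fde50975417da10b9e500c6f1db54000510b8e428802)] = true := by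
  decide +kernel

theorem coneOk_8 : coneOk 8 0x898788888888888888887888988888888888878988888888888888888888888888887898888888888888788889988888888887888888888898888878888888888888888888888888888888898888878888888788889888898888887888988988888888878888888888889888888888788888887898888878888888888888888888888887888988888888888888888888888889878889888788888887898888888888888888887888888888889888888888888888888888889888887888888888988888888878788898888 5
    []
    [
    (0, 0, 0x1896405c841a084045640fe840e764005001d9ea1b98a004e0461ea00040000a04418a1deed694426b3221c90da60420850d5aaed2c842001400758a09aeda7f222e7225950d095ea00120e0ff30102303f41b87f30e281ccbf3baf2b183410a1ec1a3a1bcf4bcab93102e1b679305fa1025c3def930818c6d90d17bc12abf3003930f5e1a43f3155a118b21bc4e70e1418df9340c87100411844204b2b037c100063147930408179b9304087047217e32b00d83040d27d8873cf93011a1002435139318481677f34172b0acc15504230d0daa50d04042005802fd8a1a322167f302083053e106b4b024e38034b7f8e7061327bbf3060e105e41060e76eeed0d9c1023f328b93197e18fff3101a10e92142ce714ec1a2393ba4871a2410b3a14374b657931a4e1533f30212300ac13eff3322ed56f2205f22abaed31dea005e0)] = true := by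
  decide +kernel

theorem coneOk_9 : coneOk 9 0x888888878888888888888788888888888889888888788988888888898887888888988888888888888888888898888889888888888887888988888898888888788888888888888788887888888888888888887888888988888888888888889888888888878888888888887888888889888888788898888888888888888888988888888878888888888988888888888788888887898898888888887888888888888888 4
    []
    [
    (0, 0, 0x19701004a019ec2186c11502117c8107da310fa4145e113b4400100005e06b3023e36a1828d1928a2ca4a000c03de85005c3aaecf063cf6c8ade35cf01b8302fc30204a0280368a4d152a21b06d13c454616f0014065d02e570f296e2519220242f005804bfce45d65c50ee0838305b061c5aa00a6605eaa2e3620678e00aa37e1ee0aba506d234530a56a6247c6e4f3850ac240138303f2104fa604fa53036a7df6e51de24a7e50f0c401143a8e0f29222004ae072830356356f222e742c618e3d08f03ce617aa106fc50a2c91a58118861)] = true := by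
  decide +kernel

theorem coneOk_10 : coneOk 10 0x788888889888888988898888888888988888888888887888878888888887888889788888888888888888888888888887888878888888887888888888888889988888888898888888888988878888888888788898888888887988888888888888888888888888888988878888888887988889888878888888888888888888888887988888888888887888898888888888988878888888888888889888878888888888 4
    []
    [
    (0, 0, 0x480005a02922214e620188307283005c0468d0195e22be2201d2308403000406d42f00f81043c1001400ae815abef0fc41043c6a2d8202ea3075633e810a568205a822cda930e2a1872900fedcccef1e5ea8e5cf1a0210a86501ce501ce75b6b47992e11864b9a136f6f4095e4b68ce7e93320031823657d50500520005e01d2643ccf48312505d61182247bd0548e740e8e146baf101a5468d183fce514b404025c076e4f4516747445f6a469070b3e156f2200be116d0422d09698e236d49186c1a2db3004aeb6e2708e85dfa537bd070a76e1110517c8100100125052be131258400080195d30998509a0400e6f1a58106e640a2c912fe405a685466d020496a62d)] = true := by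
  decide +kernel

theorem coneOk_11 : coneOk 11 0x888888888888888888888888887888888888888888888888888887888888888888888888889889888888888888888888888888888887888888888888888888888888887888888888888888888888888998888888888888888888888888887888888888888888888888888887888888889888888889888888888 3
    []
    [
    (0, 0, 0x288221440200567000020ab6100ea1152a10054000480000c000020005b2045e82023115704005b10d4841558f03a010be31013042b3cf0f7410118f17e0104666086ac)] = true := by
  decide +kernel

theorem coneOk_12 : coneOk 12 0x888888888888888888888888887888888888888888888888888887888888888888888888889889888888888888888888888888888887888888888888888888888888887888888889888888889888888888888888888888888888888888887888888888888888888888888887888888888888888888888888998 3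
    []
    [
    (0, 0, 0x619761053610f5610b0a100ea1152a10056000480000c000020437cb05ea26b2a2839b00008006bcbbcfcb2e6a256ea2c05b00a1b006128803cb1a2a2a7ea246db0)] = true := by
  decide +kernel

theorem coneOk_13 : coneOk 13 0x888888888898888788788888889889788888888888888888887988988888887887888898888888888888888888888888888988888887888888888888888888878889888788888889888988878888888888888888888888888888788898888888888888888888888888887988988878888887888898888888888 3
    []
    [
    (0, 0, 0xa7162a2e82004a006ac8162a41c74400a23191890046125b654408702e63409aa074630152a2a1c9274c5031070e561039660ae618eb8f7fc13152224b1ae11c5455482975d34a0540b8ae00bc67dd2f00bc1b738fbfdd33e2ae6622244654039610050026e250dac12cc8203254d0c13043aeced2f280e500580)] = true := by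
  decide +kernel

theorem coneOk_14 : coneOk 14 0x788888898888888888878988888888889888887788888988888888888878988888889878888888888888888888888898788878988888898889888887888888888878888887888988988888878888888888 2
    []
    [
    (0, 0, 0x5a00e92114025510220144300ce303303a292206e2307465000001a66102ba307ac3662620430125545001001cfcd01be96af620552419ec1cd9b383d14aae4f1648a5afaf004aa3d0b428de9a57220686d0e161a29131d18451573114c4010412a3aab8174d1fef553c22d16d205c91444a1b2c41e709a92afa44f32f02d85cb4101a156fa2005e008a25061c1cbf530482dd3a0f18781a7142b6ad403de42a3a928dea100610002027585693823e71400c81004a901bea12a841b10d5954f52f93121651862100140)] = true := by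
  decide +kernel

theorem coneOk_15 : coneOk 15 0x888888888788888888888878888888788888888888988888889888888898888889888878888888888888888888988888888888888889889888888878888888888887888888888887888788898888888888 2
    []
    [
    (0, 0, 0x18861009a300580004a017aa1037264906500bf151de254dcd2cc020d44946d8a077e3012ea00bf000763bc22e0e941097f3440450e3e14404744ce56598d2edb400bc701161000c00160b002e10daf1152a202e631e1347fdee199210004049ec56984202429)] = true := by
  decide +kernel

theorem coneOk_16 : coneOk 16 0x888878988898888887788889888888888888888888888888888888888888888888888888888888888889878888888988887788888898888888888888888888888888888888888888888888888888888888 2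
    []
    [
    (0, 0, 0x5104265442a2042000804612a06c0301203003033e8aa80965b6447054e1150af0001146e451e611000123cc470e2a143d6500520040a600caf184a1294af0a2113cc4500160198e10a1cc040a14df65005a079845798470f6e1)] = true := by
  decide +kernel

theorem coneOk_17 : coneOk 17 0x887898888888888888888888878888788888888888887888888988988888888888888898888888888889888888878888888888888898888888888988888888888889788788888888888888888888878888 2
    []
    [
    (0, 0, 0x4df6546e455104200080288420b9240030300cafcb4af0014000047000120b0e1b6447a2042b69cb096f40a24100010654424612a1daf4de0f431d2a14442b641001203df8af0ab01f24f4005cb00042150af00500)] = true := by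
  decide +kernel

theorem coneOk_18 : coneOk 18 0x888878888888988888888888888898888888788888889888888878888888888888887888888898888888888888878988888888888888898788888888888888888889878888888888888887898888888888 2
    []
    [
    (0, 0, 0xb6447798473cc470008000047040c83cc1114442654420a21146e1151042288420001100140005cbb69cb0050079dcb00580000a03d1cb0030379810b64100008379811000420001006c03012033cc10a20421e611)] = true := by
  decide +kernel

theorem coneOk_19 : coneOk 19 0x888888888889888788888887898887888988888888888888888888898788888888888888888888888 1
    []
    [
    (0, 0, 0x176840012000080054410f6410402240c2718681002c3002a86cb6d2f88a05d245876d09bcf79d6e4b1c51b48ab696e0002201f030ff2440fc50088314de1)] = true := by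
  decide +kernel

/-- With exactly 16 zeros the cone is simplicial: there are no equations, and each zero gives one
ray. -/
theorem coneOk_20 : coneOk 20 0 0
    []
    [
    (0, 0, 0x5a03cceaa56e20e7a109c3102d630050009c673d14e1e44f1df440db412c842074a30324d253c5)] = true := by
  decide +kernel

/-! ### The polytope is the convex hull of the known matrices -/

theorem rigid_listed : ∀ j : Fin 21, rigid j = true := by decide +kernel

theorem hasWitness_listed (j : Fin 21) (hj : j ≠ 0) : ∀ x ∈ balanced,
    (∀ α, IsZero j α → 0 ≤ x α) → x ≠ 0 → HasWitness j x := by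
  intro x hx hpos hne
  have hr := rigid_listed j
  fin_cases j
  · exact absurd rfl hj
  · exact hasWitness_of_coneOk hr coneOk_1 hx hpos hne
  · exact hasWitness_of_coneOk hr coneOk_2 hx hpos hne
  · exact hasWitness_of_coneOk hr coneOk_3 hx hpos hne
  · exact hasWitness_of_coneOk hr coneOk_4 hx hpos hne
  · exact hasWitness_of_coneOk hr coneOk_5 hx hpos hne
  · exact hasWitness_of_coneOk hr coneOk_6 hx hpos hne
  · exact hasWitness_of_coneOk hr coneOk_7 hx hpos hne
  · exact hasWitness_of_coneOk hr coneOk_8 hx hpos hne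
  · exact hasWitness_of_coneOk hr coneOk_9 hx hpos hne
  · exact hasWitness_of_coneOk hr coneOk_10 hx hpos hne
  · exact hasWitness_of_coneOk hr coneOk_11 hx hpos hne
  · exact hasWitness_of_coneOk hr coneOk_12 hx hpos hne
  · exact hasWitness_of_coneOk hr coneOk_13 hx hpos hne
  · exact hasWitness_of_coneOk hr coneOk_14 hx hpos hne
  · exact hasWitness_of_coneOk hr coneOk_15 hx hpos hne
  · exact hasWitness_of_coneOk hr coneOk_16 hx hpos hne
  · exact hasWitness_of_coneOk hr coneOk_17 hx hpos hne
  · exact hasWitness_of_coneOk hr coneOk_18 hx hpos hne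
  · exact hasWitness_of_coneOk hr coneOk_19 hx hpos hne
  · exact hasWitness_of_coneOk hr coneOk_20 hx hpos hne

/-- The known matrices that are not equivalent to the first one. -/
def others : Set (MultiMatrix 4 3) :=
  {B | ∃ i ≠ 0, MultiMatrix.Equivalent (MultiMatrix.listed i) B}

theorem others_subset : others ⊆ known := fun _ ⟨i, _, h⟩ => ⟨i, h⟩

/-- The local statement at every known matrix outside the first class, the only place where the cone
enumerations enter. -/
theorem le_of_mem_others {C : MultiMatrix 4 3} (hC : C ∈ others) {f : MultiMatrix 4 3 →ₗ[ℝ] ℝ}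
    (hf : ∀ B ∈ known, f B ≤ f C) {p : MultiMatrix 4 3}
    (hp : p ∈ MultiMatrix.birkhoffPolytope 4 3) : f p ≤ f C := by
  obtain ⟨i, hi, h⟩ := hC
  exact le_of_equivalent (fun f hf p hp => le_of_hasWitness (hasWitness_listed i hi) hf hp) h hf hp

theorem mem_others_or {B : MultiMatrix 4 3} (h : B ∈ known) :
    B ∈ others ∨ ∃ (r : Fin 8) (b : Fin 3), B = levelMatrix r b := by
  obtain ⟨i, h⟩ := h
  by_cases hi : i = 0
  · subst hi
    exact Or.inr (exists_levelMatrix h)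
  · exact Or.inl ⟨i, hi, h⟩

theorem finite_known : known.Finite := by
  refine Set.Finite.subset (Set.finite_range fun q : Fin 21 × Equiv.Perm (Fin 4 → Fin 3) =>
    MultiMatrix.listed q.1 ∘ q.2) ?_
  rintro B ⟨i, h⟩
  obtain ⟨γ, -, rfl⟩ := equivalent_iff.1 h
  exact ⟨(i, γ), rfl⟩

/-- The constant array with line sums `1`. -/
def center : MultiMatrix 4 3 := fun _ => 1 / 3

theorem center_mem : center ∈ MultiMatrix.birkhoffPolytope 4 3 := by
  refine ⟨fun α => ?_, fun i α => ?_⟩ <;> norm_num [center]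

/-- The sum of all entries vanishes on the balanced array `p - center`. Its being constant on the
polytope lets affine functions there be written as linear functionals. -/
theorem sum_entries {p : MultiMatrix 4 3} (hp : p ∈ MultiMatrix.birkhoffPolytope 4 3) :
    ∑ α, p α = 27 := by
  have h := sum_mul_eq_dot 4 (fun _ => (1, 0)) _
    (flatBalanced_of_balanced (sub_mem_balanced hp center_mem))
  rw [dot_of_allZero (by decide +kernel)] at h
  simp only [val, Pi.sub_apply, Nat.cast_one, Nat.cast_zero, sub_zero, one_mul] at h
  rw [show 3 ^ 4 = 81 from rfl, ← sum_cell fun α => p α - center α,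
    Finset.sum_sub_distrib, sub_eq_zero] at h
  rw [h]
  simp [center]
  norm_num

theorem sum_map_levelMatrix (f : MultiMatrix 4 3 →ₗ[ℝ] ℝ) (r : ℕ) :
    ∑ b : Fin 3, f (levelMatrix r b) = 3 * f center := by
  rw [← map_sum, ← smul_eq_mul, ← map_smul]
  congr 1
  funext α
  rw [Finset.sum_apply, sum_levelMatrix]
  simp [center]

/-- The center is the mean of the three levels of any other form, and each of these has level sum
`9`. -/
theorem levelSum_center (r : Fin 8) (b : Fin 3) : levelSum r b center = 9 := by
  obtain ⟨s, hs⟩ := exists_ne r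
  have h := sum_map_levelMatrix (levelSum r b) s
  simp only [levelSum_levelMatrix hs.symm] at h
  norm_num at h
  linarith

/-- A balanced array as a combination of indicators of levels. -/
theorem eq_sum_levelMatrix {x : MultiMatrix 4 3} (hx : x ∈ balanced) :
    (27 : ℝ) • x = ∑ r : Fin 8, ∑ b : Fin 3, levelSum r b x • levelMatrix r b := by
  funext α
  rw [Pi.smul_apply, smul_eq_mul, ← sum_levelSum hx, Finset.sum_apply]
  refine Finset.sum_congr rfl fun r _ => ?_
  rw [Finset.sum_apply,
    Finset.sum_eq_single (⟨direction r (code α), direction_lt _ _⟩ : Fin 3)]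
  · simp [levelMatrix]
  · intro b _ hb
    have : direction r (code α) ≠ b := fun h => hb (Fin.ext h.symm)
    simp [levelMatrix, this]
  · simp

theorem sum_levelSum_eq (r : ℕ) (x : MultiMatrix 4 3) :
    ∑ b : Fin 3, levelSum r b x = ∑ α, x α := by
  simp only [levelSum_apply]
  rw [Finset.sum_comm]
  refine Finset.sum_congr rfl fun α _ => ?_
  rw [← Finset.sum_mul, sum_levelMatrix, one_mul]

/-- The deficit of the sums over the given levels; as a functional it is at most `1` at the
matrices equivalent to the first one. -/
def deficit (β : Fin 8 → Fin 3) : MultiMatrix 4 3 →ₗ[ℝ] ℝ :=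
  (8 / 27 : ℝ) • ∑ α, LinearMap.proj α - (1 / 9 : ℝ) • ∑ r : Fin 8, levelSum r (β r)

theorem deficit_apply (β : Fin 8 → Fin 3) {p : MultiMatrix 4 3}
    (hp : p ∈ MultiMatrix.birkhoffPolytope 4 3) :
    deficit β p = 8 - (∑ r : Fin 8, levelSum r (β r) p) / 9 := by
  have := sum_entries hp
  simp only [deficit, LinearMap.sub_apply, LinearMap.smul_apply, LinearMap.sum_apply,
    LinearMap.proj_apply, this, smul_eq_mul]
  ring

/-- An upper bound for a functional in terms of its maximum over the matrices equivalent to the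
first one. -/
theorem le_deficit {f : MultiMatrix 4 3 →ₗ[ℝ] ℝ} {m : ℝ}
    (hf : ∀ (r : Fin 8) (b : Fin 3), f (levelMatrix r b) ≤ m) {p : MultiMatrix 4 3}
    (hp : p ∈ MultiMatrix.birkhoffPolytope 4 3) {β : Fin 8 → Fin 3}
    (hβ : ∀ (r : Fin 8) (b : Fin 3), levelSum r (β r) p ≤ levelSum r b p) :
    f p ≤ f center + (m - f center) * deficit β p := by
  have hx := sub_mem_balanced hp center_mem
  have h := congrArg f (eq_sum_levelMatrix hx)
  simp only [map_smul, map_sum, map_sub, smul_eq_mul, levelSum_center] at h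
  have hr (r : Fin 8) : ∑ b : Fin 3, (levelSum r b p - 9) * f (levelMatrix r b) ≤
      (m - f center) * (27 - 3 * levelSum r (β r) p) := by
    -- Subtracting the smallest level sum makes the weights nonnegative, so `f (levelMatrix r b)`
    -- may be replaced by its bound `m`. The shift is controlled because the sum of these values of
    -- `f` over `b` is known.
    have h1 : ∑ b : Fin 3, (levelSum r b p - levelSum r (β r) p) * f (levelMatrix r b) ≤
        ∑ b : Fin 3, (levelSum r b p - levelSum r (β r) p) * m :=
      Finset.sum_le_sum fun b _ => mul_le_mul_of_nonneg_left (hf r b) (sub_nonneg.2 (hβ r b))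
    have h2 := sum_map_levelMatrix f r
    have h3 := (sum_levelSum_eq r p).trans (sum_entries hp)
    simp only [Fin.sum_univ_three] at h1 h2 h3 ⊢
    linear_combination h1 + m * h3 + (levelSum r (β r) p - 9) * h2
  have hsum := Finset.sum_le_sum fun r (_ : r ∈ Finset.univ) => hr r
  rw [← h, ← Finset.mul_sum, Finset.sum_sub_distrib, ← Finset.mul_sum] at hsum
  simp only [Finset.sum_const, Finset.card_univ, Fintype.card_fin, nsmul_eq_mul] at hsum
  rw [deficit_apply β hp]
  norm_num at hsum
  nlinarith

/-- If the maximum is attained outside the first class, the local statement applies. Otherwise `f`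
is deformed towards `g` until the maximum is also attained outside that class, while the value at
`p` stays above it. -/
theorem exists_le {f : MultiMatrix 4 3 →ₗ[ℝ] ℝ} {p : MultiMatrix 4 3}
    (hp : p ∈ MultiMatrix.birkhoffPolytope 4 3) : ∃ B ∈ known, f p ≤ f B := by
  obtain ⟨C, hC, hmax⟩ := Set.exists_max_image known f finite_known ⟨_, listed_mem_known 0⟩
  refine ⟨C, hC, ?_⟩
  by_contra! hlt
  have hothers : ∀ B ∈ others, f B < f C := by
    intro B hB
    refine lt_of_le_of_ne (hmax B (others_subset hB)) fun h => ?_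
    have := le_of_mem_others hB (f := f) (fun B' hB' => h ▸ hmax B' hB') hp
    linarith
  have hlevel (r : Fin 8) (b : Fin 3) : f (levelMatrix r b) ≤ f C :=
    hmax _ (levelMatrix_mem_known r b)
  have hcenter : f center ≤ f C := by
    have h := sum_map_levelMatrix f (0 : Fin 8)
    rw [Fin.sum_univ_three] at h
    linarith [hlevel 0 0, hlevel 0 1, hlevel 0 2]
  choose β hβ using fun r : Fin 8 =>
    Finite.exists_min fun b : Fin 3 => levelSum r b p
  -- The upper bound of `le_deficit` as a linear functional; the constant `f center` is expressed
  -- through the sum of the entries, which is `27`.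
  set g : MultiMatrix 4 3 →ₗ[ℝ] ℝ :=
    (f center / 27) • ∑ α, LinearMap.proj α + (f C - f center) • deficit β
  have hg {q : MultiMatrix 4 3} (hq : q ∈ MultiMatrix.birkhoffPolytope 4 3) :
      g q = f center + (f C - f center) * deficit β q := by
    simp only [g, LinearMap.add_apply, LinearMap.smul_apply, LinearMap.sum_apply,
      LinearMap.proj_apply, sum_entries hq, smul_eq_mul]
    ring
  have hgp : f C < g p := by
    rw [hg hp]
    exact hlt.trans_le (le_deficit hlevel hp hβ)
  have hglevel (r : Fin 8) (b : Fin 3) : g (levelMatrix r b) ≤ f C := by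
    have hmem := known_subset (levelMatrix_mem_known r b)
    have := le_sum_levelSum_levelMatrix β r b
    rw [hg hmem, deficit_apply β hmem]
    nlinarith
  have hfin : {B ∈ others | f C ≤ g B}.Finite :=
    finite_known.subset fun B hB => others_subset hB.1
  have hne : {B ∈ others | f C ≤ g B}.Nonempty := by
    -- A level sum total of at most `63` means a deficit of at least `8 - 63 / 9 = 1`, hence `f C ≤
    -- g B`.
    obtain ⟨B, hB, hsmall⟩ := exists_small_sum β
    have hmem := mem_birkhoffPolytope_of_equivalent hB (listed_mem_birkhoffPolytope 1)
    refine ⟨B, ⟨1, by decide, hB⟩, ?_⟩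
    rw [hg hmem, deficit_apply β hmem]
    nlinarith
  -- The ratio is the parameter at which `(1 - t) • f + t • g` takes the value `f C` at `B`. The
  -- least one belongs to the matrix reached first on the way from `f` to `g`.
  obtain ⟨D, ⟨hD, hgD⟩, hmin⟩ := Set.exists_min_image _
    (fun B => (f C - f B) / (g B - f B)) hfin hne
  have hfD := hothers D hD
  set t := (f C - f D) / (g D - f D)
  have ht0 : 0 < t := div_pos (by linarith) (by linarith)
  have ht1 : t ≤ 1 := (div_le_one (by linarith)).2 (by linarith)
  have htD : (1 - t) * f D + t * g D = f C := by
    have : t * (g D - f D) = f C - f D := div_mul_cancel₀ _ (by linarith)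
    linarith
  have happly (q : MultiMatrix 4 3) : ((1 - t) • f + t • g) q = (1 - t) * f q + t * g q := rfl
  have := le_of_mem_others hD (f := (1 - t) • f + t • g) (fun B hB => ?_) hp
  · rw [happly, happly, htD] at this
    nlinarith
  · rw [happly, happly, htD]
    -- Outside the first class the choice of `t` gives the bound, or else `f` and `g` are both below
    -- `f C`. On the first class both are at most `f C`.
    rcases mem_others_or hB with hB | ⟨r, b, rfl⟩
    · have hfB := hothers B hB
      by_cases hgB : f C ≤ g B
      · have := hmin B ⟨hB, hgB⟩
        rw [le_div_iff₀ (by linarith)] at this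
        linarith
      · nlinarith
    · nlinarith [hlevel r b, hglevel r b]

/-! ### The convex hull and its extreme points -/

theorem birkhoffPolytope_subset :
    MultiMatrix.birkhoffPolytope 4 3 ⊆ convexHull ℝ known := by
  intro p hp
  by_contra hn
  have hclosed : IsClosed (convexHull ℝ known) := finite_known.isClosed_convexHull ℝ
  obtain ⟨f, u, hf, hu⟩ := geometric_hahn_banach_closed_point (convex_convexHull ℝ known) hclosed hn
  obtain ⟨B, hB, h⟩ := exists_le (f := (f : MultiMatrix 4 3 →ₗ[ℝ] ℝ)) hp
  have h1 := hf B (subset_convexHull ℝ known hB)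
  have h2 : f p ≤ f B := h
  linarith

theorem convex_birkhoffPolytope : Convex ℝ (MultiMatrix.birkhoffPolytope 4 3) := by
  intro x hx y hy a b ha hb hab
  refine ⟨fun α => ?_, fun i α => ?_⟩
  · have h1 := hx.1 α
    have h2 := hy.1 α
    simp only [Pi.add_apply, Pi.smul_apply, smul_eq_mul]
    positivity
  · simp only [Pi.add_apply, Pi.smul_apply, smul_eq_mul, Finset.sum_add_distrib,
      ← Finset.mul_sum, hx.2 i α, hy.2 i α]
    linarith

theorem vertices_subset : MultiMatrix.vertices 4 3 ⊆ known := by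
  intro A hA
  have h : convexHull ℝ known = MultiMatrix.birkhoffPolytope 4 3 :=
    (convexHull_min known_subset convex_birkhoffPolytope).antisymm birkhoffPolytope_subset
  rw [MultiMatrix.vertices, ← h] at hA
  exact extremePoints_convexHull_subset hA

/-! ### The listed matrices are pairwise inequivalent vertices -/

/-- If the matrix lies inside a segment of the polytope, nonnegativity makes the end points vanish
at all its zeros, and rigidity makes them equal to it. -/
theorem listed_mem_vertices (i : Fin 21) : MultiMatrix.listed i ∈ MultiMatrix.vertices 4 3 := by
  have hv := listed_mem_birkhoffPolytope i
  refine ⟨hv, ?_⟩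
  rintro x hx y hy ⟨a, b, ha, hb, -, h⟩
  refine sub_eq_zero.1 (eq_zero_of_rigid (rigid_listed i) (sub_mem_balanced hx hv) fun α hα => ?_)
  have h0 := listed_eq_zero.2 hα
  have := congrFun h α
  simp only [Pi.add_apply, Pi.smul_apply, smul_eq_mul] at this
  rw [Pi.sub_apply, h0, sub_zero]
  rw [h0] at this
  have h1 := hx.1 α
  have h2 := mul_nonneg hb.le (hy.1 α)
  have h3 := mul_nonneg ha.le h1
  exact (mul_eq_zero.1 (by linarith : a * x α = 0)).resolve_left ha.ne'

/-- The number of common coordinates of two indices. -/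
def common (α β : Fin 4 → Fin 3) : ℕ := ∑ i, if α i = β i then 1 else 0

/-- Equivalences preserve the Hamming distance of indices. -/
theorem common_move {γ : Equiv.Perm (Fin 4 → Fin 3)} (hγ : γ ∈ moves) (α β : Fin 4 → Fin 3) :
    common (γ α) (γ β) = common α β := by
  obtain ⟨σ, τ, rfl⟩ := hγ
  simp only [common, move_apply, EmbeddingLike.apply_eq_iff_eq]
  exact Equiv.sum_comp σ fun i => if α i = β i then 1 else 0

/-- A quantity that depends only on the equivalence class of a matrix. -/
def invariant (A : MultiMatrix 4 3) : ℝ :=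
  ∑ α, ∑ β, A α ^ 2 * A β ^ 2 * (common α β : ℝ) ^ 2

theorem invariant_eq_of_equivalent {A B : MultiMatrix 4 3} (h : MultiMatrix.Equivalent A B) :
    invariant B = invariant A := by
  obtain ⟨γ, hγ, rfl⟩ := equivalent_iff.1 h
  simp only [invariant]
  rw [← Equiv.sum_comp γ fun α => ∑ β, A α ^ 2 * A β ^ 2 * (common α β : ℝ) ^ 2]
  refine Finset.sum_congr rfl fun α _ => ?_
  rw [← Equiv.sum_comp γ fun β => A (γ α) ^ 2 * A β ^ 2 * (common (γ α) β : ℝ) ^ 2]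
  simp only [common_move hγ, Function.comp_apply]

/-- The sum of `f c` over `c < n`. -/
def sumBelow (n : ℕ) (f : ℕ → ℕ) : ℕ :=
  @Nat.rec (fun _ => ℕ) 0 (fun k ih => Nat.add ih (f k)) n

theorem sumBelow_eq (n : ℕ) (f : ℕ → ℕ) : sumBelow n f = ∑ c ∈ Finset.range n, f c := by
  induction n with
  | zero => rfl
  | succ n ih => rw [Finset.sum_range_succ, ← ih]; rfl

def sameDigit (c d k : ℕ) : ℕ :=
  @Bool.rec (fun _ => ℕ) 0 1
    (Nat.beq (Nat.mod (Nat.div c k) 3) (Nat.mod (Nat.div d k) 3))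

def sameDigits (c d : ℕ) : ℕ :=
  Nat.add (Nat.add (sameDigit c d 27) (sameDigit c d 9))
    (Nat.add (sameDigit c d 3) (sameDigit c d 1))

theorem common_cell (c d : ℕ) : common (cell c) (cell d) = sameDigits c d := by
  have h {k : ℕ} {i : Fin 4} (hc : cell c i = Fin.ofNat 3 (c / k))
      (hd : cell d i = Fin.ofNat 3 (d / k)) :
      (if cell c i = cell d i then 1 else 0) = sameDigit c d k := by
    rw [sameDigit, boolRec_eq, hc, hd]
    refine if_congr ?_ rfl rfl
    rw [natBeq_eq_true, Fin.ext_iff]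
    rfl
  rw [common, Fin.sum_univ_four, h (k := 27) rfl rfl, h (k := 9) rfl rfl, h (k := 3) rfl rfl,
    h (k := 1) (by simp [cell]) (by simp [cell]), add_assoc]
  rfl

/-- The invariant of the listed matrix number `j`, multiplied by the fourth power of the
denominator. -/
def scaledInvariant (j : ℕ) : ℕ :=
  sumBelow 81 fun c => @Nat.rec (fun _ => ℕ) 0
    (fun n _ => force (Nat.mul (Nat.succ n) (Nat.succ n)) fun n2 =>
      Nat.mul n2 (sumBelow 81 fun d => @Nat.rec (fun _ => ℕ) 0
        (fun m _ => force (Nat.mul (Nat.succ m) (sameDigits c d)) fun e => Nat.mul e e)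
        (numerator j d)))
    (numerator j c)

theorem natRec_eq {α : Type} (n : ℕ) (a : α) (f : ℕ → α) :
    @Nat.rec (fun _ => α) a (fun n _ => f n) n = if n = 0 then a else f (n - 1) := by
  cases n <;> rfl

theorem scaledInvariant_eq (j : ℕ) : scaledInvariant j = ∑ c ∈ Finset.range 81,
    ∑ d ∈ Finset.range 81, numerator j c ^ 2 * numerator j d ^ 2 * sameDigits c d ^ 2 := by
  simp only [scaledInvariant, sumBelow_eq, natRec_eq, force_eq]
  refine Finset.sum_congr rfl fun c _ => ?_
  split_ifs with h
  · simp [h]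
  · change (numerator j c - 1 + 1) * (numerator j c - 1 + 1) * _ = _
    rw [Nat.sub_add_cancel (Nat.pos_of_ne_zero h), Finset.mul_sum]
    refine Finset.sum_congr rfl fun d _ => ?_
    split_ifs with h'
    · simp [h']
    · change _ * ((numerator j d - 1 + 1) * sameDigits c d *
        ((numerator j d - 1 + 1) * sameDigits c d)) = _
      rw [Nat.sub_add_cancel (Nat.pos_of_ne_zero h')]
      ring

theorem invariant_listed (i : Fin 21) :
    invariant (MultiMatrix.listed i) * (MultiMatrix.listedDenominator i : ℝ) ^ 4 =
      scaledInvariant i := by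
  have hD : (MultiMatrix.listedDenominator i : ℝ) ≠ 0 := by
    exact_mod_cast (listedDenominator_pos i).ne'
  rw [scaledInvariant_eq, invariant, sum_cell]
  push_cast
  rw [Finset.sum_mul]
  refine Finset.sum_congr rfl fun c hc => ?_
  rw [sum_cell, Finset.sum_mul]
  refine Finset.sum_congr rfl fun d hd => ?_
  rw [common_cell, listed_apply, listed_apply, code_cell (Finset.mem_range.1 hc),
    code_cell (Finset.mem_range.1 hd)]
  field_simp

def invariantTable : Fin 21 → ℕ :=
  ![1944, 11168, 9792, 9056, 44856, 43544, 43448, 140544, 144320, 39224, 39320, 131456,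
    328280, 129920, 36864, 125280, 297432, 315848, 692288, 123200, 294776]

theorem scaledInvariant_table : ∀ i : Fin 21, scaledInvariant i = invariantTable i := by
  decide +kernel

/-- The rational invariants are compared after clearing denominators. This proves that the 21
classes are distinct. -/
theorem invariantTable_injective : ∀ i k : Fin 21,
    invariantTable i * MultiMatrix.listedDenominator k ^ 4 =
      invariantTable k * MultiMatrix.listedDenominator i ^ 4 → i = k := by
  decide +kernel

theorem eq_of_equivalent {i k : Fin 21} {A : MultiMatrix 4 3}
    (hi : MultiMatrix.Equivalent (MultiMatrix.listed i) A)
    (hk : MultiMatrix.Equivalent (MultiMatrix.listed k) A) : i = k := by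
  refine invariantTable_injective i k ?_
  have h := (invariant_eq_of_equivalent hi).symm.trans (invariant_eq_of_equivalent hk)
  have h1 := invariant_listed i
  have h2 := invariant_listed k
  rw [scaledInvariant_table] at h1 h2
  have : (invariantTable i : ℝ) * (MultiMatrix.listedDenominator k : ℝ) ^ 4 =
      invariantTable k * (MultiMatrix.listedDenominator i : ℝ) ^ 4 := by
    rw [← h1, ← h2, h]
    ring
  exact_mod_cast this

/-! ### Support sizes and permanents -/

theorem card_support : ∀ i : Fin 21,
    (Finset.univ.filter fun α : Fin 4 → Fin 3 => numerator i (code α) ≠ 0).card =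
      MultiMatrix.listedSupportSize i := by
  decide +kernel

theorem supportSize_listed (i : Fin 21) :
    (MultiMatrix.listed i).supportSize = MultiMatrix.listedSupportSize i := by
  rw [← card_support, MultiMatrix.supportSize, ← Set.ncard_coe_finset]
  congr 1
  ext α
  simp [listed_eq_zero]

/-- The index with first coordinate `k` of the diagonal given by three permutations. -/
def diagonalPoint (π : Fin 3 → Equiv.Perm (Fin 3)) (k : Fin 3) : Fin 4 → Fin 3 :=
  Fin.cons k fun i => π i k

theorem diagonalPoint_injective (π : Fin 3 → Equiv.Perm (Fin 3)) :
    Function.Injective (diagonalPoint π) := fun _ _ h => congrFun h 0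

theorem diagonalPoint_ne (π : Fin 3 → Equiv.Perm (Fin 3)) {k l : Fin 3} (h : k ≠ l) (i : Fin 4) :
    diagonalPoint π k i ≠ diagonalPoint π l i := by
  refine Fin.cases ?_ (fun i => ?_) i
  · exact h
  · simpa [diagonalPoint] using h

/-- Every coordinate is a bijection from a diagonal to `Fin 3`, so with the first coordinate as
parameter the other three become permutations. This replaces a sum over sets of indices by `6 ^ 3`
terms. -/
theorem permanent_eq (A : MultiMatrix 4 3) :
    A.permanent = ∑ π : Fin 3 → Equiv.Perm (Fin 3), ∏ k, A (diagonalPoint π k) := by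
  symm
  refine Finset.sum_nbij (fun π => Finset.univ.image (diagonalPoint π)) (fun π _ => ?_) ?_ ?_
    fun π _ => ?_
  · simp only [MultiMatrix.diagonals, Finset.mem_filter, Finset.mem_powersetCard,
      Finset.subset_univ, true_and]
    refine ⟨by rw [Finset.card_image_of_injective _ (diagonalPoint_injective π)]; rfl, ?_⟩
    intro α hα β hβ hne
    obtain ⟨k, -, rfl⟩ := Finset.mem_image.1 hα
    obtain ⟨l, -, rfl⟩ := Finset.mem_image.1 hβ
    exact diagonalPoint_ne π fun h => hne (by rw [h])
  · intro π _ π' _ h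
    funext i
    ext1 k
    have hk : diagonalPoint π k ∈ Finset.univ.image (diagonalPoint π') := by
      have h : Finset.univ.image (diagonalPoint π) = Finset.univ.image (diagonalPoint π') := h
      rw [← h]
      exact Finset.mem_image_of_mem _ (Finset.mem_univ k)
    obtain ⟨l, -, hl⟩ := Finset.mem_image.1 hk
    obtain rfl : l = k := congrFun hl 0
    exact (congrFun hl i.succ).symm
  · intro l hl
    simp only [MultiMatrix.diagonals, Finset.coe_filter, Finset.mem_powersetCard,
      Finset.subset_univ, true_and, Set.mem_ofPred_eq] at hl
    obtain ⟨hcard, hne⟩ := hl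
    have hbij (i : Fin 4) : Function.Bijective fun α : l => α.1 i := by
      rw [Fintype.bijective_iff_injective_and_card]
      refine ⟨fun α β h => ?_, by simp [hcard]⟩
      by_contra hαβ
      exact hne α.1 α.2 β.1 β.2 (fun h' => hαβ (Subtype.ext h')) i h
    -- The permutations sought are the transition maps from coordinate `0` to the others.
    let e (i : Fin 4) : l ≃ Fin 3 := Equiv.ofBijective _ (hbij i)
    have hpoint (α : l) : diagonalPoint (fun i => (e 0).symm.trans (e i.succ)) (e 0 α) = α.1 := by
      funext i
      refine Fin.cases rfl (fun i => ?_) i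
      simp [diagonalPoint, e]
    refine ⟨fun i => (e 0).symm.trans (e i.succ), Finset.mem_coe.2 (Finset.mem_univ _), ?_⟩
    ext α
    simp only [Finset.mem_image, Finset.mem_univ, true_and]
    constructor
    · rintro ⟨k, rfl⟩
      obtain ⟨β, rfl⟩ := (e 0).surjective k
      rw [hpoint]
      exact β.2
    · intro hα
      exact ⟨e 0 ⟨α, hα⟩, hpoint ⟨α, hα⟩⟩
  · rw [Finset.prod_image (diagonalPoint_injective π).injOn]

/-- The permanents of the listed matrices, multiplied by the cubes of the denominators. -/
def scaledPermanent : Fin 21 → ℕ :=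
  ![27, 84, 72, 66, 256, 255, 255, 616, 624, 236, 236, 600, 1194, 584, 234, 576, 1074, 1141, 2040,
    580, 1115]

theorem sum_diagonals : ∀ i : Fin 21, ∑ π : Fin 3 → Equiv.Perm (Fin 3),
    ∏ k, numerator i (code (diagonalPoint π k)) = scaledPermanent i := by
  decide +kernel

theorem permanent_listed (i : Fin 21) :
    (MultiMatrix.listed i).permanent = MultiMatrix.listedPermanent i := by
  have h : (MultiMatrix.listed i).permanent =
      (scaledPermanent i : ℝ) / (MultiMatrix.listedDenominator i : ℝ) ^ 3 := by
    rw [permanent_eq, ← sum_diagonals]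
    push_cast
    rw [Finset.sum_div]
    refine Finset.sum_congr rfl fun π _ => ?_
    simp only [listed_apply, Finset.prod_div_distrib, Finset.prod_const, Finset.card_univ,
      Fintype.card_fin]
  rw [h]
  fin_cases i <;>
    norm_num [scaledPermanent, MultiMatrix.listedDenominator, MultiMatrix.listedPermanent]

/-! ### Symmetric matrices -/

theorem numerator_comp : ∀ i ∈ MultiMatrix.listedSymmetric, ∀ (σ : Equiv.Perm (Fin 4))
    (c : Fin 81), numerator i (code fun k => cell c (σ k)) = numerator i c := by
  decide +kernel

theorem isSymmetric_listed {i : Fin 21} (hi : i ∈ MultiMatrix.listedSymmetric) :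
    (MultiMatrix.listed i).IsSymmetric := by
  intro σ α
  have := numerator_comp i hi σ ⟨code α, code_lt α⟩
  simp only [cell_code] at this
  rw [listed_apply, listed_apply, this]

/-- Numbers of permutations of the directions which do not belong to automorphisms of the listed
matrices, if these are not symmetric. -/
def twist : Fin 21 → Fin 24 :=
  ![0, 1, 2, 0, 1, 1, 0, 6, 0, 1, 2, 6, 0, 2, 1, 2, 6, 1, 0, 2, 1]

theorem allBelow_of {n : ℕ} {f : ℕ → Bool} (h : ∀ c < n, f c = true) : allBelow n f = true := by
  induction n with
  | zero => rfl
  | succ n ih =>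
    change @Bool.rec (fun _ => Bool) false (allBelow n f) (f n) = true
    rw [h n n.lt_succ_self]
    exact ih fun c hc => h c (hc.trans n.lt_succ_self)

/-- One permutation of the directions suffices for each matrix: none of its `6 ^ 4` combinations
with permutations of hyperplanes is an automorphism. -/
theorem not_isAut : ∀ i ∉ MultiMatrix.listedSymmetric, allBelow 1296 (fun t =>
    @Bool.rec (fun _ => Bool) true false (isAut i (Nat.add (1296 * (twist i : ℕ)) t))) = true := by
  decide +kernel

/-- Conjugating the symmetries of `B` by the equivalence turns them into automorphisms of the listed
matrix. These induce every permutation of the directions, in particular the one that `not_isAut`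
excludes. -/
theorem mem_listedSymmetric {i : Fin 21} {B : MultiMatrix 4 3}
    (h : MultiMatrix.Equivalent (MultiMatrix.listed i) B) (hB : B.IsSymmetric) :
    i ∈ MultiMatrix.listedSymmetric := by
  by_contra hi
  obtain ⟨σ, τ, h⟩ := h
  obtain ⟨s, hs⟩ := exists_perm4 (twist i)
  obtain ⟨t, ht, hact⟩ := exists_number s (fun k => τ k * (τ (s k))⁻¹) hs
  have key (α : Fin 4 → Fin 3) :
      MultiMatrix.listed i (move s (fun k => τ k * (τ (s k))⁻¹) α) = MultiMatrix.listed i α := by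
    -- The equivalence is evaluated at the preimage of `α` and at that preimage permuted by `σ * s *
    -- σ⁻¹`. The conjugation makes the induced permutation of directions equal to `s`.
    have h1 := h (fun k => (τ (σ⁻¹ k))⁻¹ (α (σ⁻¹ k)))
    have h2 := h (fun k => (τ (σ⁻¹ ((σ * s * σ⁻¹) k)))⁻¹ (α (σ⁻¹ ((σ * s * σ⁻¹) k))))
    have h3 := hB (σ * s * σ⁻¹) (fun k => (τ (σ⁻¹ k))⁻¹ (α (σ⁻¹ k)))
    rw [h3, h1] at h2
    simp only [Equiv.Perm.coe_mul, Function.comp_apply, Equiv.Perm.coe_inv,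
      Equiv.symm_apply_apply, Equiv.apply_symm_apply] at h2
    exact h2.symm
  have := of_allBelow (not_isAut i hi) t ht
  rw [boolRec_eq] at this
  have haut : isAut i (Nat.add (1296 * (twist i : ℕ)) t) = true := by
    rw [isAut, withAct_eq]
    refine allBelow_of fun c hc => natBeq_eq_true.2 ?_
    have hD : (MultiMatrix.listedDenominator i : ℝ) ≠ 0 := by
      exact_mod_cast (listedDenominator_pos i).ne'
    have := key (cell c)
    rw [listed_apply, listed_apply, div_left_inj' hD, ← hact, code_cell hc] at this
    exact_mod_cast this
  rw [if_pos haut] at this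
  cases this

end Polystochastic

open Polystochastic

/-! ### The classification of the vertices -/

theorem mainTheorem2 :
    -- there are exactly 21 equivalence classes of vertices, and exactly 6 of them contain a
    -- symmetric vertex
    Nat.card (MultiMatrix.VertexClass 4 3) = 21 ∧
    Nat.card {c : MultiMatrix.VertexClass 4 3 //
      ∃ A : MultiMatrix.vertices 4 3,
        Quotient.mk (MultiMatrix.vertexSetoid 4 3) A = c ∧ A.1.IsSymmetric} = 6 ∧
    -- the listed matrices are vertices, and each vertex is equivalent to exactly one of them
    (∀ i, MultiMatrix.listed i ∈ MultiMatrix.vertices 4 3) ∧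
    (∀ A ∈ MultiMatrix.vertices 4 3, ∃! i, MultiMatrix.Equivalent (MultiMatrix.listed i) A) ∧
    -- the support sizes and the permanents of the listed matrices
    (∀ i, (MultiMatrix.listed i).supportSize = MultiMatrix.listedSupportSize i) ∧
    (∀ i, (MultiMatrix.listed i).permanent = MultiMatrix.listedPermanent i) ∧
    -- the symmetric ones: in the list, and among all vertices up to equivalence
    (∀ i, (MultiMatrix.listed i).IsSymmetric ↔ i ∈ MultiMatrix.listedSymmetric) ∧
    (∀ A ∈ MultiMatrix.vertices 4 3, A.IsSymmetric →
      ∃ i ∈ MultiMatrix.listedSymmetric, MultiMatrix.Equivalent (MultiMatrix.listed i) A) := by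
  -- Injectivity is the separation by the invariant; surjectivity is the convex hull description.
  -- The counts of classes follow from this bijection and its restriction to the symmetric matrices.
  have hclass : Function.Bijective fun i : Fin 21 =>
      Quotient.mk (MultiMatrix.vertexSetoid 4 3) ⟨MultiMatrix.listed i, listed_mem_vertices i⟩ := by
    constructor
    · intro i k h
      exact eq_of_equivalent (Quotient.exact h) (MultiMatrix.Equivalent.refl _)
    · intro c
      induction c using Quotient.inductionOn with
      | _ A =>
        obtain ⟨i, hi⟩ := vertices_subset A.2
        exact ⟨i, Quotient.sound hi⟩
  refine ⟨?_, ?_, listed_mem_vertices, fun A hA => ?_, supportSize_listed, permanent_listed,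
    fun i => ⟨fun h => mem_listedSymmetric (MultiMatrix.Equivalent.refl _) h, isSymmetric_listed⟩,
    fun A hA h => ?_⟩
  · rw [← Nat.card_eq_of_bijective _ hclass, Nat.card_fin]
  · have hsym : Function.Bijective fun i : MultiMatrix.listedSymmetric =>
        (⟨_, ⟨MultiMatrix.listed i.1, listed_mem_vertices i.1⟩, rfl, isSymmetric_listed i.2⟩ :
          {c : MultiMatrix.VertexClass 4 3 // ∃ A : MultiMatrix.vertices 4 3,
            Quotient.mk (MultiMatrix.vertexSetoid 4 3) A = c ∧ A.1.IsSymmetric}) := by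
      constructor
      · intro i k h
        exact Subtype.ext (hclass.1 (Subtype.ext_iff.1 h))
      · rintro ⟨_, A, rfl, hA⟩
        obtain ⟨i, hi⟩ := vertices_subset A.2
        exact ⟨⟨i, mem_listedSymmetric hi hA⟩, Subtype.ext (Quotient.sound hi)⟩
    rw [← Nat.card_eq_of_bijective _ hsym, Nat.card_eq_fintype_card, Fintype.card_coe]
    rfl
  · obtain ⟨i, hi⟩ := vertices_subset hA
    exact ⟨i, hi, fun k hk => eq_of_equivalent hk hi⟩
  · obtain ⟨i, hi⟩ := vertices_subset hA
    exact ⟨i, mem_listedSymmetric hi h, hi⟩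

end
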